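/- Let $j\ge 1$ be an integer, $\frac{2-j}{2}\le s<1$ and $0<\epsilon<\frac{1}{10000(2j+1)}$. Write $\langle x\rangle=(1+x^2)^{1/2}$, $\mathbf T=\mathbb R/2\pi\mathbb Z$, $\hat f(k)=\frac1{2\pi}\int_0^{2\pi}e^{-ikx}f(x)\,dx$, $\|f\|_{H^r}^2=\sum_{k\in\mathbb Z}\langle k\rangle^{2r}|\hat f(k)|^2$. Let $\varphi$ be a smooth nonincreasing function with $\varphi(r)=1$ for $r\le 1$ and $\varphi(r)=r^{s-1}$ for $r\ge 2$, and for $N\ge 1$ let $I=I_N$ be the Fourier multiplier $\widehat{If}(k)=m(k)\hat f(k)$, $m(k)=\varphi(|k|/N)$. Put $$\|v\|_{X_{r,b}}=\Big\|\langle k\rangle^{r}\big\langle\tau+(-1)^jk^{2j+1}\big\rangle^{b}\,\mathscr Fv(k,\tau)\Big\|_{L^2(k,\tau)},$$ where $\mathscr F$ is the Fourier transform in $x$ (as above) and in $t$ (with $\frac1{2\pi}\int_{\mathbb R} e^{-it\tau}f(t)\,dt$), and $\|w\|_{X^\delta_{r,b}}=\inf\{\|v\|_{X_{r,b}}: v|_{[0,\delta]}=w\}$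 (equal to $\infty$ if there is no such $v$). By a solution on $[0,\delta]$ we mean a real-valued $u\in C([0,\delta];H^s(\mathbf T))$ with $\int_{\mathbf T}u(x,0)\,dx=0$ which satisfies $$u_t-u_{txx}+\partial_x^{2j+1}u-\partial_x^{2j+3}u+3uu_x-2u_xu_{xx}-uu_{xxx}=0$$ in the time-integrated sense in every spatial Fourier mode, the nonlinear term being understood as the limit, as $K\to\infty$, of the nonlinear terms of the frequency truncations $P_Ku$ onto $|k|\le K$. That is, for all $t\in[0,\delta]$ and $k\in\mathbb Z$, with $w_K=P_Ku$, $$(1+k^2)\big(\hat u(k,t)-\hat u(k,0)\big)+\int_0^t\Big[\big((ik)^{2j+1}-(ik)^{2j+3}\big)\hat u(k,r)+\big(3w_K\partial_xw_K-2\partial_xw_K\partial_x^2w_K-w_K\partial_x^3w_K\big)^{\wedge}(k,r)\Big]dr\longrightarrow 0\quad(K\to\infty).$$ Then there is a constant $C>0$, depending only on $j,s,\epsilon,\varphi$, such that for all $N\ge1$, all $\delta>0$ and every solution $u$ on $[0,\delta]$, $$\Big|\|Iu(\delta)\|_{H^1}^2-\|Iu(0)\|_{H^1}^2\Big|\le C\,\delta^{\frac{j}{2j+1}-2\epsilon}\,N^{-j}\,\|Iu\|_{X^{\delta}_{1,1/2}}^3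 .$$ -/

import Mathlib

open MeasureTheory Filter Topology
open scoped FourierTransform ContDiff ENNReal

namespace ShallowWater

noncomputable section

/-! A periodic distribution `f` on the circle `ℝ / 2πℤ` is represented by the sequence
`a : ℤ → ℂ` of its Fourier coefficients, `a k = (2π)⁻¹ ∫ e^{-ikx} f(x) dx`; a time-dependent one
by `u : ℝ → ℤ → ℂ`, where `u t k` is the `k`-th coefficient at time `t`. -/

/-- The bracket `⟨x⟩ = (1 + x²)^{1/2}`. -/
def bracket (x : ℝ) : ℝ := Real.sqrt (1 + x ^ 2)

/-- Membership in the Sobolev space `H^s` of the circle. -/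
def MemSobolev (s : ℝ) (a : ℤ → ℂ) : Prop :=
  Summable fun k : ℤ => bracket k ^ (2 * s) * ‖a k‖ ^ 2

/-- The norm of `H^s`, meaningful for `a` with `MemSobolev s a`. -/
def sobolevNorm (s : ℝ) (a : ℤ → ℂ) : ℝ :=
  Real.sqrt (∑' k : ℤ, bracket k ^ (2 * s) * ‖a k‖ ^ 2)

/-- The derivative `∂ₓⁿ`. -/
def fourierDeriv (n : ℕ) (a : ℤ → ℂ) (k : ℤ) : ℂ := (Complex.I * (k : ℂ)) ^ n * a k

/-- The `k`-th Fourier coefficient of the product `(P_K f)(P_K g)`, where `a`, `b` are the Fourier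
coefficients of `f`, `g` and `P_K` is the projection on the frequencies `|l| ≤ K`. -/
def truncProd (K : ℕ) (a b : ℤ → ℂ) (k : ℤ) : ℂ :=
  ∑ l ∈ (Finset.Icc (-(K : ℤ)) (K : ℤ)).filter (fun l => |k - l| ≤ (K : ℤ)), a l * b (k - l)

/-- The `k`-th Fourier coefficient of `3 w wₓ - 2 wₓ wₓₓ - w wₓₓₓ` for `w = P_K f`. -/
def truncNonlin (K : ℕ) (a : ℤ → ℂ) (k : ℤ) : ℂ :=
  3 * truncProd K a (fourierDeriv 1 a) k - 2 * truncProd K (fourierDeriv 1 a) (fourierDeriv 2 a) k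
    - truncProd K a (fourierDeriv 3 a) k

/-- `u ∈ C([0, δ]; H^s)` is a real-valued solution with mean zero initial value of
`u_t - u_{txx} + ∂ₓ^{2j+1} u - ∂ₓ^{2j+3} u + 3 u uₓ - 2 uₓ uₓₓ - u uₓₓₓ = 0` on `[0, δ]`.
For `s < 1` the products are not products of functions; the nonlinear term is the limit of the
nonlinear terms of the frequency truncations `P_K u`, and the equation is the time-integrated one,
in the sense of distributions in `x`, that is, in every Fourier mode. -/
structure IsSolution (j : ℕ) (s δ : ℝ) (u : ℝ → ℤ → ℂ) : Prop where
  mem : ∀ t ∈ Set.Icc 0 δ, MemSobolev s (u t)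
  cont : ∀ t₀ ∈ Set.Icc 0 δ,
    Tendsto (fun t => sobolevNorm s (u t - u t₀)) (𝓝[Set.Icc 0 δ] t₀) (𝓝 0)
  real : ∀ t ∈ Set.Icc 0 δ, ∀ k : ℤ, u t (-k) = starRingEnd ℂ (u t k)
  mean_zero : u 0 0 = 0
  equation : ∀ t ∈ Set.Icc 0 δ, ∀ k : ℤ,
    Tendsto
      (fun K : ℕ => ((u t k - fourierDeriv 2 (u t) k) - (u 0 k - fourierDeriv 2 (u 0) k))
        + ∫ r in (0 : ℝ)..t,
            (fourierDeriv (2 * j + 1) (u r) k - fourierDeriv (2 * j + 3) (u r) k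
              + truncNonlin K (u r) k))
      atTop (𝓝 0)

/-- The profiles of the multiplier of the operator `I`: smooth, nonincreasing, equal to `1` up to
`1` and to `r ^ (s - 1)` from `2` on. -/
structure IsProfile (s : ℝ) (φ : ℝ → ℝ) : Prop where
  smooth : ContDiff ℝ ∞ φ
  anti : Antitone φ
  eq_one : ∀ r ≤ 1, φ r = 1
  eq_rpow : ∀ r, 2 ≤ r → φ r = r ^ (s - 1)

/-- The operator `I`, with multiplier `m(k) = φ(|k| / N)`. -/
def opI (φ : ℝ → ℝ) (N : ℝ) (a : ℤ → ℂ) (k : ℤ) : ℂ := (φ (|(k : ℝ)| / N) : ℂ) * a k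

/-- The phase `P(k) = (-1)^j k^{2j+1}`: free waves live on `τ + P(k) = 0`. -/
def phase (j : ℕ) (k : ℤ) : ℝ := (-1) ^ j * (k : ℝ) ^ (2 * j + 1)

/-- The (Plancherel) Fourier transform in time, `(2π)⁻¹ ∫ e^{-itτ} f(t) dt`. -/
def timeFourier (f : Lp ℂ 2 (volume : Measure ℝ)) (τ : ℝ) : ℂ :=
  ((2 * Real.pi)⁻¹ : ℝ) * (𝓕 f : Lp ℂ 2 (volume : Measure ℝ)) (τ / (2 * Real.pi))

/-- The norm of `X_{s,b}`, for `b ≥ 0`. An element of `X_{s,b}` is given by its spatial Fourier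
coefficients `v k`, which are square integrable in time because `b ≥ 0`. -/
def xNorm (j : ℕ) (s b : ℝ) (v : ℤ → Lp ℂ 2 (volume : Measure ℝ)) : ℝ≥0∞ :=
  (∑' k : ℤ, ∫⁻ τ : ℝ, ENNReal.ofReal
    (bracket k ^ (2 * s) * bracket (τ + phase j k) ^ (2 * b) * ‖timeFourier (v k) τ‖ ^ 2))
    ^ (1 / 2 : ℝ)

/-- The restriction norm of `X_{s,b}^δ`: the infimum of the norms of the extensions of `w` from
`[0, δ]` to all times (`∞` if there is no extension in `X_{s,b}`). -/
def xNormOn (j : ℕ) (s b δ : ℝ) (w : ℝ → ℤ → ℂ) : ℝ≥0∞ :=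
  ⨅ (v : ℤ → Lp ℂ 2 (volume : Measure ℝ))
    (_ : ∀ k : ℤ, ∀ᵐ t ∂(volume.restrict (Set.Icc 0 δ)), v k t = w t k), xNorm j s b v

end

end ShallowWater

namespace ShallowWater

/-! ### Sums of two odd powers and the resonance function -/

/-! Dividing the equation of the `k`-th mode by `1 + k²` leaves the free phase of the space `X`.
Symmetrising the nonlinear term in `l` and `k - l` turns its symbol into `(ik/2) * quad`, where
`quad` is symmetric in the three frequencies `l`, `k - l`, `-k` of sum zero. So the increment of the
energy of `Iu` is a sum over `k₁ + k₂ + k₃ = 0` of `m(k₃)² k₃ quad` times the imaginary part of `∫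
u_{k₁} u_{k₂} u_{k₃}`, up to sign. Letting each frequency play the role of `k₃` replaces this
coefficient by a third of `(∑ m(kᵢ)² kᵢ) quad`. It vanishes when all `|kᵢ| ≤ N`, and in general it
is at most `C (kmax/N)^j ∏ m(kᵢ)⟨kᵢ⟩` (`exists_symbol_le`). This yields `N^{-j}` and leaves the
weight `kmax^j` to be paid for.

The payment comes from the resonance function `res`, the sum of the three phases, which is at least
a multiple of `kmin * kmax^{2j}`. Hence `kmax^j` is bounded by `kmin^{-1/2} |res|^{1/2}`. On the
Fourier side the restriction to an interval of length at most `δ` gives the kernel `2 δ^θ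
|σ|^{-(1-θ)}`, where `σ` is the sum of the three modulations minus `res`. So either `|σ|` or one of
the modulations is comparable to `|res|` (`exists_kernel_le`). If `|σ|` is large, a kernel of
exponent `-γ` with `γ = 1/2 - θ > 0` is left over, and it yields both decay in `σ` and the extra
power of `kmin` needed for summation. If a modulation is large, the corresponding factor absorbs its
half power into `L²` (`exists_tsum_high_le`). There, far from resonance, the bilinear convolution
gains a small power of `kmin`. Near resonance, at most two choices of the second frequency compete
for a given first frequency and modulation, because distinct values of `res` are separated by a
multiple of the first frequency.

The rest is justification at low regularity. The equation holds only after integration in time, and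
its nonlinear term only as a limit of truncations. The energy identity is therefore derived with
Steklov differences (`hasSum_energy`), for which the same Fourier bounds, uniform under time
translation, give dominated convergence. Translation is harmless because it does not change moduli
of Fourier transforms. The solution is never replaced by its extension: `FourierDom` records only
that its modes, tested on subintervals, are controlled by the moduli of the transform of an
extension, and the infimum over extensions is taken at the very end. -/

/-- With `D = d ^ 2`, the pair consists of `(a + d) ^ (2 n + 1) + (a - d) ^ (2 n + 1)` and of
`((a + d) ^ (2 n + 1) - (a - d) ^ (2 n + 1)) / d`. -/
noncomputable def oddPowPair (a D : ℝ) : ℕ → ℝ × ℝ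
  | 0 => (2 * a, 2)
  | n + 1 => ((a ^ 2 + D) * (oddPowPair a D n).1 + 2 * a * D * (oddPowPair a D n).2,
      (a ^ 2 + D) * (oddPowPair a D n).2 + 2 * a * (oddPowPair a D n).1)

/-- The recursion is multiplication by `(a ± d)² = (a² + D) ± 2ad`, separated into parts even and
odd in `d`. -/
theorem oddPowPair_eq (a d : ℝ) (n : ℕ) :
    (a + d) ^ (2 * n + 1) + (a - d) ^ (2 * n + 1) = (oddPowPair a (d ^ 2) n).1 ∧
      (a + d) ^ (2 * n + 1) - (a - d) ^ (2 * n + 1) = d * (oddPowPair a (d ^ 2) n).2 := by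
  induction n with
  | zero => simp [oddPowPair]; constructor <;> ring
  | succ n ih =>
    obtain ⟨h1, h2⟩ := ih
    have e1 : (a + d) ^ (2 * (n + 1) + 1) = (a + d) ^ 2 * (a + d) ^ (2 * n + 1) := by ring
    have e2 : (a - d) ^ (2 * (n + 1) + 1) = (a - d) ^ 2 * (a - d) ^ (2 * n + 1) := by ring
    constructor
    · simp only [oddPowPair, e1, e2]
      linear_combination (a ^ 2 + d ^ 2) * h1 + 2 * a * d * h2
    · simp only [oddPowPair, e1, e2]
      linear_combination 2 * a * d * h1 + (a ^ 2 + d ^ 2) * h2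

/-- All coefficients of the recursion are nonnegative and nondecreasing in `D`. -/
theorem oddPowPair_mono {a D D' : ℝ} (ha : 0 ≤ a) (hD' : 0 ≤ D') (h : D' ≤ D) (n : ℕ) :
    0 ≤ (oddPowPair a D' n).1 ∧ (oddPowPair a D' n).1 ≤ (oddPowPair a D n).1 ∧
      0 ≤ (oddPowPair a D' n).2 ∧ (oddPowPair a D' n).2 ≤ (oddPowPair a D n).2 := by
  induction n with
  | zero => simp [oddPowPair, ha]
  | succ n ih =>
    obtain ⟨h1, h2, h3, h4⟩ := ih
    have h2' := h1.trans h2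
    have h4' := h3.trans h4
    have hD := hD'.trans h
    simp only [oddPowPair]
    refine ⟨by positivity, ?_, by positivity, ?_⟩ <;> gcongr

theorem le_oddPowPair_snd {a D : ℝ} (ha : 0 ≤ a) (hD : 0 ≤ D) (n : ℕ) :
    2 * (a ^ 2 + D) ^ n ≤ (oddPowPair a D n).2 := by
  induction n with
  | zero => simp [oddPowPair]
  | succ n ih =>
    have h1 := (oddPowPair_mono ha hD le_rfl n).1
    simp only [oddPowPair]
    have : 0 ≤ 2 * a * (oddPowPair a D n).1 := by positivity
    have h2 : (a ^ 2 + D) * (2 * (a ^ 2 + D) ^ n) ≤ (a ^ 2 + D) * (oddPowPair a D n).2 := by gcongr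
    calc 2 * (a ^ 2 + D) ^ (n + 1) = (a ^ 2 + D) * (2 * (a ^ 2 + D) ^ n) := by ring
      _ ≤ _ := by linarith

/-- Of the terms in the difference of the two recursion steps only `2a(D - D')` times the second
component is kept; the others are nonnegative by monotonicity. -/
theorem le_oddPowPair_sub {a D D' : ℝ} (ha : 0 ≤ a) (hD' : 0 ≤ D') (h : D' ≤ D) (n : ℕ) :
    4 * a * (D - D') * (a ^ 2 + D) ^ n ≤
      (oddPowPair a D (n + 1)).1 - (oddPowPair a D' (n + 1)).1 := by
  obtain ⟨h1, h2, h3, h4⟩ := oddPowPair_mono ha hD' h n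
  have h5 := le_oddPowPair_snd ha (hD'.trans h) n
  have h6 : (2 * a * (D - D')) * (2 * (a ^ 2 + D) ^ n)
      ≤ (2 * a * (D - D')) * (oddPowPair a D n).2 :=
    mul_le_mul_of_nonneg_left h5 (mul_nonneg (by positivity) (by linarith))
  have h7 : 0 ≤ (a ^ 2 + D) * ((oddPowPair a D n).1 - (oddPowPair a D' n).1) :=
    mul_nonneg (by linarith [sq_nonneg a]) (by linarith)
  have h8 : 0 ≤ (D - D') * (oddPowPair a D' n).1 := mul_nonneg (by linarith) h1
  have h9 : 0 ≤ 2 * a * D' * ((oddPowPair a D n).2 - (oddPowPair a D' n).2) :=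
    mul_nonneg (by positivity) (by linarith)
  simp only [oddPowPair]
  nlinarith

/-- A sum of two equal odd powers depends only on the half-sum `a` and on `D`, the square of the
half-difference. Pairs with the same sum share `a`, and the difference of their products is `D' -
D`, so growth in `D` gives the bound. -/
theorem le_abs_oddPow_sub {x y x' y' : ℝ} (h : x + y = x' + y') (n : ℕ) :
    2 * |x + y| * |x * y - x' * y'| * ((x ^ 2 + y ^ 2) / 2) ^ n ≤
      |x ^ (2 * n + 3) + y ^ (2 * n + 3) - (x' ^ (2 * n + 3) + y' ^ (2 * n + 3))| := by
  wlog hs : 0 ≤ x + y generalizing x y x' y' with H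
  · have := @H (-x) (-y) (-x') (-y') (by linarith) (by linarith)
    have ho : Odd (2 * n + 3) := ⟨n + 1, by ring⟩
    rw [ho.neg_pow, ho.neg_pow, ho.neg_pow, ho.neg_pow] at this
    have e1 : -x + -y = -(x + y) := by ring
    have e2 : -x ^ (2 * n + 3) + -y ^ (2 * n + 3) - (-x' ^ (2 * n + 3) + -y' ^ (2 * n + 3))
      = -(x ^ (2 * n + 3) + y ^ (2 * n + 3) - (x' ^ (2 * n + 3) + y' ^ (2 * n + 3))) := by ring
    rw [e1, e2, abs_neg, abs_neg] at this
    simpa using this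
  have key : ∀ u v : ℝ, u + v = x + y → u ^ (2 * n + 3) + v ^ (2 * n + 3)
      = (oddPowPair ((x + y) / 2) (((u - v) / 2) ^ 2) (n + 1)).1 := by
    intro u v huv
    have := (oddPowPair_eq ((x + y) / 2) ((u - v) / 2) (n + 1)).1
    rw [← this, ← huv]
    congr 2 <;> ring
  rw [key x y rfl, key x' y' h.symm]
  set D := ((x - y) / 2) ^ 2 with hD
  set D' := ((x' - y') / 2) ^ 2 with hD'
  have e : x * y - x' * y' = D' - D := by
    rw [hD, hD']
    have : y' = x + y - x' := by linarith
    subst this; ring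
  have e2 : (x ^ 2 + y ^ 2) / 2 = ((x + y) / 2) ^ 2 + D := by rw [hD]; ring
  rw [e, e2, abs_of_nonneg hs]
  rcases le_total D' D with h1 | h1
  · have := le_oddPowPair_sub (a := (x + y) / 2) (by positivity) (by positivity : 0 ≤ D') h1 n
    rw [abs_of_nonpos (by linarith)]
    refine le_trans (le_of_eq (by ring)) (this.trans (le_abs_self _))
  -- Here the bound carries `a ^ 2 + D'`, which dominates `a ^ 2 + D = (x ^ 2 + y ^ 2) / 2`.
  · have := le_oddPowPair_sub (a := (x + y) / 2) (by positivity) (by positivity : 0 ≤ D) h1 n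
    rw [abs_of_nonneg (by linarith), abs_sub_comm]
    refine le_trans ?_ (this.trans (le_abs_self _))
    have h2 : (((x + y) / 2) ^ 2 + D) ^ n ≤ (((x + y) / 2) ^ 2 + D') ^ n := by gcongr
    have h3 : 0 ≤ 4 * ((x + y) / 2) * (D' - D) := mul_nonneg (by positivity) (by linarith)
    nlinarith [mul_le_mul_of_nonneg_left h2 h3]

/-- The values at two different decompositions `k + l` of an integer are far apart. -/
theorem le_abs_oddPow_sub_int {j : ℕ} (hj : 1 ≤ j) {s k k' : ℤ} (h1 : k ≠ k')
    (h2 : k + k' ≠ s) :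
    2 / 4 ^ (j - 1) * |(s : ℝ)| ≤
      |(k : ℝ) ^ (2 * j + 1) + ((s - k : ℤ) : ℝ) ^ (2 * j + 1)
        - ((k' : ℝ) ^ (2 * j + 1) + ((s - k' : ℤ) : ℝ) ^ (2 * j + 1))| := by
  obtain ⟨n, rfl⟩ : ∃ n, j = n + 1 := ⟨j - 1, by omega⟩
  rcases eq_or_ne s 0 with rfl | hs
  · simp
  have := le_abs_oddPow_sub (x := (k : ℝ)) (y := ((s - k : ℤ) : ℝ)) (x' := (k' : ℝ))
    (y' := ((s - k' : ℤ) : ℝ)) (by push_cast; ring) n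
  have e : 2 * (n + 1) + 1 = 2 * n + 3 := by ring
  rw [e]
  refine le_trans ?_ this
  have e1 : (k : ℝ) + ((s - k : ℤ) : ℝ) = s := by push_cast; ring
  -- The two excluded coincidences are exactly the zeros of this product of integers, so its
  -- absolute value is at least `1`.
  have e2 : (k : ℝ) * ((s - k : ℤ) : ℝ) - (k' : ℝ) * ((s - k' : ℤ) : ℝ)
      = ((k' - k) * (k + k' - s) : ℤ) := by push_cast; ring
  have e3 : (1 : ℝ) ≤ |(((k' - k) * (k + k' - s) : ℤ) : ℝ)| := by
    rw [← Int.cast_abs]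
    exact_mod_cast Int.one_le_abs (mul_ne_zero (sub_ne_zero.2 h1.symm) (sub_ne_zero.2 h2))
  have e4 : (1 / 4 : ℝ) ≤ ((k : ℝ) ^ 2 + ((s - k : ℤ) : ℝ) ^ 2) / 2 := by
    have : (1 : ℝ) ≤ (s : ℝ) ^ 2 := by
      have : (1 : ℤ) ≤ s ^ 2 := Int.one_le_abs hs |>.trans (by
        rw [← sq_abs]; nlinarith [Int.one_le_abs hs])
      exact_mod_cast this
    push_cast
    nlinarith [sq_nonneg ((s : ℝ) - 2 * k)]
  rw [e1, e2]
  have e5 : (1 / 4 : ℝ) ^ n ≤ (((k : ℝ) ^ 2 + ((s - k : ℤ) : ℝ) ^ 2) / 2) ^ n := by gcongr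
  calc 2 / 4 ^ (n + 1 - 1) * |(s : ℝ)| = 2 * |(s : ℝ)| * 1 * (1 / 4) ^ n := by
        rw [Nat.add_sub_cancel, one_div, inv_pow]; ring
    _ ≤ _ := by gcongr

/-- Lower bound for the resonance function. -/
theorem le_resonance {j : ℕ} (hj : 1 ≤ j) {x y z K : ℝ} (h : x + y + z = 0)
    (hK : K ≤ |x| ∨ K ≤ |y| ∨ K ≤ |z|) (hK0 : 0 ≤ K) :
    2 / 4 ^ (j - 1) * (|x| * |y| * |z|) * K ^ (2 * j - 2) ≤
      |x ^ (2 * j + 1) + y ^ (2 * j + 1) + z ^ (2 * j + 1)| := by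
  obtain ⟨n, rfl⟩ : ∃ n, j = n + 1 := ⟨j - 1, by omega⟩
  -- The pair `(x, y)` is compared with `(0, -z)`, which has the same sum and product zero.
  have := le_abs_oddPow_sub (x := x) (y := y) (x' := 0) (y' := -z) (by linarith) n
  have ho : Odd (2 * n + 3) := ⟨n + 1, by ring⟩
  have e : 2 * (n + 1) + 1 = 2 * n + 3 := by ring
  rw [ho.neg_pow, zero_pow (by omega), zero_add, sub_neg_eq_add, zero_mul, sub_zero, abs_mul,
    show x + y = -z by linarith, abs_neg] at this
  rw [e]
  refine le_trans ?_ this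
  -- Whichever of the three frequencies is large, `x ^ 2 + y ^ 2` sees it, at the cost of the `4`
  -- whose power appears in the constant.
  have h4 : K ^ 2 / 4 ≤ (x ^ 2 + y ^ 2) / 2 := by
    have hz : z ^ 2 ≤ 2 * (x ^ 2 + y ^ 2) := by
      have : z = -(x + y) := by linarith
      subst this; nlinarith [sq_nonneg (x - y)]
    have : K ^ 2 ≤ 2 * (x ^ 2 + y ^ 2) := by
      rcases hK with h | h | h
      · have := pow_le_pow_left₀ hK0 h 2
        rw [sq_abs] at this; nlinarith [sq_nonneg x, sq_nonneg y]
      · have := pow_le_pow_left₀ hK0 h 2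
        rw [sq_abs] at this; nlinarith [sq_nonneg x, sq_nonneg y]
      · have := pow_le_pow_left₀ hK0 h 2
        rw [sq_abs] at this; linarith
    linarith
  have h5 : (K ^ 2 / 4) ^ n ≤ ((x ^ 2 + y ^ 2) / 2) ^ n := by gcongr
  calc 2 / 4 ^ (n + 1 - 1) * (|x| * |y| * |z|) * K ^ (2 * (n + 1) - 2)
      = 2 * |z| * (|x| * |y|) * (K ^ 2 / 4) ^ n := by
        rw [show 2 * (n + 1) - 2 = 2 * n by omega, Nat.add_sub_cancel, div_pow, pow_mul]; ring
    _ ≤ _ := by gcongr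

/-! ### The multiplier of the operator `I` -/

theorem one_le_bracket (x : ℝ) : 1 ≤ bracket x :=
  Real.one_le_sqrt.2 (by nlinarith [sq_nonneg x])

theorem bracket_pos (x : ℝ) : 0 < bracket x := zero_lt_one.trans_le (one_le_bracket x)

theorem abs_le_bracket (x : ℝ) : |x| ≤ bracket x :=
  Real.abs_le_sqrt (by linarith)

theorem sq_bracket (x : ℝ) : bracket x ^ 2 = 1 + x ^ 2 :=
  Real.sq_sqrt (by positivity)

namespace IsProfile

variable {s : ℝ} {φ : ℝ → ℝ}

theorem pos (h : IsProfile s φ) (r : ℝ) : 0 < φ r := by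
  have h1 : φ (max r 2) ≤ φ r := h.anti (le_max_left _ _)
  rw [h.eq_rpow _ (le_max_right _ _)] at h1
  exact lt_of_lt_of_le (Real.rpow_pos_of_pos (lt_max_of_lt_right two_pos) _) h1

theorem le_one (h : IsProfile s φ) (r : ℝ) : φ r ≤ 1 := by
  have h1 : φ r ≤ φ (min r 1) := h.anti (min_le_left _ _)
  rwa [h.eq_one _ (min_le_right _ _)] at h1

/-- For `q ≥ 2` doubling costs `2 ^ (s - 1)`; for `q ≤ 2` the value at `2 * q` is at least `φ 4 = 4
^ (s - 1)`. -/
theorem doubling (h : IsProfile s φ) (hs1 : s < 1) {p q : ℝ} (hq : 0 ≤ q) (hpq : p ≤ 2 * q) :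
    4 ^ (s - 1) * φ q ≤ φ p := by
  refine le_trans ?_ (h.anti hpq)
  rcases le_total q 2 with h2 | h2
  · have h4 : φ 4 ≤ φ (2 * q) := h.anti (by linarith)
    rw [h.eq_rpow 4 (by norm_num)] at h4
    have : (0 : ℝ) < 4 ^ (s - 1) := by positivity
    nlinarith [h.le_one q]
  · rw [h.eq_rpow q h2, h.eq_rpow (2 * q) (by linarith), Real.mul_rpow two_pos.le hq]
    have : (4 : ℝ) ^ (s - 1) ≤ 2 ^ (s - 1) :=
      Real.rpow_le_rpow_of_nonpos two_pos (by norm_num) (by linarith)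
    gcongr

/-- For large `t` the product is `t ^ (j + 2 * (s - 1))`, and the exponent is nonnegative exactly
when `(2 - j) / 2 ≤ s`. The lower bound on `s` enters the estimates through this lemma. -/
theorem one_le_pow_mul_sq (h : IsProfile s φ) {j : ℕ} (hs : (2 - (j : ℝ)) / 2 ≤ s) {r : ℝ}
    (hr : 1 / 2 ≤ r) : 1 ≤ 4 ^ j * (r ^ j * φ r ^ 2) := by
  have key : ∀ t : ℝ, 2 ≤ t → 1 ≤ t ^ j * φ t ^ 2 := by
    intro t ht
    have ht0 : 0 < t := by linarith
    rw [h.eq_rpow t ht, ← Real.rpow_natCast, ← Real.rpow_mul_natCast ht0.le, ← Real.rpow_add ht0]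
    apply Real.one_le_rpow (by linarith)
    push_cast
    linarith
  rcases le_total 2 r with h2 | h2
  · have := key r h2
    have h4 : (1 : ℝ) ≤ 4 ^ j := one_le_pow₀ (by norm_num)
    nlinarith
  -- As `φ` is antitone and `2 ≤ 4 * r`, the value at `2` controls this range; hence the constant `4
  -- ^ j`.
  · have h3 := key 2 le_rfl
    have h4 : φ 2 ≤ φ r := h.anti h2
    have h5 : (2 : ℝ) ^ j * φ 2 ^ 2 ≤ (4 * r) ^ j * φ r ^ 2 := by
      have := (h.pos 2).le
      gcongr
      linarith
    rw [mul_pow] at h5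
    linarith

/-- The logarithmic derivative of `φ` with respect to `log r` is bounded: by compactness up to `2`,
and by the explicit power beyond. -/
theorem exists_deriv_le (h : IsProfile s φ) (hs1 : s < 1) :
    ∃ C : ℝ, 0 ≤ C ∧ ∀ r, 0 ≤ r → r * |deriv φ r| ≤ C * φ r := by
  have hc : Continuous (deriv φ) := h.smooth.continuous_deriv (by norm_cast)
  obtain ⟨M, hM⟩ := (isCompact_Icc (a := (0 : ℝ)) (b := 2)).exists_bound_of_continuousOn
    hc.continuousOn
  have hM0 : 0 ≤ M := (norm_nonneg _).trans (hM 0 (by simp))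
  have h2 := h.pos 2
  refine ⟨max (2 * M / φ 2) (1 - s), le_max_of_le_right (by linarith), fun r hr => ?_⟩
  rcases le_or_gt r 2 with h1 | h1
  · have h3 : φ 2 ≤ φ r := h.anti h1
    calc r * |deriv φ r| ≤ 2 * M := by
          gcongr
          exact hM r ⟨hr, h1⟩
      _ = 2 * M / φ 2 * φ 2 := by field_simp
      _ ≤ max (2 * M / φ 2) (1 - s) * φ r := by
          gcongr
          exact le_max_left _ _
  · have hr0 : 0 < r := by linarith
    have he : φ =ᶠ[𝓝 r] fun t => t ^ (s - 1) := by
      filter_upwards [lt_mem_nhds h1] with t ht using h.eq_rpow t ht.le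
    rw [he.deriv_eq, Real.deriv_rpow_const, h.eq_rpow r h1.le]
    have : r * |(s - 1) * r ^ (s - 1 - 1)| = (1 - s) * r ^ (s - 1) := by
      rw [abs_mul, abs_of_neg (by linarith : s - 1 < 0), abs_of_nonneg (by positivity),
        Real.rpow_sub_one hr0.ne']
      field_simp
      ring
    rw [this]
    gcongr
    exact le_max_right _ _

/-- Mean value inequality for `r ↦ φ r ^ 2 * r`, whose derivative is at most a multiple of `φ r ^ 2
≤ φ t ^ 2` on `[t, ∞)`. -/
theorem exists_sub_le (h : IsProfile s φ) (hs1 : s < 1) :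
    ∃ C : ℝ, 0 ≤ C ∧ ∀ t p q, 0 ≤ t → t ≤ q → q ≤ p →
      |φ p ^ 2 * p - φ q ^ 2 * q| ≤ C * φ t ^ 2 * (p - q) := by
  obtain ⟨C, hC, hd⟩ := h.exists_deriv_le hs1
  refine ⟨1 + 2 * C, by linarith, fun t p q ht htq hqp => ?_⟩
  have hdiff : Differentiable ℝ φ := h.smooth.differentiable (by simp)
  have hder : ∀ x, HasDerivAt (fun r => φ r ^ 2 * r) (2 * φ x * deriv φ x * x + φ x ^ 2) x := by
    intro x
    have := ((hdiff x).hasDerivAt.pow 2).mul (hasDerivAt_id x)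
    convert! this using 1
    simp
  have := (convex_Ici t).norm_image_sub_le_of_norm_hasDerivWithin_le
    (f := fun r => φ r ^ 2 * r) (C := (1 + 2 * C) * φ t ^ 2) (x := q) (y := p)
    (fun x _ => (hder x).hasDerivWithinAt) (fun x hx => ?_) htq (htq.trans hqp)
  · rw [Real.norm_eq_abs, Real.norm_eq_abs, abs_of_nonneg (sub_nonneg.2 hqp)] at this
    exact this
  · have hx0 : 0 ≤ x := ht.trans hx
    have h1 : φ x ≤ φ t := h.anti hx
    have h2 := (h.pos x).le
    have h3 : φ x ^ 2 ≤ φ t ^ 2 := by gcongr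
    rw [Real.norm_eq_abs]
    calc |2 * φ x * deriv φ x * x + φ x ^ 2|
        ≤ |2 * φ x * deriv φ x * x| + |φ x ^ 2| := abs_add_le _ _
      _ = 2 * φ x * (x * |deriv φ x|) + φ x ^ 2 := by
          rw [abs_mul, abs_mul, abs_mul, abs_of_nonneg h2, abs_of_nonneg hx0, abs_two,
            abs_of_nonneg (sq_nonneg (φ x))]
          ring
      _ ≤ 2 * φ x * (C * φ x) + φ x ^ 2 := by 
          have := hd x hx0
          gcongr
      _ = (1 + 2 * C) * φ x ^ 2 := by ring
      _ ≤ _ := by gcongr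

set_option maxHeartbeats 1000000 in
/-- The multiplier bounds for ordered frequencies `p = q + r`, `1 ≤ r ≤ q`. -/
theorem exists_symbol_le_of_ordered (h : IsProfile s φ) {j : ℕ} (hj : 1 ≤ j)
    (hs : (2 - (j : ℝ)) / 2 ≤ s) (hs1 : s < 1) :
    ∃ C : ℝ, 0 < C ∧ ∀ N : ℝ, 1 ≤ N → ∀ p q r : ℝ, p = q + r → 1 ≤ r → r ≤ q →
      (|φ (p / N) ^ 2 * p - φ (q / N) ^ 2 * q - φ (r / N) ^ 2 * r|
          * (3 + (p ^ 2 + q ^ 2 + r ^ 2) / 2)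
        ≤ C * (p / N) ^ j * (φ (p / N) * φ (q / N) * φ (r / N) * (p * q * r))) ∧
      (∀ i ∈ ({p, q, r} : Set ℝ), φ (i / N) ^ 2 * i * (3 + (p ^ 2 + q ^ 2 + r ^ 2) / 2)
        ≤ C * p ^ j * (φ (p / N) * φ (q / N) * φ (r / N) * (p * q * r))) := by
  obtain ⟨C₀, hC₀, hsub⟩ := h.exists_sub_le hs1
  obtain ⟨c, hc⟩ : ∃ c : ℝ, c = 4 ^ (s - 1) := ⟨_, rfl⟩
  have hc0 : 0 < c := by rw [hc]; positivity
  have h4j : (1 : ℝ) ≤ 4 ^ j := one_le_pow₀ (by norm_num)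
  obtain ⟨A, hA0, hAle⟩ : ∃ A : ℝ, 0 < A ∧ 10 * 4 ^ j ≤ A ∧ 10 * 4 ^ j * (1 / c) ≤ A ∧
      10 * (C₀ + 1) * 4 ^ j ≤ A := by
    have h1 : (0 : ℝ) < 10 * 4 ^ j := by positivity
    have h2 : 0 < 10 * 4 ^ j * (1 / c) := by positivity
    have h3 : 0 < 10 * (C₀ + 1) * 4 ^ j := by positivity
    exact ⟨10 * 4 ^ j + 10 * 4 ^ j * (1 / c) + 10 * (C₀ + 1) * 4 ^ j, by positivity,
      by linarith, by linarith, by linarith⟩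
  refine ⟨A, hA0, fun N hN p q r hp hr hrq => ?_⟩
  have hN0 : 0 < N := by linarith
  have hp0 : 0 < p := by linarith
  have hq0 : 0 < q := by linarith
  have hr0 : 0 < r := by linarith
  have hqp : q ≤ p := by linarith
  have hmp := h.pos (p / N)
  have hmq := h.pos (q / N)
  have hmr := h.pos (r / N)
  have hpq' : φ (p / N) ≤ φ (q / N) := h.anti (by gcongr)
  have hqr' : φ (q / N) ≤ φ (r / N) := h.anti (by gcongr)
  have hr1 := h.le_one (r / N)
  have hF : 3 + (p ^ 2 + q ^ 2 + r ^ 2) / 2 ≤ 5 * p ^ 2 := by nlinarith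
  have hlow : ∀ t : ℝ, 1 ≤ t → 1 ≤ 4 ^ j * (t ^ j * φ (t / N) ^ 2) := by
    intro t ht
    rcases le_total (1 / 2) (t / N) with h1 | h1
    · have := h.one_le_pow_mul_sq hs h1
      refine this.trans ?_
      have : (t / N) ≤ t := div_le_self (by linarith) hN
      gcongr
    · rw [h.eq_one _ (by linarith)]
      have : 1 ≤ t ^ j := one_le_pow₀ ht
      nlinarith
  -- the bound used when the frequency outside the product is one of the two large ones
  have hbig : p ≤ 4 ^ j * (p ^ j * φ (r / N) * r) := by
    have h1 := hlow r hr
    have h2 : r ^ (j - 1) ≤ p ^ (j - 1) := by gcongr; linarith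
    have h3 : p ^ j = p ^ (j - 1) * p := by
      rw [← pow_succ]; congr 1; omega
    have h3' : r ^ j = r ^ (j - 1) * r := by
      rw [← pow_succ]; congr 1; omega
    -- `hlow` controls the square of `φ (r / N)`, while `hbig` needs its first power; so the squared
    -- inequality is proved first.
    have h5 : 1 ≤ (4 ^ j * (p ^ (j - 1) * φ (r / N) * r)) ^ 2 := by
      calc (1 : ℝ) ≤ 4 ^ j * (r ^ j * φ (r / N) ^ 2) := h1
        _ = 4 ^ j * (r ^ (j - 1) * 1 * φ (r / N) ^ 2 * r) := by rw [h3']; ring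
        _ ≤ (4 ^ j * 4 ^ j) * (p ^ (j - 1) * p ^ (j - 1) * φ (r / N) ^ 2 * (r * r)) := by
          have : (1 : ℝ) ≤ p ^ (j - 1) := one_le_pow₀ (by linarith)
          have h6 : r ≤ r * r := by nlinarith
          have h7 : (4 : ℝ) ^ j ≤ 4 ^ j * 4 ^ j := by nlinarith
          gcongr
        _ = _ := by ring
    have h6 : 1 ≤ 4 ^ j * (p ^ (j - 1) * φ (r / N) * r) := by
      by_contra! hlt
      have : 0 ≤ 4 ^ j * (p ^ (j - 1) * φ (r / N) * r) := by positivity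
      nlinarith
    calc p = p * 1 := (mul_one p).symm
      _ ≤ p * (4 ^ j * (p ^ (j - 1) * φ (r / N) * r)) := by gcongr
      _ = _ := by rw [h3]; ring
  refine ⟨?_, ?_⟩
  · rcases le_or_gt p N with hpN | hpN
    -- If the largest frequency is at most `N`, all multipliers are `1` and the symbol is `p - q - r
    -- = 0`.
    · rw [h.eq_one (p / N) ((div_le_one hN0).2 hpN),
        h.eq_one (q / N) ((div_le_one hN0).2 (by linarith)),
        h.eq_one (r / N) ((div_le_one hN0).2 (by linarith))]
      have : (1 : ℝ) ^ 2 * p - 1 ^ 2 * q - 1 ^ 2 * r = 0 := by rw [hp]; ring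
      rw [this, abs_zero, zero_mul]
      positivity
    -- Since `p - q = r`, the two large terms cancel down to the size of the small one.
    · have h1 := hsub (r / N) (p / N) (q / N) (by positivity) (by gcongr) (by gcongr)
      have h2 : |φ (p / N) ^ 2 * p - φ (q / N) ^ 2 * q| ≤ C₀ * φ (r / N) ^ 2 * r := by
        have e1 : φ (p / N) ^ 2 * (p / N) - φ (q / N) ^ 2 * (q / N)
            = (φ (p / N) ^ 2 * p - φ (q / N) ^ 2 * q) / N := by ring
        have e2 : C₀ * φ (r / N) ^ 2 * (p / N - q / N) = (C₀ * φ (r / N) ^ 2 * r) / N := by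
          rw [hp]; ring
        rw [e1, e2, abs_div, abs_of_pos hN0] at h1
        exact (div_le_div_iff_of_pos_right hN0).1 h1
      have h3 : |φ (p / N) ^ 2 * p - φ (q / N) ^ 2 * q - φ (r / N) ^ 2 * r|
          ≤ (C₀ + 1) * φ (r / N) ^ 2 * r := by
        refine (abs_sub _ _).trans ?_
        rw [abs_of_nonneg (by positivity : 0 ≤ φ (r / N) ^ 2 * r)]
        linarith
      -- Because `p > N`, the lower bound applies at `p / N` rather than at `p`. This produces `(p /
      -- N) ^ j` and hence the decay in `N`.
      have h4 := h.one_le_pow_mul_sq hs (r := p / N)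
        (by rw [le_div_iff₀ hN0]; linarith)
      calc _ ≤ ((C₀ + 1) * φ (r / N) ^ 2 * r) * (5 * p ^ 2) := by gcongr
        _ = 5 * (C₀ + 1) * (φ (r / N) * φ (r / N) * r * p ^ 2) * 1 := by ring
        _ ≤ 5 * (C₀ + 1) * (1 * φ (r / N) * r * (p * (2 * q)))
              * (4 ^ j * ((p / N) ^ j * φ (p / N) ^ 2)) := by
            gcongr
            nlinarith
        _ = 10 * (C₀ + 1) * 4 ^ j * (p / N) ^ j
              * (φ (p / N) * φ (p / N) * φ (r / N) * (p * q * r)) := by ring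
        _ ≤ _ := by
            have := hAle.2.2
            gcongr
  · intro i hi
    simp only [Set.mem_insert_iff, Set.mem_singleton_iff] at hi
    have hp2 : p ≤ 2 * q := by linarith
    rcases hi with rfl | rfl | rfl
    · calc _ ≤ φ (i / N) ^ 2 * i * (5 * i ^ 2) := by gcongr
        _ = 5 * (φ (i / N) * φ (i / N)) * i * i * i := by ring
        _ ≤ 5 * (φ (i / N) * φ (q / N)) * i * (2 * q) * (4 ^ j * (i ^ j * φ (r / N) * r)) := by
            gcongr
        _ = 10 * 4 ^ j * i ^ j * (φ (i / N) * φ (q / N) * φ (r / N) * (i * q * r)) := by ring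
        _ ≤ _ := by
            have := hAle.1
            gcongr
    · have hd : φ (i / N) ≤ 1 / c * φ (p / N) := by
        have := h.doubling hs1 (p := p / N) (q := i / N) (by positivity)
          (by rw [← mul_div_assoc]; gcongr)
        rw [← hc] at this
        rw [one_div, ← div_eq_inv_mul, le_div_iff₀ hc0]
        linarith
      calc _ ≤ φ (i / N) ^ 2 * i * (5 * p ^ 2) := by gcongr
        _ = 5 * (φ (i / N) * φ (i / N)) * i * p * p := by ring
        _ ≤ 5 * ((1 / c * φ (p / N)) * φ (i / N)) * i * p * (4 ^ j * (p ^ j * φ (r / N) * r)) := by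
            gcongr
        _ = 5 * 4 ^ j * (1 / c) * p ^ j
              * (φ (p / N) * φ (i / N) * φ (r / N) * (p * i * r)) := by ring
        _ ≤ _ := by
            have : 5 * 4 ^ j * (1 / c) ≤ A := le_trans (by gcongr; norm_num) hAle.2.1
            gcongr
    · calc _ ≤ φ (i / N) ^ 2 * i * (5 * p ^ 2) := by gcongr
        _ = 5 * (φ (i / N) * φ (i / N) * i * p ^ 2) * 1 := by ring
        _ ≤ 5 * (1 * φ (i / N) * i * (p * (2 * q))) * (4 ^ j * (p ^ j * φ (p / N) ^ 2)) := by
            gcongr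
            · nlinarith
            · exact hlow p (by linarith)
        _ = 10 * 4 ^ j * p ^ j * (φ (p / N) * φ (p / N) * φ (i / N) * (p * q * i)) := by ring
        _ ≤ _ := by
            have := hAle.1
            gcongr

/-- The multiplier bounds for frequencies with sum zero. -/
theorem exists_symbol_le (h : IsProfile s φ) {j : ℕ} (hj : 1 ≤ j)
    (hs : (2 - (j : ℝ)) / 2 ≤ s) (hs1 : s < 1) :
    ∃ C : ℝ, 0 < C ∧ ∀ N : ℝ, 1 ≤ N → ∀ x y z M : ℝ, x + y + z = 0 → 1 ≤ |x| → 1 ≤ |y| → 1 ≤ |z| →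
      |x| ≤ M → |y| ≤ M → |z| ≤ M →
      (|φ (|x| / N) ^ 2 * x + φ (|y| / N) ^ 2 * y + φ (|z| / N) ^ 2 * z|
          * (3 + (x ^ 2 + y ^ 2 + z ^ 2) / 2)
        ≤ C * (M / N) ^ j * (φ (|x| / N) * φ (|y| / N) * φ (|z| / N)
          * (bracket x * bracket y * bracket z))) ∧
      (∀ i ∈ ({x, y, z} : Set ℝ), φ (|i| / N) ^ 2 * |i| * (3 + (x ^ 2 + y ^ 2 + z ^ 2) / 2)
        ≤ C * M ^ j * (φ (|x| / N) * φ (|y| / N) * φ (|z| / N)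
          * (bracket x * bracket y * bracket z))) := by
  obtain ⟨C, hC, H⟩ := h.exists_symbol_le_of_ordered hj hs hs1
  refine ⟨C, hC, fun N hN x y z M h0 hx hy hz hxM hyM hzM => ?_⟩
  -- Both bounds are symmetric in the three frequencies, so three exchanges reduce to `|z| ≤ |y| ≤
  -- |x|`.
  wlog hxy : |y| ≤ |x| generalizing x y
  · have := this y x (by linarith) hy hx hyM hxM (by linarith)
    rw [Set.insert_comm, show φ (|x| / N) ^ 2 * x + φ (|y| / N) ^ 2 * y
      = φ (|y| / N) ^ 2 * y + φ (|x| / N) ^ 2 * x by ring,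
      show x ^ 2 + y ^ 2 = y ^ 2 + x ^ 2 by ring, mul_comm (φ (|x| / N)) (φ (|y| / N)),
      mul_comm (bracket x) (bracket y)]
    exact this
  wlog hxz : |z| ≤ |x| generalizing x y z
  · have := this x hx hxM z y (by linarith) hz hy hzM hyM (by linarith) (by linarith)
    rw [show ({x, y, z} : Set ℝ) = {z, y, x} by ext; simp; tauto,
      show φ (|x| / N) ^ 2 * x + φ (|y| / N) ^ 2 * y + φ (|z| / N) ^ 2 * z
      = φ (|z| / N) ^ 2 * z + φ (|y| / N) ^ 2 * y + φ (|x| / N) ^ 2 * x by ring,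
      show x ^ 2 + y ^ 2 + z ^ 2 = z ^ 2 + y ^ 2 + x ^ 2 by ring,
      show φ (|x| / N) * φ (|y| / N) * φ (|z| / N) = φ (|z| / N) * φ (|y| / N) * φ (|x| / N) by ring,
      show bracket x * bracket y * bracket z = bracket z * bracket y * bracket x by ring]
    exact this
  wlog hyz : |z| ≤ |y| generalizing y z
  · have := this y hy hyM z (by linarith) hz hzM hxz hxy (by linarith)
    rw [show ({x, y, z} : Set ℝ) = {x, z, y} by ext; simp; tauto,
      show φ (|x| / N) ^ 2 * x + φ (|y| / N) ^ 2 * y + φ (|z| / N) ^ 2 * z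
      = φ (|x| / N) ^ 2 * x + φ (|z| / N) ^ 2 * z + φ (|y| / N) ^ 2 * y by ring,
      show x ^ 2 + y ^ 2 + z ^ 2 = x ^ 2 + z ^ 2 + y ^ 2 by ring,
      show φ (|x| / N) * φ (|y| / N) * φ (|z| / N) = φ (|x| / N) * φ (|z| / N) * φ (|y| / N) by ring,
      show bracket x * bracket y * bracket z = bracket x * bracket z * bracket y by ring]
    exact this
  have hN0 : 0 < N := by linarith
  -- The two smaller frequencies have the sign opposite to that of the largest, which turns sum zero
  -- into `|x| = |y| + |z|`.
  have hsum : |x| = |y| + |z| ∧ |φ (|x| / N) ^ 2 * x + φ (|y| / N) ^ 2 * y + φ (|z| / N) ^ 2 * z|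
      = abs (φ (|x| / N) ^ 2 * |x| - φ (|y| / N) ^ 2 * |y| - φ (|z| / N) ^ 2 * |z|) := by
    rcases le_total 0 x with hx0 | hx0
    · rw [abs_of_nonneg hx0] at *
      have hy0 : y ≤ 0 := by linarith [neg_abs_le z]
      have hz0 : z ≤ 0 := by linarith [neg_abs_le y]
      rw [abs_of_nonpos hy0, abs_of_nonpos hz0]
      exact ⟨by linarith, by ring_nf⟩
    · rw [abs_of_nonpos hx0] at *
      have hy0 : 0 ≤ y := by linarith [le_abs_self z]
      have hz0 : 0 ≤ z := by linarith [le_abs_self y]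
      rw [abs_of_nonneg hy0, abs_of_nonneg hz0]
      refine ⟨by linarith, ?_⟩
      rw [← abs_neg]
      ring_nf
  obtain ⟨H1, H2⟩ := H N hN |x| |y| |z| hsum.1 hz hyz
  simp only [sq_abs] at H1 H2
  have hb : |x| * |y| * |z| ≤ bracket x * bracket y * bracket z := by
    have := bracket_pos x
    have := bracket_pos y
    gcongr <;> exact abs_le_bracket _
  have := h.pos (|x| / N)
  have := h.pos (|y| / N)
  have := h.pos (|z| / N)
  have hM0 : 0 ≤ M := (abs_nonneg x).trans hxM
  rw [hsum.2]
  refine ⟨H1.trans (by gcongr), fun i hi => ?_⟩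
  refine (H2 |i| ?_).trans (by gcongr)
  simp only [Set.mem_insert_iff, Set.mem_singleton_iff] at hi ⊢
  rcases hi with rfl | rfl | rfl <;> simp

end IsProfile

/-- Lower bound of the resonance function in terms of the largest and the smallest frequency. -/
theorem exists_le_resonance {j : ℕ} (hj : 1 ≤ j) :
    ∃ C : ℝ, 0 < C ∧ ∀ x y z M K : ℝ, x + y + z = 0 → (M = |x| ∨ M = |y| ∨ M = |z|) →
      |x| ≤ M → |y| ≤ M → |z| ≤ M → K ≤ |x| → K ≤ |y| → K ≤ |z| → 0 ≤ K →
      K * M ^ (2 * j) ≤ C * |x ^ (2 * j + 1) + y ^ (2 * j + 1) + z ^ (2 * j + 1)| := by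
  refine ⟨4 ^ (j - 1), by positivity, fun x y z M K h0 hM hx hy hz hKx hKy hKz hK => ?_⟩
  have hM0 : 0 ≤ M := (abs_nonneg x).trans hx
  have := le_resonance hj h0 (K := M) (by rcases hM with h | h | h <;> simp [h]) hM0
  -- The two frequencies other than the largest have absolute values at least `K` and summing to at
  -- least `M`, so their product is at least `K * M / 2`.
  have hp : K * M ^ 2 ≤ 2 * (|x| * |y| * |z|) := by
    have tx : |x| ≤ |y| + |z| := by
      rw [show x = -(y + z) by linarith, abs_neg]; exact abs_add_le _ _
    have ty : |y| ≤ |x| + |z| := by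
      rw [show y = -(x + z) by linarith, abs_neg]; exact abs_add_le _ _
    have tz : |z| ≤ |x| + |y| := by
      rw [show z = -(x + y) by linarith, abs_neg]; exact abs_add_le _ _
    have aux : ∀ a b c : ℝ, M = a → a ≤ b + c → b ≤ M → c ≤ M → K ≤ b → K ≤ c →
        K * M ^ 2 ≤ 2 * (a * b * c) := by
      intro a b c ha h1 h2 h3 h4 h5
      subst ha
      have h6 : K * M ≤ 2 * (b * c) := by
        nlinarith [mul_nonneg (sub_nonneg.2 h4) (sub_nonneg.2 h5),
          mul_nonneg hK (sub_nonneg.2 h1), mul_nonneg (sub_nonneg.2 h4) hK,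
          mul_nonneg (sub_nonneg.2 h5) hK]
      nlinarith
    rcases hM with h | h | h
    · exact aux _ _ _ h tx hy hz hKy hKz
    · have := aux _ _ _ h ty hx hz hKx hKz
      nlinarith
    · have := aux _ _ _ h tz hx hy hKx hKy
      nlinarith
  have e : M ^ (2 * j) = M ^ 2 * M ^ (2 * j - 2) := by
    rw [← pow_add]; congr 1; omega
  have h4 : (0 : ℝ) < 4 ^ (j - 1) := by positivity
  calc K * M ^ (2 * j) = K * M ^ 2 * M ^ (2 * j - 2) := by rw [e]; ring
    _ ≤ 2 * (|x| * |y| * |z|) * M ^ (2 * j - 2) := by gcongr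
    _ = 4 ^ (j - 1) * (2 / 4 ^ (j - 1) * (|x| * |y| * |z|) * M ^ (2 * j - 2)) := by
        field_simp
    _ ≤ _ := by gcongr

/-! ### Weights and kernels on the line -/

/-- The bracket as an extended nonnegative number. -/
noncomputable def jb (x : ℝ) : ℝ≥0∞ := ENNReal.ofReal (bracket x)

/-- The absolute value as an extended nonnegative number. -/
noncomputable def ab (x : ℝ) : ℝ≥0∞ := ENNReal.ofReal |x|

/-- The kernel `|x|^{-ρ}` near the origin and `|x|^{-p}` away from it. -/
noncomputable def kap (ρ p x : ℝ) : ℝ≥0∞ := if |x| ≤ 1 then ab x ^ (-ρ) else ab x ^ (-p)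

theorem one_le_jb (x : ℝ) : 1 ≤ jb x := by
  rw [jb, ← ENNReal.ofReal_one]; exact ENNReal.ofReal_le_ofReal (one_le_bracket x)

theorem jb_ne_zero (x : ℝ) : jb x ≠ 0 := (zero_lt_one.trans_le (one_le_jb x)).ne'

theorem jb_ne_top (x : ℝ) : jb x ≠ ⊤ := ENNReal.ofReal_ne_top

theorem jb_add (x p q : ℝ) : jb x ^ (p + q) = jb x ^ p * jb x ^ q :=
  ENNReal.rpow_add _ _ (jb_ne_zero x) (jb_ne_top x)

theorem ab_ne_top (x : ℝ) : ab x ≠ ⊤ := ENNReal.ofReal_ne_top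

theorem ab_le_jb (x : ℝ) : ab x ≤ jb x := ENNReal.ofReal_le_ofReal (abs_le_bracket x)

theorem continuous_bracket : Continuous bracket := by unfold bracket; fun_prop

@[fun_prop]
theorem measurable_jb : Measurable jb := by
  unfold jb
  exact continuous_bracket.measurable.ennreal_ofReal

@[fun_prop]
theorem measurable_ab : Measurable ab := by
  unfold ab
  exact (continuous_abs.measurable).ennreal_ofReal

theorem measurable_kap (ρ p : ℝ) : Measurable (kap ρ p) := by
  unfold kap
  exact Measurable.ite (measurableSet_le continuous_abs.measurable measurable_const)
    (measurable_ab.pow_const _) (measurable_ab.pow_const _)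

theorem bracket_le_two_mul_abs {x : ℝ} (hx : 1 ≤ |x|) : bracket x ≤ 2 * |x| := by
  refine Real.sqrt_le_iff.2 ⟨by positivity, ?_⟩
  rw [mul_pow, sq_abs]
  have : 1 ≤ x ^ 2 := by rw [← sq_abs]; nlinarith
  linarith

theorem jb_le_two_mul_ab {x : ℝ} (hx : 1 ≤ |x|) : jb x ≤ 2 * ab x := by
  rw [jb, ab, show (2 : ℝ≥0∞) = ENNReal.ofReal 2 by simp, ← ENNReal.ofReal_mul two_pos.le]
  exact ENNReal.ofReal_le_ofReal (bracket_le_two_mul_abs hx)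

theorem bracket_add_le (a x : ℝ) : bracket a ≤ 2 * (bracket x * bracket (a + x)) := by
  refine Real.sqrt_le_iff.2 ⟨by have := bracket_pos x; have := bracket_pos (a + x); positivity, ?_⟩
  rw [mul_pow, mul_pow, sq_bracket, sq_bracket]
  nlinarith [sq_nonneg (a + 2 * x), sq_nonneg (x * (a + x)), sq_nonneg x, sq_nonneg (a + x),
    sq_nonneg a]

theorem jb_add_le (a x : ℝ) : jb a ≤ 2 * (jb x * jb (a + x)) := by
  rw [jb, jb, jb, show (2 : ℝ≥0∞) = ENNReal.ofReal 2 by simp,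
    ← ENNReal.ofReal_mul (bracket_pos x).le, ← ENNReal.ofReal_mul two_pos.le]
  exact ENNReal.ofReal_le_ofReal (bracket_add_le a x)

theorem rpow_neg_antitone {x y : ℝ≥0∞} {p : ℝ} (hp : 0 ≤ p) (h : x ≤ y) : y ^ (-p) ≤ x ^ (-p) := by
  rw [ENNReal.rpow_neg, ENNReal.rpow_neg]
  exact ENNReal.inv_le_inv.2 (ENNReal.rpow_le_rpow h hp)

theorem lintegral_jb_ne_top {p : ℝ} (hp : 1 < p) : ∫⁻ x, jb x ^ (-p) ≠ ⊤ := by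
  have h := integrable_rpow_neg_one_add_norm_sq (E := ℝ) (μ := volume) (r := p) (by simpa using hp)
  have h2 := h.lintegral_lt_top.ne
  convert h2 using 3 with x
  rw [jb, ENNReal.ofReal_rpow_of_pos (bracket_pos x), bracket, Real.sqrt_eq_rpow,
    ← Real.rpow_mul (by positivity), Real.norm_eq_abs, sq_abs]
  congr 2
  ring

theorem lintegral_ab_ne_top {ρ : ℝ} (hρ : ρ < 1) :
    ∫⁻ x in {x : ℝ | |x| ≤ 1}, ab x ^ (-ρ) ≠ ⊤ := by
  have h1 : ∫⁻ x in Set.Ioc (0 : ℝ) 1, ab x ^ (-ρ) ≠ ⊤ := by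
    have h := (intervalIntegral.intervalIntegrable_rpow' (a := 0) (b := 1) (r := -ρ) (by linarith))
    rw [intervalIntegrable_iff_integrableOn_Ioc_of_le zero_le_one] at h
    have h2 := h.setLIntegral_lt_top.ne
    rw [setLIntegral_congr_fun measurableSet_Ioc
      (g := fun x => ENNReal.ofReal (x ^ (-ρ))) (fun x hx => ?_)]
    · exact h2
    · simp only [ab]
      rw [abs_of_pos hx.1, ENNReal.ofReal_rpow_of_pos hx.1]
  have h2 : ∫⁻ x in Set.Ico (-1 : ℝ) 0, ab x ^ (-ρ) = ∫⁻ x in Set.Ioc (0 : ℝ) 1, ab x ^ (-ρ) := by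
    rw [← lintegral_indicator measurableSet_Ico, ← lintegral_indicator measurableSet_Ioc,
      ← lintegral_neg_eq_self]
    congr 1
    ext x
    simp only [Set.indicator, Set.mem_Ico, Set.mem_Ioc, ab, abs_neg]
    congr 1
    apply propext
    constructor <;> rintro ⟨h, h'⟩ <;> constructor <;> linarith
  have h3 : ({x : ℝ | |x| ≤ 1} : Set ℝ) ⊆ Set.Ico (-1 : ℝ) 0 ∪ ({0} ∪ Set.Ioc 0 1) := by
    intro x hx
    rw [Set.mem_ofPred_eq, abs_le] at hx
    rcases lt_trichotomy x 0 with h | h | h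
    · exact Or.inl ⟨hx.1, h⟩
    · exact Or.inr (Or.inl h)
    · exact Or.inr (Or.inr ⟨h, hx.2⟩)
  refine ne_top_of_le_ne_top ?_ ((lintegral_mono_set h3).trans
    ((lintegral_union_le _ _ _).trans (add_le_add le_rfl (lintegral_union_le _ _ _))))
  rw [h2, setLIntegral_measure_zero ({0} : Set ℝ) _ (by simp), zero_add]
  exact ENNReal.add_ne_top.2 ⟨h1, h1⟩

theorem ab_rpow_le {x p : ℝ} (hp : 0 ≤ p) (hx : 1 ≤ |x|) :
    ab x ^ (-p) ≤ 2 ^ p * jb x ^ (-p) := by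
  have h1 := rpow_neg_antitone hp (jb_le_two_mul_ab hx)
  rw [ENNReal.mul_rpow_of_ne_top (by simp) (ab_ne_top x)] at h1
  calc ab x ^ (-p) = 2 ^ p * (2 ^ (-p) * ab x ^ (-p)) := by
        rw [← mul_assoc, ← ENNReal.rpow_add _ _ (by simp) (by simp)]; simp
    _ ≤ _ := by gcongr

theorem kap_le (ρ : ℝ) {p : ℝ} (hp : 0 ≤ p) (x : ℝ) :
    kap ρ p x ≤ ({x : ℝ | |x| ≤ 1}.indicator (fun x => ab x ^ (-ρ)) x) + 2 ^ p * jb x ^ (-p) := by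
  unfold kap
  split_ifs with h
  · rw [Set.indicator_of_mem (by exact h)]
    exact le_self_add
  · exact (ab_rpow_le hp (not_le.1 h).le).trans le_add_self

theorem measurableSet_abs_le_one : MeasurableSet {x : ℝ | |x| ≤ 1} :=
  measurableSet_le continuous_abs.measurable measurable_const

theorem lintegral_kap_ne_top {ρ p : ℝ} (hρ : ρ < 1) (hp : 1 < p) : ∫⁻ x, kap ρ p x ≠ ⊤ := by
  refine ne_top_of_le_ne_top ?_ (lintegral_mono (kap_le ρ (by linarith)))
  rw [lintegral_add_right _ ((measurable_jb.pow_const _).const_mul _),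
    lintegral_indicator measurableSet_abs_le_one, lintegral_const_mul _ (measurable_jb.pow_const _)]
  exact ENNReal.add_ne_top.2 ⟨lintegral_ab_ne_top hρ,
    ENNReal.mul_ne_top (by simp) (lintegral_jb_ne_top hp)⟩

/-- Replacing the larger of `a` and `b` by the smaller one only increases the product of negative
powers. -/
theorem mul_rpow_neg_le {a b : ℝ≥0∞} (ha : a ≠ 0) (ha' : a ≠ ⊤) (hb : b ≠ 0) (hb' : b ≠ ⊤)
    {p q : ℝ} (hp : 0 ≤ p) (hq : 0 ≤ q) :
    a ^ (-p) * b ^ (-q) ≤ a ^ (-(p + q)) + b ^ (-(p + q)) := by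
  rcases le_total a b with h | h
  · refine le_trans ?_ le_self_add
    rw [neg_add, ENNReal.rpow_add _ _ ha ha']
    exact mul_le_mul_right (rpow_neg_antitone hq h) _
  · refine le_trans ?_ le_add_self
    rw [neg_add, ENNReal.rpow_add _ _ hb hb']
    exact mul_le_mul_left (rpow_neg_antitone hp h) _

/-- By `jb_add_le`, `p / 4` of the decay in each factor buys the decay in `a`. The remaining
exponents `3p/4` and `1 - p/4` add up to `1 + p/2 > 1`, which is integrable. -/
theorem exists_conv_jb_le {p : ℝ} (hp : 0 < p) (hp1 : p ≤ 1) :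
    ∃ C : ℝ≥0∞, C ≠ ⊤ ∧ ∀ a : ℝ,
      ∫⁻ x, jb (a + x) ^ (-p) * jb x ^ (-1 : ℝ) ≤ C * jb a ^ (-(p / 4)) := by
  set I := ∫⁻ x, jb x ^ (-(1 + p / 2))
  have hI : I ≠ ⊤ := lintegral_jb_ne_top (by linarith)
  refine ⟨2 ^ (p / 4) * (I + I), ENNReal.mul_ne_top (by simp) (by simp [hI]), fun a => ?_⟩
  have key : ∀ x, jb (a + x) ^ (-p) * jb x ^ (-1 : ℝ) ≤
      2 ^ (p / 4) * jb a ^ (-(p / 4)) *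
        (jb (a + x) ^ (-(1 + p / 2)) + jb x ^ (-(1 + p / 2))) := by
    intro x
    have h1 : 1 ≤ 2 ^ (p / 4) * jb a ^ (-(p / 4)) * (jb x ^ (p / 4) * jb (a + x) ^ (p / 4)) := by
      have := ENNReal.rpow_le_rpow (jb_add_le a x) (by positivity : 0 ≤ p / 4)
      rw [ENNReal.mul_rpow_of_nonneg _ _ (by positivity),
        ENNReal.mul_rpow_of_nonneg _ _ (by positivity)] at this
      calc (1 : ℝ≥0∞) = jb a ^ (-(p / 4)) * jb a ^ (p / 4) := by rw [← jb_add]; simp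
        _ ≤ jb a ^ (-(p / 4)) * (2 ^ (p / 4) * (jb x ^ (p / 4) * jb (a + x) ^ (p / 4))) := by gcongr
        _ = _ := by ring
    have h2 := mul_rpow_neg_le (jb_ne_zero (a + x)) (jb_ne_top _) (jb_ne_zero x) (jb_ne_top x)
      (p := 3 * p / 4) (q := 1 - p / 4) (by positivity) (by linarith)
    rw [show 3 * p / 4 + (1 - p / 4) = 1 + p / 2 by ring] at h2
    calc jb (a + x) ^ (-p) * jb x ^ (-1 : ℝ) = 1 * (jb (a + x) ^ (-p) * jb x ^ (-1 : ℝ)) := by simp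
      _ ≤ (2 ^ (p / 4) * jb a ^ (-(p / 4)) * (jb x ^ (p / 4) * jb (a + x) ^ (p / 4)))
          * (jb (a + x) ^ (-p) * jb x ^ (-1 : ℝ)) := by gcongr
      _ = 2 ^ (p / 4) * jb a ^ (-(p / 4)) * ((jb (a + x) ^ (p / 4) * jb (a + x) ^ (-p))
          * (jb x ^ (p / 4) * jb x ^ (-1 : ℝ))) := by ring
      _ = 2 ^ (p / 4) * jb a ^ (-(p / 4)) *
          (jb (a + x) ^ (-(3 * p / 4)) * jb x ^ (-(1 - p / 4))) := by
          rw [← jb_add, ← jb_add]; congr 3 <;> ring_nf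
      _ ≤ _ := by gcongr
  calc _ ≤ _ := lintegral_mono key
    _ = 2 ^ (p / 4) * jb a ^ (-(p / 4)) * (I + I) := by
        rw [lintegral_const_mul _ (by fun_prop),
          lintegral_add_left (by fun_prop),
          lintegral_add_left_eq_self (fun x => jb x ^ (-(1 + p / 2)))]
    _ = _ := by ring

/-- Away from the singularity this is `exists_conv_jb_le`. Where `|a + x| ≤ 1`, the brackets of `a`
and `x` are comparable, so `jb x ^ (-1)` supplies the decay and the singularity is merely
integrated. -/
theorem exists_conv_kap_le {ρ p : ℝ} (hρ : ρ < 1) (hp : 0 < p) (hp1 : p ≤ 1) :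
    ∃ C : ℝ≥0∞, C ≠ ⊤ ∧ ∀ a : ℝ,
      ∫⁻ x, kap ρ p (a + x) * jb x ^ (-1 : ℝ) ≤ C * jb a ^ (-(p / 4)) := by
  obtain ⟨C, hC, h⟩ := exists_conv_jb_le hp hp1
  set I := ∫⁻ x in {x : ℝ | |x| ≤ 1}, ab x ^ (-ρ)
  have hI : I ≠ ⊤ := lintegral_ab_ne_top hρ
  set g : ℝ → ℝ≥0∞ := {x : ℝ | |x| ≤ 1}.indicator (fun x => ab x ^ (-ρ)) with hg
  have hgm : Measurable g := (measurable_ab.pow_const _).indicator measurableSet_abs_le_one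
  refine ⟨4 * I + 2 ^ p * C, ENNReal.add_ne_top.2 ⟨ENNReal.mul_ne_top (by simp) hI,
    ENNReal.mul_ne_top (by simp) hC⟩, fun a => ?_⟩
  have key : ∀ x, kap ρ p (a + x) * jb x ^ (-1 : ℝ) ≤
      4 * jb a ^ (-(p / 4)) * g (a + x) + 2 ^ p * (jb (a + x) ^ (-p) * jb x ^ (-1 : ℝ)) := by
    intro x
    calc _ ≤ (g (a + x) + 2 ^ p * jb (a + x) ^ (-p)) * jb x ^ (-1 : ℝ) := by
          gcongr; exact kap_le ρ hp.le _
      _ = g (a + x) * jb x ^ (-1 : ℝ) + 2 ^ p * (jb (a + x) ^ (-p) * jb x ^ (-1 : ℝ)) := by ring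
      _ ≤ _ := by
        gcongr ?_ + _
        by_cases hx : |a + x| ≤ 1
        · have h1 : jb (a + x) ≤ 2 := by
            rw [jb, show (2 : ℝ≥0∞) = ENNReal.ofReal 2 by simp]
            apply ENNReal.ofReal_le_ofReal
            refine Real.sqrt_le_iff.2 ⟨by norm_num, ?_⟩
            have : (a + x) ^ 2 ≤ 1 := by rw [← sq_abs]; nlinarith [abs_nonneg (a + x)]
            linarith
          have h2 : jb a ≤ 4 * jb x := by
            calc jb a ≤ 2 * (jb x * jb (a + x)) := jb_add_le a x
              _ ≤ 2 * (jb x * 2) := by gcongr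
              _ = 4 * jb x := by ring
          have h3 : jb x ^ (-1 : ℝ) ≤ 4 * jb a ^ (-1 : ℝ) := by
            rw [ENNReal.rpow_neg_one, ENNReal.rpow_neg_one, ← div_eq_mul_inv,
              ENNReal.le_div_iff_mul_le (Or.inl (jb_ne_zero a)) (Or.inl (jb_ne_top a))]
            calc (jb x)⁻¹ * jb a ≤ (jb x)⁻¹ * (4 * jb x) := by gcongr
              _ = 4 * ((jb x)⁻¹ * jb x) := by ring
              _ = 4 := by rw [ENNReal.inv_mul_cancel (jb_ne_zero x) (jb_ne_top x), mul_one]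
          have h4 : jb a ^ (-1 : ℝ) ≤ jb a ^ (-(p / 4)) :=
            ENNReal.rpow_le_rpow_of_exponent_le (one_le_jb a) (by linarith)
          calc _ ≤ g (a + x) * (4 * jb a ^ (-(p / 4))) := by gcongr; exact h3.trans (by gcongr)
            _ = _ := by ring
        · rw [hg, Set.indicator_of_notMem (by exact hx)]
          simp
  have hgm' : Measurable fun x => g (a + x) := hgm.comp (measurable_const_add a)
  calc _ ≤ _ := lintegral_mono key
    _ = 4 * jb a ^ (-(p / 4)) * I
        + 2 ^ p * ∫⁻ x, jb (a + x) ^ (-p) * jb x ^ (-1 : ℝ) := by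
        rw [lintegral_add_left (hgm'.const_mul _), lintegral_const_mul _ hgm',
          lintegral_const_mul _ (by fun_prop),
          lintegral_add_left_eq_self g, hg, lintegral_indicator measurableSet_abs_le_one]
    _ ≤ 4 * jb a ^ (-(p / 4)) * I + 2 ^ p * (C * jb a ^ (-(p / 4))) := by gcongr; exact h a
    _ = _ := by ring

/-- Iterating a decay bound of a convolution. -/
theorem exists_conv_conv_le {F : ℝ → ℝ≥0∞} (hF : Measurable F) {p : ℝ} (hp : 0 < p) (hp1 : p ≤ 1)
    (h : ∃ C : ℝ≥0∞, C ≠ ⊤ ∧ ∀ a : ℝ, ∫⁻ x, F (a + x) * jb x ^ (-1 : ℝ) ≤ C * jb a ^ (-p)) :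
    ∃ C : ℝ≥0∞, C ≠ ⊤ ∧ ∀ a : ℝ,
      ∫⁻ x, ∫⁻ y, F (a + x + y) * (jb x ^ (-1 : ℝ) * jb y ^ (-1 : ℝ)) ≤ C * jb a ^ (-(p / 4)) := by
  obtain ⟨C, hC, h⟩ := h
  obtain ⟨C', hC', h'⟩ := exists_conv_jb_le hp hp1
  refine ⟨C * C', ENNReal.mul_ne_top hC hC', fun a => ?_⟩
  calc _ ≤ ∫⁻ x, C * (jb (a + x) ^ (-p) * jb x ^ (-1 : ℝ)) := by
        refine lintegral_mono fun x => ?_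
        have e : ∀ y, F (a + x + y) * (jb x ^ (-1 : ℝ) * jb y ^ (-1 : ℝ))
            = jb x ^ (-1 : ℝ) * (F (a + x + y) * jb y ^ (-1 : ℝ)) := fun y => by ring
        simp_rw [e]
        rw [lintegral_const_mul _ (by fun_prop)]
        calc _ ≤ jb x ^ (-1 : ℝ) * (C * jb (a + x) ^ (-p)) := by gcongr; exact h _
          _ = _ := by ring
    _ = C * ∫⁻ x, jb (a + x) ^ (-p) * jb x ^ (-1 : ℝ) :=
        lintegral_const_mul _ (by fun_prop)
    _ ≤ C * (C' * jb a ^ (-(p / 4))) := by gcongr; exact h' a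
    _ = _ := by ring

/-! ### Cauchy-Schwarz inequalities for extended nonnegative functions -/

/-- Cauchy-Schwarz phrased with squares, so that weights can be split between `f` and `g` without
square roots. -/
theorem sq_lintegral_le {α : Type*} [MeasurableSpace α] {μ : Measure α} {h f g : α → ℝ≥0∞}
    (hf : AEMeasurable f μ) (hg : AEMeasurable g μ) (hfg : ∀ x, h x ^ 2 ≤ f x * g x) :
    (∫⁻ x, h x ∂μ) ^ 2 ≤ (∫⁻ x, f x ∂μ) * ∫⁻ x, g x ∂μ := by
  have h1 : ∀ x, h x ≤ f x ^ (1 / 2 : ℝ) * g x ^ (1 / 2 : ℝ) := by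
    intro x
    rw [← ENNReal.mul_rpow_of_nonneg _ _ (by norm_num), one_div,
      ENNReal.le_rpow_inv_iff (by norm_num)]
    exact_mod_cast hfg x
  have h2 := ENNReal.lintegral_mul_le_Lp_mul_Lq μ Real.HolderConjugate.two_two
    (hf.pow_const (1 / 2 : ℝ)) (hg.pow_const (1 / 2 : ℝ))
  have e : ∀ y : ℝ≥0∞, (y ^ (1 / 2 : ℝ)) ^ (2 : ℝ) = y := fun y => by
    rw [← ENNReal.rpow_mul]; norm_num
  simp only [e, Pi.mul_apply] at h2
  have h3 := (lintegral_mono h1).trans h2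
  calc _ ≤ ((∫⁻ x, f x ∂μ) ^ (1 / 2 : ℝ) * (∫⁻ x, g x ∂μ) ^ (1 / 2 : ℝ)) ^ 2 := by gcongr
    _ = _ := by rw [mul_pow, ← ENNReal.rpow_two, ← ENNReal.rpow_two, e, e]

theorem sq_tsum_le {ι : Type*} {h f g : ι → ℝ≥0∞} (hfg : ∀ i, h i ^ 2 ≤ f i * g i) :
    (∑' i, h i) ^ 2 ≤ (∑' i, f i) * ∑' i, g i := by
  let _ : MeasurableSpace ι := ⊤
  have := sq_lintegral_le (μ := Measure.count) (h := h) (f := f) (g := g)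
    measurable_from_top.aemeasurable measurable_from_top.aemeasurable hfg
  simpa only [lintegral_count] using this

theorem sq_add_le (a b : ℝ≥0∞) : (a + b) ^ 2 ≤ 4 * (a ^ 2 + b ^ 2) := by
  rcases le_total a b with h | h
  · calc (a + b) ^ 2 ≤ (b + b) ^ 2 := by gcongr
      _ = 4 * (0 + b ^ 2) := by ring
      _ ≤ _ := by gcongr; exact zero_le
  · calc (a + b) ^ 2 ≤ (a + a) ^ 2 := by gcongr
      _ = 4 * (a ^ 2 + 0) := by ring
      _ ≤ _ := by gcongr; exact zero_le

theorem le_of_sq_le_sq {a b : ℝ≥0∞} (h : a ^ 2 ≤ b ^ 2) : a ≤ b :=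
  (ENNReal.pow_le_pow_left_iff two_ne_zero).1 h

/-! ### Bilinear and trilinear convolution integrals on the line -/

/-- The square of the norm of `f` in the weighted space `L²(⟨x⟩ dx)`. -/
noncomputable def wsq (f : ℝ → ℝ≥0∞) : ℝ≥0∞ := ∫⁻ x, jb x * f x ^ 2

/-- The bilinear convolution of `f` and `g` with the kernel `F`. -/
noncomputable def bilin (F f g : ℝ → ℝ≥0∞) (a : ℝ) : ℝ≥0∞ :=
  ∫⁻ z : ℝ × ℝ, F (a + z.1 + z.2) * (f z.1 * g z.2)

theorem measurable_bilin {F f g : ℝ → ℝ≥0∞} (hF : Measurable F) (hf : Measurable f)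
    (hg : Measurable g) : Measurable (bilin F f g) := by
  unfold bilin
  apply Measurable.lintegral_prod_right'
    (f := fun p : ℝ × (ℝ × ℝ) => F (p.1 + p.2.1 + p.2.2) * (f p.2.1 * g p.2.2))
  fun_prop

/-- Cauchy-Schwarz after inserting `jb ^ (-1) * jb = 1` in both variables: one factor contains only
kernel and weights, the other the weighted squares of `f` and `g`. -/
theorem sq_bilin_le {F F₁ F₂ f g : ℝ → ℝ≥0∞} (hF₁ : Measurable F₁) (hF₂ : Measurable F₂)
    (hf : Measurable f) (hg : Measurable g) (h : ∀ x, F x ^ 2 ≤ F₁ x * F₂ x) (a : ℝ) :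
    bilin F f g a ^ 2 ≤ bilin F₁ (fun x => jb x ^ (-1 : ℝ)) (fun x => jb x ^ (-1 : ℝ)) a *
      bilin F₂ (fun x => jb x * f x ^ 2) (fun x => jb x * g x ^ 2) a := by
  unfold bilin
  refine sq_lintegral_le (by fun_prop) (by fun_prop) fun z => ?_
  have e : ∀ x, jb x ^ (-1 : ℝ) * jb x = 1 := fun x => by
    rw [ENNReal.rpow_neg_one, ENNReal.inv_mul_cancel (jb_ne_zero x) (jb_ne_top x)]
  calc (F (a + z.1 + z.2) * (f z.1 * g z.2)) ^ 2
      = F (a + z.1 + z.2) ^ 2 * (f z.1 ^ 2 * g z.2 ^ 2) := by ring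
    _ ≤ F₁ (a + z.1 + z.2) * F₂ (a + z.1 + z.2) * (f z.1 ^ 2 * g z.2 ^ 2) := by gcongr; exact h _
    _ = F₁ (a + z.1 + z.2) * F₂ (a + z.1 + z.2) * (f z.1 ^ 2 * g z.2 ^ 2)
        * ((jb z.1 ^ (-1 : ℝ) * jb z.1) * (jb z.2 ^ (-1 : ℝ) * jb z.2)) := by simp [e]
    _ = _ := by ring

theorem lintegral_bilin {F f g : ℝ → ℝ≥0∞} (hF : Measurable F) (hf : Measurable f)
    (hg : Measurable g) :
    ∫⁻ a, bilin F f g a = (∫⁻ x, F x) * ((∫⁻ x, f x) * ∫⁻ x, g x) := by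
  unfold bilin
  rw [lintegral_lintegral_swap (by fun_prop)]
  have e : ∀ z : ℝ × ℝ, ∫⁻ a, F (a + z.1 + z.2) * (f z.1 * g z.2)
      = (∫⁻ x, F x) * (f z.1 * g z.2) := by
    intro z
    rw [lintegral_mul_const _ (by fun_prop)]
    congr 1
    simp_rw [add_assoc]
    exact lintegral_add_right_eq_self F (z.1 + z.2)
  simp_rw [e]
  rw [lintegral_const_mul _ (by fun_prop)]
  congr 1
  exact lintegral_prod_mul hf.aemeasurable hg.aemeasurable

theorem bilin_jb_eq {F : ℝ → ℝ≥0∞} (hF : Measurable F) (a : ℝ) :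
    bilin F (fun x => jb x ^ (-1 : ℝ)) (fun x => jb x ^ (-1 : ℝ)) a
      = ∫⁻ x, ∫⁻ y, F (a + x + y) * (jb x ^ (-1 : ℝ) * jb y ^ (-1 : ℝ)) := by
  unfold bilin
  exact lintegral_prod _ (by fun_prop)

theorem bilin_one_le (f g : ℝ → ℝ≥0∞) (hf : Measurable f) (hg : Measurable g) (a : ℝ) :
    bilin (fun _ => 1) (fun x => jb x * f x ^ 2) (fun x => jb x * g x ^ 2) a = wsq f * wsq g := by
  unfold bilin wsq
  simp only [one_mul]
  exact lintegral_prod_mul (f := fun x => jb x * f x ^ 2) (g := fun x => jb x * g x ^ 2)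
    (by fun_prop) (by fun_prop)

/-- The trilinear form with a bounded, slowly decaying kernel. -/
theorem exists_trilin_jb_le {γ : ℝ} (hγ : 0 < γ) (hγ1 : γ ≤ 1 / 2) :
    ∃ C : ℝ≥0∞, C ≠ ⊤ ∧ ∀ (f₁ f₂ f₃ : ℝ → ℝ≥0∞), Measurable f₁ → Measurable f₂ → Measurable f₃ →
      ∀ Ω : ℝ, (∫⁻ x, f₁ x * bilin (fun y => jb y ^ (-γ)) f₂ f₃ (x - Ω)) ^ 2
        ≤ C * (wsq f₁ * (wsq f₂ * wsq f₃)) := by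
  obtain ⟨C, hC, h⟩ := exists_conv_conv_le (F := fun y => jb y ^ (-(2 * γ))) (p := 2 * γ / 4)
    (by fun_prop) (by positivity) (by linarith)
    (exists_conv_jb_le (p := 2 * γ) (by positivity) (by linarith))
  obtain ⟨C', hC', h'⟩ := exists_conv_jb_le (p := 2 * γ / 4 / 4) (by positivity) (by linarith)
  refine ⟨C * C', ENNReal.mul_ne_top hC hC', fun f₁ f₂ f₃ hf₁ hf₂ hf₃ Ω => ?_⟩
  set B := bilin (fun y => jb y ^ (-γ)) f₂ f₃ with hB
  have hBm : Measurable B := measurable_bilin (by fun_prop) hf₂ hf₃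
  -- The convolution is bounded pointwise and still decays. Against `jb ^ (-1)` this decay makes the
  -- last integral finite uniformly in `Ω`.
  have hBsq : ∀ a, B a ^ 2 ≤ C * jb a ^ (-(2 * γ / 4 / 4)) * (wsq f₂ * wsq f₃) := by
    intro a
    have := sq_bilin_le (F := fun y => jb y ^ (-γ)) (F₁ := fun y => jb y ^ (-(2 * γ)))
      (F₂ := fun _ => 1) (by fun_prop) (by fun_prop) hf₂ hf₃ (fun x => by
        rw [mul_one, ← ENNReal.rpow_natCast, ← ENNReal.rpow_mul]
        apply le_of_eq; congr 1; push_cast; ring) a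
    rw [bilin_one_le _ _ hf₂ hf₃, bilin_jb_eq (by fun_prop)] at this
    exact this.trans (by gcongr; exact h a)
  calc _ ≤ (∫⁻ x, jb x * f₁ x ^ 2) * ∫⁻ x, jb x ^ (-1 : ℝ) * B (x - Ω) ^ 2 := by
        refine sq_lintegral_le (by fun_prop) (by fun_prop) fun x => le_of_eq ?_
        calc _ = f₁ x ^ 2 * B (x - Ω) ^ 2 * 1 := by ring
          _ = f₁ x ^ 2 * B (x - Ω) ^ 2 * (jb x ^ (-1 : ℝ) * jb x) := by
              rw [ENNReal.rpow_neg_one, ENNReal.inv_mul_cancel (jb_ne_zero x) (jb_ne_top x)]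
          _ = _ := by ring
    _ ≤ wsq f₁ * ∫⁻ x, C * (wsq f₂ * wsq f₃)
          * (jb (-Ω + x) ^ (-(2 * γ / 4 / 4)) * jb x ^ (-1 : ℝ)) := by
        refine mul_le_mul_right (lintegral_mono fun x => ?_) _
        calc jb x ^ (-1 : ℝ) * B (x - Ω) ^ 2 ≤ jb x ^ (-1 : ℝ) * _ :=
              mul_le_mul_right (hBsq _) _
          _ = _ := by rw [show -Ω + x = x - Ω by ring]; ring
    _ = wsq f₁ * (C * (wsq f₂ * wsq f₃)
          * ∫⁻ x, (jb (-Ω + x) ^ (-(2 * γ / 4 / 4)) * jb x ^ (-1 : ℝ))) := by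
        rw [lintegral_const_mul _ (by fun_prop)]
    _ ≤ wsq f₁ * (C * (wsq f₂ * wsq f₃) * C') := by
        gcongr
        refine (h' (-Ω)).trans ?_
        calc _ ≤ C' * 1 := by
              gcongr
              rw [ENNReal.rpow_neg]
              exact ENNReal.inv_le_one.2 (ENNReal.one_le_rpow (one_le_jb _) (by positivity))
          _ = _ := mul_one _
    _ = _ := by ring

/-- The squared kernel has exponent `1 + 2γ`. Near the origin it is halved, each half being locally
integrable because `γ < 1/2` where this is used. Away from it, `1 + γ` is kept for integrability and
`γ` for decay. -/
theorem ab_rpow_sq {γ : ℝ} (x : ℝ) :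
    (ab x ^ (-(1 / 2 + γ))) ^ 2 ≤ kap (1 / 2 + γ) γ x * kap (1 / 2 + γ) (1 + γ) x := by
  unfold kap
  split_ifs with h
  · rw [sq]
  · have h0 : ab x ≠ 0 := by
      rw [ab, Ne, ENNReal.ofReal_eq_zero, not_le]
      linarith
    rw [← ENNReal.rpow_add _ _ h0 (ab_ne_top x), ← ENNReal.rpow_natCast, ← ENNReal.rpow_mul]
    apply le_of_eq; congr 1; push_cast; ring

/-- The bounds for the bilinear convolution with the singular kernel. -/
theorem exists_bilin_ab_le {γ : ℝ} (hγ : 0 < γ) (hγ1 : γ < 1 / 2) :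
    ∃ C : ℝ≥0∞, C ≠ ⊤ ∧ ∀ (f g : ℝ → ℝ≥0∞), Measurable f → Measurable g →
      ∀ R : ℝ, 0 ≤ R → ∫⁻ a, {a : ℝ | R ≤ |a|}.indicator
          (fun a => bilin (fun y => ab y ^ (-(1 / 2 + γ))) f g a ^ 2) a
        ≤ C * jb R ^ (-(γ / 16)) * (wsq f * wsq g) := by
  have hm := measurable_kap (1 / 2 + γ) γ
  have hm' := measurable_kap (1 / 2 + γ) (1 + γ)
  obtain ⟨C, hC, h⟩ := exists_conv_conv_le hm (p := γ / 4) (by positivity) (by linarith)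
    (exists_conv_kap_le (ρ := 1 / 2 + γ) (p := γ) (by linarith) hγ (by linarith))
  set I := ∫⁻ x, kap (1 / 2 + γ) (1 + γ) x with hI
  have hI' : I ≠ ⊤ := lintegral_kap_ne_top (by linarith) (by linarith)
  refine ⟨C * I, ENNReal.mul_ne_top hC hI', fun f g hf hg R hR => ?_⟩
  -- The slowly decaying part of the squared kernel is bounded pointwise after convolution with the
  -- weights, and gives the decay in `R`. The integrable part carries `f` and `g`, and is integrated
  -- in `a` by Fubini.
  have key : ∀ a, {a : ℝ | R ≤ |a|}.indicator
      (fun a => bilin (fun y => ab y ^ (-(1 / 2 + γ))) f g a ^ 2) a ≤ C * jb R ^ (-(γ / 16)) *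
        bilin (kap (1 / 2 + γ) (1 + γ)) (fun x => jb x * f x ^ 2) (fun x => jb x * g x ^ 2) a := by
    intro a
    by_cases ha : R ≤ |a|
    swap
    · rw [Set.indicator_of_notMem (by exact ha)]
      exact zero_le
    rw [Set.indicator_of_mem (by exact ha)]
    have := sq_bilin_le hm hm' hf hg (fun x => ab_rpow_sq x) a
    rw [bilin_jb_eq hm] at this
    refine this.trans ?_
    gcongr
    refine (h a).trans ?_
    rw [show γ / 4 / 4 = γ / 16 by ring]
    refine mul_le_mul_right (rpow_neg_antitone (by positivity) ?_) _
    apply ENNReal.ofReal_le_ofReal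
    unfold bracket
    apply Real.sqrt_le_sqrt
    have : R ^ 2 ≤ a ^ 2 := by
      rw [← sq_abs a]
      exact pow_le_pow_left₀ hR ha 2
    linarith
  calc _ ≤ _ := lintegral_mono key
    _ = C * jb R ^ (-(γ / 16)) * (I * (wsq f * wsq g)) := by
        rw [lintegral_const_mul _ (measurable_bilin hm' (by fun_prop) (by fun_prop)),
          lintegral_bilin hm' (by fun_prop) (by fun_prop), ← hI]
        rfl
    _ = _ := by ring

/-- The trilinear form with kernel `F` and resonance `Ω`. -/
noncomputable def trilin (F f₁ f₂ f₃ : ℝ → ℝ≥0∞) (Ω : ℝ) : ℝ≥0∞ :=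
  ∫⁻ x, f₁ x * bilin F f₂ f₃ (x - Ω)

theorem bilin_comm (F f g : ℝ → ℝ≥0∞) : bilin F f g = bilin F g f := by
  ext a
  unfold bilin
  refine Eq.trans ?_ ((Measure.measurePreserving_swap (μ := (volume : Measure ℝ))
    (ν := (volume : Measure ℝ))).lintegral_comp_emb MeasurableEquiv.prodComm.measurableEmbedding
      (fun z => F (a + z.1 + z.2) * (g z.1 * f z.2)))
  refine lintegral_congr fun z => ?_
  rw [Prod.fst_swap, Prod.snd_swap]
  rw [mul_comm (f z.1), add_right_comm]

theorem trilin_eq {F f₁ f₂ f₃ : ℝ → ℝ≥0∞} (hF : Measurable F)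
    (h₂ : Measurable f₂) (h₃ : Measurable f₃) (Ω : ℝ) :
    trilin F f₁ f₂ f₃ Ω =
      ∫⁻ x, ∫⁻ y, ∫⁻ z, F (x + y + z - Ω) * (f₁ x * f₂ y * f₃ z) := by
  unfold trilin bilin
  refine lintegral_congr fun x => ?_
  rw [← lintegral_const_mul _ (by fun_prop)]
  refine (lintegral_prod _ (by fun_prop)).trans ?_
  refine lintegral_congr fun y => lintegral_congr fun z => ?_
  rw [show x - Ω + y + z = x + y + z - Ω by ring]
  ring

/-- Together with `bilin_comm` this makes the form symmetric, so a factor with high modulation can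
always be moved to the first place. -/
theorem trilin_swap {F f₁ f₂ f₃ : ℝ → ℝ≥0∞} (hF : Measurable F) (h₁ : Measurable f₁)
    (h₂ : Measurable f₂) (h₃ : Measurable f₃) (Ω : ℝ) :
    trilin F f₁ f₂ f₃ Ω = trilin F f₂ f₁ f₃ Ω := by
  rw [trilin_eq hF h₂ h₃, trilin_eq hF h₁ h₃, lintegral_lintegral_swap]
  · refine lintegral_congr fun x => lintegral_congr fun y => lintegral_congr fun z => ?_
    rw [add_comm x y, mul_comm (f₁ _)]
  · apply Measurable.aemeasurable
    apply Measurable.lintegral_prod_right'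
      (f := fun p : (ℝ × ℝ) × ℝ => F (p.1.1 + p.1.2 + p.2 - Ω) * (f₁ p.1.1 * f₂ p.1.2 * f₃ p.2))
    fun_prop

/-! ### Sums over frequencies with sum zero -/

/-- The third frequency. -/
def thd (p : ℤ × ℤ) : ℤ := -p.1 - p.2

/-- The smallest of the absolute values of the three frequencies. -/
def kmin (p : ℤ × ℤ) : ℕ := min p.1.natAbs (min p.2.natAbs (thd p).natAbs)

/-- The largest of the absolute values of the three frequencies. -/
def kmax (p : ℤ × ℤ) : ℕ := max p.1.natAbs (max p.2.natAbs (thd p).natAbs)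

/-- The resonance function. -/
noncomputable def res (j : ℕ) (p : ℤ × ℤ) : ℝ := phase j p.1 + phase j p.2 + phase j (thd p)

/-- Exchange of the first and the third frequency. -/
def swapThd : (ℤ × ℤ) ≃ (ℤ × ℤ) where
  toFun p := (thd p, p.2)
  invFun p := (thd p, p.2)
  left_inv p := by simp [thd]
  right_inv p := by simp [thd]

theorem thd_swap (p : ℤ × ℤ) : thd p.swap = thd p := by simp [thd]; ring

theorem thd_swapThd (p : ℤ × ℤ) : thd (swapThd p) = p.1 := by simp [thd, swapThd]

theorem kmin_swap (p : ℤ × ℤ) : kmin p.swap = kmin p := by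
  simp only [kmin, thd_swap, Prod.fst_swap, Prod.snd_swap]; omega

theorem kmin_swapThd (p : ℤ × ℤ) : kmin (swapThd p) = kmin p := by
  simp only [kmin, thd_swapThd]; simp only [swapThd, Equiv.coe_fn_mk]; omega

theorem res_swap (j : ℕ) (p : ℤ × ℤ) : res j p.swap = res j p := by
  simp only [res, thd_swap, Prod.fst_swap, Prod.snd_swap]; ring

theorem res_swapThd (j : ℕ) (p : ℤ × ℤ) : res j (swapThd p) = res j p := by
  simp only [res, thd_swapThd]; simp only [swapThd, Equiv.coe_fn_mk]; ring

theorem tsum_int_rpow_ne_top {p : ℝ} (hp : 1 < p) :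
    ∑' k : ℤ, (if k = 0 then 0 else (k.natAbs : ℝ≥0∞) ^ (-p)) ≠ ⊤ := by
  have h := Real.summable_abs_int_rpow hp
  refine ne_top_of_le_ne_top h.tsum_ofReal_ne_top (ENNReal.tsum_le_tsum fun k => ?_)
  split_ifs with hk
  · exact zero_le
  · have : (k.natAbs : ℝ≥0∞) = ENNReal.ofReal |(k : ℝ)| := by
      rw [← Int.cast_abs, Int.abs_eq_natAbs, Int.cast_natCast, ENNReal.ofReal_natCast]
    rw [this, ENNReal.ofReal_rpow_of_pos (by positivity)]

theorem tsum_mul_thd_le (q : ℤ → ℝ≥0∞) (k : ℤ) :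
    ∑' l, q l * q (thd (k, l)) ≤ ∑' l, q l ^ 2 := by
  apply le_of_sq_le_sq
  refine (sq_tsum_le (f := fun l => q l ^ 2) (g := fun l => q (thd (k, l)) ^ 2)
    (fun l => by rw [mul_pow])).trans (le_of_eq ?_)
  have : ∑' l, q (thd (k, l)) ^ 2 = ∑' l, q l ^ 2 := by
    rw [← (Equiv.subLeft (-k)).tsum_eq (fun l => q l ^ 2)]
    rfl
  rw [this, sq]

/-- For fixed first frequency the inner sum is bounded by Cauchy-Schwarz; the outer one converges
because `2r > 1`. The condition `q 0 = 0` is needed since `0 ^ (-r) = ⊤`. -/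
theorem exists_tsum_first_le {r : ℝ} (hr : 1 / 2 < r) :
    ∃ C : ℝ≥0∞, C ≠ ⊤ ∧ ∀ q : ℤ → ℝ≥0∞, q 0 = 0 →
      ∑' p : ℤ × ℤ, (p.1.natAbs : ℝ≥0∞) ^ (-r) * (q p.1 * (q p.2 * q (thd p)))
        ≤ C * (∑' k, q k ^ 2) ^ (3 / 2 : ℝ) := by
  set A := ∑' k : ℤ, (if k = 0 then 0 else (k.natAbs : ℝ≥0∞) ^ (-(2 * r))) with hA
  have hA' : A ≠ ⊤ := tsum_int_rpow_ne_top (by linarith)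
  refine ⟨A ^ (1 / 2 : ℝ), by simp [hA'], fun q hq => ?_⟩
  set V := ∑' k, q k ^ 2 with hV
  have h1 : ∑' k : ℤ, (k.natAbs : ℝ≥0∞) ^ (-r) * q k ≤ A ^ (1 / 2 : ℝ) * V ^ (1 / 2 : ℝ) := by
    rw [← ENNReal.mul_rpow_of_nonneg _ _ (by norm_num), one_div,
      ENNReal.le_rpow_inv_iff (by norm_num), ENNReal.rpow_two]
    refine sq_tsum_le fun k => ?_
    split_ifs with hk
    · subst hk; simp [hq]
    · rw [mul_pow]
      apply le_of_eq
      congr 1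
      rw [← ENNReal.rpow_natCast, ← ENNReal.rpow_mul]
      congr 1; push_cast; ring
  rw [ENNReal.tsum_prod (f := fun k l => (k.natAbs : ℝ≥0∞) ^ (-r) * (q k * (q l * q (thd (k, l)))))]
  calc _ ≤ ∑' k : ℤ, (k.natAbs : ℝ≥0∞) ^ (-r) * q k * V := by
        refine ENNReal.tsum_le_tsum fun k => ?_
        simp_rw [← mul_assoc ((k.natAbs : ℝ≥0∞) ^ (-r))]
        rw [ENNReal.tsum_mul_left]
        exact mul_le_mul_right (tsum_mul_thd_le q k) _
    _ ≤ A ^ (1 / 2 : ℝ) * V ^ (1 / 2 : ℝ) * V := by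
        rw [ENNReal.tsum_mul_right]; gcongr
    _ = _ := by
        rw [mul_assoc]
        congr 1
        nth_rewrite 2 [← ENNReal.rpow_one V]
        rw [← ENNReal.rpow_add_of_nonneg _ _ (by norm_num) (by norm_num)]
        norm_num

/-- The minimum is one of the three frequencies, and the rest of the summand is invariant under
permuting them. -/
theorem exists_tsum_kmin_le {r : ℝ} (hr : 1 / 2 < r) :
    ∃ C : ℝ≥0∞, C ≠ ⊤ ∧ ∀ q : ℤ → ℝ≥0∞, q 0 = 0 →
      ∑' p : ℤ × ℤ, (kmin p : ℝ≥0∞) ^ (-r) * (q p.1 * (q p.2 * q (thd p)))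
        ≤ C * (∑' k, q k ^ 2) ^ (3 / 2 : ℝ) := by
  obtain ⟨C, hC, h⟩ := exists_tsum_first_le hr
  refine ⟨C + C + C, by simp [hC], fun q hq => ?_⟩
  set V := ∑' k, q k ^ 2 with hV
  have h1 := h q hq
  have h2 : ∑' p : ℤ × ℤ, (p.2.natAbs : ℝ≥0∞) ^ (-r) * (q p.1 * (q p.2 * q (thd p)))
      ≤ C * V ^ (3 / 2 : ℝ) := by
    refine le_trans (le_of_eq ?_) h1
    rw [← (Equiv.prodComm ℤ ℤ).tsum_eq]
    refine tsum_congr fun p => ?_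
    rw [Equiv.prodComm_apply, thd_swap, Prod.fst_swap, Prod.snd_swap]
    ring
  have h3 : ∑' p : ℤ × ℤ, ((thd p).natAbs : ℝ≥0∞) ^ (-r) * (q p.1 * (q p.2 * q (thd p)))
      ≤ C * V ^ (3 / 2 : ℝ) := by
    refine le_trans (le_of_eq ?_) h1
    rw [← swapThd.tsum_eq]
    refine tsum_congr fun p => ?_
    rw [thd_swapThd]
    simp only [swapThd, Equiv.coe_fn_mk]
    ring
  calc _ ≤ ∑' p : ℤ × ℤ, ((p.1.natAbs : ℝ≥0∞) ^ (-r) * (q p.1 * (q p.2 * q (thd p)))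
        + (p.2.natAbs : ℝ≥0∞) ^ (-r) * (q p.1 * (q p.2 * q (thd p)))
        + ((thd p).natAbs : ℝ≥0∞) ^ (-r) * (q p.1 * (q p.2 * q (thd p)))) := by
        refine ENNReal.tsum_le_tsum fun p => ?_
        rw [← add_mul, ← add_mul]
        gcongr
        have : kmin p = p.1.natAbs ∨ kmin p = p.2.natAbs ∨ kmin p = (thd p).natAbs := by
          unfold kmin; omega
        rcases this with h | h | h <;> rw [h]
        · exact le_self_add.trans le_self_add
        · exact le_add_self.trans le_self_add
        · exact le_add_self
    _ ≤ _ := by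
        rw [ENNReal.tsum_add, ENNReal.tsum_add, add_mul, add_mul]
        gcongr

/-! ### The contribution of a high modulation -/

/-- A sum with at most two nonzero terms. -/
theorem sq_tsum_le_of_support {a : ℤ → ℝ≥0∞} {s : ℤ}
    (h : ∀ k k', a k ≠ 0 → a k' ≠ 0 → k' = k ∨ k' = s - k) :
    (∑' k, a k) ^ 2 ≤ 4 * ∑' k, a k ^ 2 := by
  by_cases h0 : ∃ k, a k ≠ 0
  · obtain ⟨k, hk⟩ := h0
    have hs : ∀ k' ∉ ({k, s - k} : Finset ℤ), a k' = 0 := by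
      intro k' hk'
      by_contra hne
      exact hk' (by simpa using h k k' hk hne)
    rw [tsum_eq_sum hs]
    have h2 : ∑ k' ∈ ({k, s - k} : Finset ℤ), a k' ^ 2 ≤ ∑' k, a k ^ 2 := ENNReal.sum_le_tsum _
    refine le_trans ?_ (mul_le_mul_right h2 _)
    by_cases he : k = s - k
    · rw [← he, Finset.pair_eq_singleton, Finset.sum_singleton, Finset.sum_singleton]
      calc a k ^ 2 = 1 * a k ^ 2 := (one_mul _).symm
        _ ≤ _ := by gcongr; norm_num
    · rw [Finset.sum_pair he, Finset.sum_pair he]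
      exact sq_add_le _ _
  · push Not at h0
    simp [h0]

theorem phase_eq (j : ℕ) (k : ℤ) : phase j k = (-1) ^ j * (k : ℝ) ^ (2 * j + 1) := rfl

/-- The excluded value `-k - l` exchanges the second and third frequencies, which leaves the
resonance function unchanged. -/
theorem res_sub_res_ge {j : ℕ} (hj : 1 ≤ j) {k l l' : ℤ} (h1 : l' ≠ l) (h2 : l' ≠ -k - l) :
    2 / 4 ^ (j - 1) * |(k : ℝ)| ≤ |res j (k, l) - res j (k, l')| := by
  have := le_abs_oddPow_sub_int hj (s := -k) (k := l) (k' := l') h1.symm (by omega)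
  rw [Int.cast_neg, abs_neg] at this
  refine this.trans (le_of_eq ?_)
  have e : res j (k, l) - res j (k, l') = (-1) ^ j * ((l : ℝ) ^ (2 * j + 1)
      + ((-k - l : ℤ) : ℝ) ^ (2 * j + 1)
        - ((l' : ℝ) ^ (2 * j + 1) + ((-k - l' : ℤ) : ℝ) ^ (2 * j + 1))) := by
    simp only [res, phase_eq, thd]; ring
  rw [e, abs_mul, abs_pow, abs_neg, abs_one, one_pow, one_mul]

/-- The part of the trilinear sum in which the first factor carries half a power of its
modulation. -/
theorem exists_tsum_high_le {j : ℕ} (hj : 1 ≤ j) {γ : ℝ} (hγ : 0 < γ) (hγ1 : γ < 1 / 2) :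
    ∃ C : ℝ≥0∞, C ≠ ⊤ ∧ ∀ f : ℤ → ℝ → ℝ≥0∞, (∀ k, Measurable (f k)) → (∀ x, f 0 x = 0) →
      ∑' p : ℤ × ℤ, (kmin p : ℝ≥0∞) ^ (-(1 / 2) : ℝ) *
          trilin (fun y => ab y ^ (-(1 / 2 + γ))) (fun x => jb x ^ (1 / 2 : ℝ) * f p.1 x)
            (f p.2) (f (thd p)) (res j p)
        ≤ C * (∑' k, wsq (f k)) ^ (3 / 2 : ℝ) := by
  obtain ⟨C, hC, hb⟩ := exists_bilin_ab_le hγ hγ1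
  obtain ⟨A, hA, ha⟩ := exists_tsum_kmin_le (r := 1 / 2 + γ / 32) (by linarith)
  set c : ℝ := 1 / 4 ^ (j - 1) with hc
  have hc0 : 0 < c := by positivity
  set c' : ℝ≥0∞ := ENNReal.ofReal c with hc'
  have hc'0 : c' ≠ 0 := by simpa [hc'] using hc0
  have hc't : c' ≠ ⊤ := ENNReal.ofReal_ne_top
  refine ⟨(4 * C) ^ (1 / 2 : ℝ) + (C * c' ^ (-(γ / 16))) ^ (1 / 2 : ℝ) * A, ?_, fun f hf hf0 => ?_⟩
  · refine ENNReal.add_ne_top.2 ⟨by simp [ENNReal.mul_ne_top, hC], ENNReal.mul_ne_top ?_ hA⟩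
    have : c' ^ (-(γ / 16)) ≠ ⊤ := by simp [ENNReal.rpow_eq_top_iff, hc'0, hc't]
    simp [ENNReal.mul_ne_top, hC, this]
  set V := ∑' k, wsq (f k) with hV
  set κ : ℝ → ℝ≥0∞ := fun y => ab y ^ (-(1 / 2 + γ)) with hκ
  have hκm : Measurable κ := by fun_prop
  set q : ℤ → ℝ≥0∞ := fun k => wsq (f k) ^ (1 / 2 : ℝ) with hq
  have hq2 : ∀ k, q k ^ 2 = wsq (f k) := fun k => by
    rw [hq, ← ENNReal.rpow_two, ← ENNReal.rpow_mul]; norm_num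
  have hq0 : q 0 = 0 := by simp [hq, wsq, hf0]
  have hVq : V = ∑' k, q k ^ 2 := by simp_rw [hq2]; rfl
  set h : ℤ → ℝ → ℝ≥0∞ := fun k x => jb x ^ (1 / 2 : ℝ) * f k x with hh
  have hhm : ∀ k, Measurable (h k) := fun k => by
    have := hf k
    simp only [hh]; fun_prop
  have hhsq : ∀ k, ∫⁻ x, h k x ^ 2 = wsq (f k) := fun k => by
    unfold wsq
    refine lintegral_congr fun x => ?_
    rw [hh, mul_pow, ← ENNReal.rpow_two, ← ENNReal.rpow_mul]; norm_num
  set B : ℤ × ℤ → ℝ → ℝ≥0∞ := fun p x => bilin κ (f p.2) (f (thd p)) (x - res j p) with hB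
  have hBm : ∀ p, Measurable (B p) := fun p =>
    (measurable_bilin hκm (hf _) (hf _)).comp (measurable_id.sub_const _)
  set R : ℤ → ℝ := fun k => c * |(k : ℝ)| with hR
  have hR0 : ∀ k, 0 ≤ R k := fun k => by positivity
  set S : ℤ × ℤ → Set ℝ := fun p => {x | R p.1 ≤ |x - res j p|} with hS
  have hSm : ∀ p, MeasurableSet (S p) := fun p =>
    measurableSet_le measurable_const (by fun_prop)
  have hBsq : ∀ (p : ℤ × ℤ) (R : ℝ), 0 ≤ R →
      ∫⁻ x, {x | R ≤ |x - res j p|}.indicator (fun x => B p x ^ 2) x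
        ≤ C * jb R ^ (-(γ / 16)) * (wsq (f p.2) * wsq (f (thd p))) := by
    intro p R hR
    refine le_trans (le_of_eq ?_) (hb (f p.2) (f (thd p)) (hf _) (hf _) R hR)
    exact lintegral_sub_right_eq_self (fun a => {a : ℝ | R ≤ |a|}.indicator
      (fun a => bilin κ (f p.2) (f (thd p)) a ^ 2) a) (res j p)
  -- the far part
  have hfar : ∑' p : ℤ × ℤ, (kmin p : ℝ≥0∞) ^ (-(1 / 2) : ℝ) *
      (∫⁻ x, (S p).indicator (fun x => h p.1 x * B p x) x)
        ≤ (C * c' ^ (-(γ / 16))) ^ (1 / 2 : ℝ) * A * V ^ (3 / 2 : ℝ) := by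
    have h1 : ∀ p : ℤ × ℤ, (kmin p : ℝ≥0∞) ^ (-(1 / 2) : ℝ) *
        (∫⁻ x, (S p).indicator (fun x => h p.1 x * B p x) x) ≤
        (C * c' ^ (-(γ / 16))) ^ (1 / 2 : ℝ) * ((kmin p : ℝ≥0∞) ^ (-(1 / 2 + γ / 32)) *
          (q p.1 * (q p.2 * q (thd p)))) := by
      intro p
      by_cases hp : kmin p = 0
      -- The weight is infinite here, but a zero frequency makes the integrand vanish.
      · have hz : ∀ x, h p.1 x * B p x = 0 := by
          have : p.1 = 0 ∨ p.2 = 0 ∨ thd p = 0 := by unfold kmin at hp; omega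
          intro x
          rcases this with h0 | h0 | h0
          · simp [hh, h0, hf0]
          · simp [hB, h0, bilin, hf0]
          · simp [hB, h0, bilin, hf0]
        simp [hz]
      · have hkm : (kmin p : ℝ≥0∞) ≠ 0 := by exact_mod_cast hp
        have hsq : (∫⁻ x, (S p).indicator (fun x => h p.1 x * B p x) x) ^ 2 ≤
            (C * c' ^ (-(γ / 16))) * (kmin p : ℝ≥0∞) ^ (-(γ / 16))
              * (q p.1 * (q p.2 * q (thd p))) ^ 2 := by
          calc _ ≤ (∫⁻ x, h p.1 x ^ 2) * ∫⁻ x, (S p).indicator (fun x => B p x ^ 2) x := by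
                refine sq_lintegral_le ((hhm _).pow_const _).aemeasurable
                  (((hBm p).pow_const _).indicator (hSm p)).aemeasurable fun x => ?_
                by_cases hx : x ∈ S p
                · simp [hx, mul_pow]
                · simp [hx]
            _ ≤ wsq (f p.1) *
                (C * jb (R p.1) ^ (-(γ / 16)) * (wsq (f p.2) * wsq (f (thd p)))) := by
                rw [hhsq]
                exact mul_le_mul_right (hBsq p _ (hR0 _)) _
            -- Since `jb (R p.1) ≥ c * |p.1| ≥ c * kmin p`, distance from the resonance becomes a
            -- power of `kmin`; after the square root this is the extra `γ / 32` that makes the sum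
            -- converge.
            _ ≤ wsq (f p.1) * (C * (c' ^ (-(γ / 16)) * (kmin p : ℝ≥0∞) ^ (-(γ / 16)))
                  * (wsq (f p.2) * wsq (f (thd p)))) := by
                gcongr
                rw [← ENNReal.mul_rpow_of_ne_top hc't (by simp)]
                refine rpow_neg_antitone (by positivity) ?_
                refine le_trans ?_ (ab_le_jb _)
                simp only [ab, hR]
                rw [abs_of_nonneg (by positivity), ENNReal.ofReal_mul hc0.le]
                gcongr
                rw [← Int.cast_abs, Int.abs_eq_natAbs]
                simp only [Int.cast_natCast, ENNReal.ofReal_natCast]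
                exact_mod_cast (min_le_left _ _)
            _ = _ := by rw [mul_pow, mul_pow, hq2, hq2, hq2]; ring
        apply le_of_sq_le_sq
        rw [mul_pow]
        refine (mul_le_mul_right hsq _).trans (le_of_eq ?_)
        have e1 : ((kmin p : ℝ≥0∞) ^ (-(1 / 2) : ℝ)) ^ 2 = (kmin p : ℝ≥0∞) ^ (-1 : ℝ) := by
          rw [← ENNReal.rpow_two, ← ENNReal.rpow_mul]; norm_num
        have e2 : ((kmin p : ℝ≥0∞) ^ (-(1 / 2 + γ / 32))) ^ 2
            = (kmin p : ℝ≥0∞) ^ (-1 : ℝ) * (kmin p : ℝ≥0∞) ^ (-(γ / 16)) := by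
          rw [← ENNReal.rpow_two, ← ENNReal.rpow_mul, ← ENNReal.rpow_add _ _ hkm (by simp)]
          congr 1; ring
        have e3 : ((C * c' ^ (-(γ / 16))) ^ (1 / 2 : ℝ)) ^ 2 = C * c' ^ (-(γ / 16)) := by
          rw [← ENNReal.rpow_two, ← ENNReal.rpow_mul]; norm_num
        simp only [mul_pow, e1, e2, e3]
        ring
    refine (ENNReal.tsum_le_tsum h1).trans ?_
    rw [ENNReal.tsum_mul_left, mul_assoc, hVq]
    gcongr
    exact ha q hq0
  -- the near part
  have hnear : ∑' p : ℤ × ℤ, (kmin p : ℝ≥0∞) ^ (-(1 / 2) : ℝ) *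
      (∫⁻ x, (S p)ᶜ.indicator (fun x => h p.1 x * B p x) x)
        ≤ (4 * C) ^ (1 / 2 : ℝ) * V ^ (3 / 2 : ℝ) := by
    have h1 : ∀ p : ℤ × ℤ, (kmin p : ℝ≥0∞) ^ (-(1 / 2) : ℝ) *
        (∫⁻ x, (S p)ᶜ.indicator (fun x => h p.1 x * B p x) x) ≤
        ∫⁻ x, h p.1 x * (S p)ᶜ.indicator (B p) x := by
      intro p
      by_cases hp : kmin p = 0
      · have hz : ∀ x, h p.1 x * B p x = 0 := by
          have : p.1 = 0 ∨ p.2 = 0 ∨ thd p = 0 := by unfold kmin at hp; omega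
          intro x
          rcases this with h0 | h0 | h0
          · simp [hh, h0, hf0]
          · simp [hB, h0, bilin, hf0]
          · simp [hB, h0, bilin, hf0]
        simp [hz]
      · have : (kmin p : ℝ≥0∞) ^ (-(1 / 2) : ℝ) ≤ 1 := by
          rw [ENNReal.rpow_neg]
          refine ENNReal.inv_le_one.2 (ENNReal.one_le_rpow ?_ (by norm_num))
          exact_mod_cast Nat.one_le_iff_ne_zero.2 hp
        calc _ ≤ 1 * ∫⁻ x, (S p)ᶜ.indicator (fun x => h p.1 x * B p x) x := by gcongr
          _ = _ := by
            rw [one_mul]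
            refine lintegral_congr fun x => ?_
            by_cases hx : x ∈ (S p)ᶜ
            · rw [Set.indicator_of_mem hx, Set.indicator_of_mem hx]
            · rw [Set.indicator_of_notMem hx, Set.indicator_of_notMem hx, mul_zero]
    have hBi : ∀ p, Measurable ((S p)ᶜ.indicator (B p)) := fun p =>
      (hBm p).indicator (hSm p).compl
    -- The sum over `l` is taken inside the integral before Cauchy-Schwarz, so that `h k` is squared
    -- once for all `l`. No power of `kmin` is needed in the near part.
    have h2 : ∀ k : ℤ, (∑' l : ℤ, ∫⁻ x, h k x * (S (k, l))ᶜ.indicator (B (k, l)) x) ^ 2 ≤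
        4 * C * (wsq (f k) * ∑' l : ℤ, wsq (f l) * wsq (f (thd (k, l)))) := by
      intro k
      rw [← lintegral_tsum (f := fun l x => h k x * (S (k, l))ᶜ.indicator (B (k, l)) x)
        fun l => ((hhm k).mul (hBi (k, l))).aemeasurable]
      calc _ ≤ (∫⁻ x, h k x ^ 2) * ∫⁻ x, 4 * ∑' l : ℤ, B (k, l) x ^ 2 := by
            refine sq_lintegral_le ((hhm _).pow_const _).aemeasurable
              ((Measurable.tsum fun l =>
                (hBm _).pow_const _).const_mul _).aemeasurable fun x => ?_
            rw [ENNReal.tsum_mul_left, mul_pow]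
            gcongr
            refine (sq_tsum_le_of_support (s := -k) fun l l' hl hl' => ?_).trans ?_
            · have hl := Set.mem_of_indicator_ne_zero hl
              have hl' := Set.mem_of_indicator_ne_zero hl'
              simp only [hS, Set.mem_compl_iff, Set.mem_ofPred_eq, not_le] at hl hl'
              by_contra! hcon
              have := res_sub_res_ge hj hcon.1 hcon.2
              have h3 : |res j (k, l) - res j (k, l')| < R k + R k := by
                calc |res j (k, l) - res j (k, l')|
                    = |(x - res j (k, l')) - (x - res j (k, l))| := by congr 1; ring
                  _ ≤ |x - res j (k, l')| + |x - res j (k, l)| := abs_sub _ _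
                  _ < _ := add_lt_add hl' hl
              have h4 : R k + R k = 2 / 4 ^ (j - 1) * |(k : ℝ)| := by
                simp only [hR, hc]; ring
              linarith
            · gcongr with l
              exact Set.indicator_le_self _ _ _
        _ = wsq (f k) * (4 * ∑' l : ℤ, ∫⁻ x, B (k, l) x ^ 2) := by
            rw [hhsq, lintegral_const_mul _ (Measurable.tsum fun l =>
                (hBm _).pow_const _), lintegral_tsum fun l => ((hBm _).pow_const _).aemeasurable]
        _ ≤ wsq (f k) * (4 * ∑' l : ℤ, C * (wsq (f l) * wsq (f (thd (k, l))))) := by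
            gcongr with l
            -- With radius `0` the restriction in `hBsq` is void.
            have := hBsq (k, l) 0 le_rfl
            simp only [abs_nonneg, Set.ofPred_true, Set.indicator_univ] at this
            refine this.trans ?_
            have hj1 : jb 0 = 1 := by simp [jb, bracket]
            simp [hj1]
        _ = _ := by rw [ENNReal.tsum_mul_left]; ring
    have hww : ∑' k : ℤ, ∑' l : ℤ, wsq (f l) * wsq (f (thd (k, l))) = V * V := by
      rw [ENNReal.tsum_comm]
      have : ∀ l : ℤ, ∑' k : ℤ, wsq (f l) * wsq (f (thd (k, l))) = wsq (f l) * V := by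
        intro l
        rw [ENNReal.tsum_mul_left, hV, ← (Equiv.subRight l).tsum_eq (fun k => wsq (f k)),
          ← (Equiv.neg ℤ).tsum_eq]
        congr 1
        refine tsum_congr fun k => ?_
        simp [thd]
      simp_rw [this]
      rw [ENNReal.tsum_mul_right]
    refine (ENNReal.tsum_le_tsum h1).trans ?_
    rw [ENNReal.tsum_prod (f := fun k l => ∫⁻ x, h k x * (S (k, l))ᶜ.indicator (B (k, l)) x)]
    apply le_of_sq_le_sq
    calc _ ≤ (∑' k, wsq (f k)) * ∑' k, 4 * C * ∑' l : ℤ, wsq (f l) * wsq (f (thd (k, l))) :=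
          sq_tsum_le fun k => (h2 k).trans (le_of_eq (by ring))
      _ = 4 * C * V ^ 3 := by
          rw [ENNReal.tsum_mul_left, hww]; ring
      _ = _ := by
          rw [mul_pow, ← ENNReal.rpow_two, ← ENNReal.rpow_two, ← ENNReal.rpow_mul,
            ← ENNReal.rpow_mul, ← ENNReal.rpow_natCast]
          norm_num
  calc _ = ∑' p : ℤ × ℤ, ((kmin p : ℝ≥0∞) ^ (-(1 / 2) : ℝ) *
      (∫⁻ x, (S p)ᶜ.indicator (fun x => h p.1 x * B p x) x) + (kmin p : ℝ≥0∞) ^ (-(1 / 2) : ℝ) *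
      (∫⁻ x, (S p).indicator (fun x => h p.1 x * B p x) x)) := by
        refine tsum_congr fun p => ?_
        rw [← mul_add, lintegral_indicator (hSm p), lintegral_indicator (hSm p).compl, add_comm,
          lintegral_add_compl _ (hSm p)]
        rfl
    _ ≤ _ := by
        rw [ENNReal.tsum_add, add_mul]
        exact add_le_add hnear hfar

/-- Written as one integral, the forms can be compared by integrating the pointwise bound
`exists_kernel_le`. -/
theorem trilin_eq_lintegral {F f₁ f₂ f₃ : ℝ → ℝ≥0∞} (hF : Measurable F) (h₁ : Measurable f₁)
    (h₂ : Measurable f₂) (h₃ : Measurable f₃) (Ω : ℝ) :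
    trilin F f₁ f₂ f₃ Ω = ∫⁻ w : ℝ × (ℝ × ℝ),
      F (w.1 - Ω + w.2.1 + w.2.2) * (f₁ w.1 * (f₂ w.2.1 * f₃ w.2.2)) := by
  refine Eq.trans ?_ (lintegral_prod _ (by fun_prop)).symm
  unfold trilin bilin
  refine lintegral_congr fun x => ?_
  rw [← lintegral_const_mul _ (by fun_prop)]
  refine lintegral_congr fun z => ?_
  simp only
  ring

theorem jb_le_one_add_ab (x : ℝ) : jb x ≤ 1 + ab x := by
  rw [jb, ab, ← ENNReal.ofReal_one, ← ENNReal.ofReal_add zero_le_one (abs_nonneg x)]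
  apply ENNReal.ofReal_le_ofReal
  refine Real.sqrt_le_iff.2 ⟨by positivity, ?_⟩
  nlinarith [sq_abs x, abs_nonneg x]

theorem ab_add_le (x y : ℝ) : ab (x + y) ≤ ab x + ab y := by
  rw [ab, ab, ab, ← ENNReal.ofReal_add (abs_nonneg x) (abs_nonneg y)]
  exact ENNReal.ofReal_le_ofReal (abs_add_le x y)

theorem ab_neg (x : ℝ) : ab (-x) = ab x := by rw [ab, abs_neg, ab]

/-- Either the kernel is evaluated far from the origin, or one of the modulations is large. -/
theorem exists_kernel_le {A : ℝ≥0∞} (hA : A ≠ ⊤) {γ : ℝ} (hγ : 0 < γ) :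
    ∃ D : ℝ≥0∞, D ≠ ⊤ ∧ ∀ (n : ℕ) (Ω x y z : ℝ), n ≠ 0 → (n : ℝ≥0∞) ≤ A * ab Ω →
      ab Ω ^ (1 / 2 : ℝ) * ab (x - Ω + y + z) ^ (-(1 / 2 + γ)) ≤
        D * (n : ℝ≥0∞) ^ (-(γ / 2)) * jb (x - Ω + y + z) ^ (-(γ / 2)) +
          2 * ((jb x ^ (1 / 2 : ℝ) + jb y ^ (1 / 2 : ℝ) + jb z ^ (1 / 2 : ℝ))
            * ab (x - Ω + y + z) ^ (-(1 / 2 + γ))) := by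
  refine ⟨2 * (A * 4) ^ (γ / 2) * (A * 4 + 1) ^ (γ / 2), ?_, fun n Ω x y z hn hle => ?_⟩
  · refine ENNReal.mul_ne_top (ENNReal.mul_ne_top (by simp) ?_) ?_
    · exact ENNReal.rpow_ne_top_of_nonneg (by positivity) (ENNReal.mul_ne_top hA (by simp))
    · exact ENNReal.rpow_ne_top_of_nonneg (by positivity)
        (ENNReal.add_ne_top.2 ⟨ENNReal.mul_ne_top hA (by simp), by simp⟩)
  set σ := x - Ω + y + z with hσ
  have hn1 : (1 : ℝ≥0∞) ≤ n := by exact_mod_cast Nat.one_le_iff_ne_zero.2 hn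
  have hΩ : ab Ω ≤ ab σ + ab x + ab y + ab z := by
    calc ab Ω = ab (-σ + x + y + z) := by rw [hσ]; congr 1; ring
      _ ≤ ab (-σ + x + y) + ab z := ab_add_le _ _
      _ ≤ ab (-σ + x) + ab y + ab z := by gcongr; exact ab_add_le _ _
      _ ≤ ab (-σ) + ab x + ab y + ab z := by gcongr; exact ab_add_le _ _
      _ = _ := by rw [ab_neg]
  -- One of the four terms in the triangle inequality is at least a quarter of the total.
  have h4 : ab Ω ≤ 4 * ab σ ∨ ab Ω ≤ 4 * ab x ∨ ab Ω ≤ 4 * ab y ∨ ab Ω ≤ 4 * ab z := by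
    by_contra! hcon
    obtain ⟨h1, h2, h3, h5⟩ := hcon
    have hs : 4 * (ab σ + ab x + ab y + ab z) < 4 * ab Ω := by
      calc 4 * (ab σ + ab x + ab y + ab z) = 4 * ab σ + 4 * ab x + 4 * ab y + 4 * ab z := by ring
        _ < ab Ω + ab Ω + ab Ω + ab Ω := by
          exact ENNReal.add_lt_add (ENNReal.add_lt_add (ENNReal.add_lt_add h1 h2) h3) h5
        _ = _ := by ring
    exact absurd (mul_le_mul_right hΩ 4) (not_le.2 hs)
  have hmod : ∀ t, ab Ω ≤ 4 * ab t → ab Ω ^ (1 / 2 : ℝ) ≤ 2 * jb t ^ (1 / 2 : ℝ) := by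
    intro t ht
    calc ab Ω ^ (1 / 2 : ℝ) ≤ (4 * jb t) ^ (1 / 2 : ℝ) :=
          ENNReal.rpow_le_rpow (ht.trans (by gcongr; exact ab_le_jb t)) (by norm_num)
      _ = _ := by
        rw [ENNReal.mul_rpow_of_nonneg _ _ (by norm_num),
          show (4 : ℝ≥0∞) = 2 ^ (2 : ℝ) by norm_num, ← ENNReal.rpow_mul]
        norm_num
  rcases h4 with h | h | h | h
  -- With `|σ|` comparable to the resonance or larger, the exponent left over is `1/2 - (1/2 + γ) =
  -- -γ`. Half of it is turned into decay in `n`, half into a bounded kernel decaying in `σ`.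
  · refine le_trans ?_ le_self_add
    have hnσ : (n : ℝ≥0∞) ≤ A * 4 * ab σ := by
      rw [mul_assoc]; exact hle.trans (by gcongr)
    have hσ0 : ab σ ≠ 0 := by
      intro h0
      rw [h0, mul_zero] at hnσ
      exact absurd (hn1.trans hnσ) (by simp)
    have hA40 : A * 4 ≠ 0 := by
      intro h0
      rw [h0, zero_mul] at hnσ
      exact absurd (hn1.trans hnσ) (by simp)
    have h1 : ab Ω ^ (1 / 2 : ℝ) ≤ 2 * ab σ ^ (1 / 2 : ℝ) := by
      calc ab Ω ^ (1 / 2 : ℝ) ≤ (4 * ab σ) ^ (1 / 2 : ℝ) := ENNReal.rpow_le_rpow h (by norm_num)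
        _ = _ := by
          rw [ENNReal.mul_rpow_of_nonneg _ _ (by norm_num),
            show (4 : ℝ≥0∞) = 2 ^ (2 : ℝ) by norm_num, ← ENNReal.rpow_mul]
          norm_num
    have cancel : ∀ B : ℝ≥0∞, B ≠ 0 → B ≠ ⊤ → ∀ t : ℝ≥0∞, t ≤ B * ab σ →
        ab σ ^ (-(γ / 2)) ≤ B ^ (γ / 2) * t ^ (-(γ / 2)) := by
      intro B hB hB' t ht
      have := rpow_neg_antitone (by positivity : 0 ≤ γ / 2) ht
      rw [ENNReal.mul_rpow_of_ne_top hB' (ab_ne_top σ)] at this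
      calc ab σ ^ (-(γ / 2)) = B ^ (γ / 2) * (B ^ (-(γ / 2)) * ab σ ^ (-(γ / 2))) := by
            rw [← mul_assoc, ← ENNReal.rpow_add _ _ hB hB']; simp
        _ ≤ _ := by gcongr
    have h2 := cancel (A * 4) hA40 (ENNReal.mul_ne_top hA (by simp)) n hnσ
    have h3 := cancel (A * 4 + 1) (by simp)
      (ENNReal.add_ne_top.2 ⟨ENNReal.mul_ne_top hA (by simp), by simp⟩) (jb σ) (by
        calc jb σ ≤ 1 + ab σ := jb_le_one_add_ab σ
          _ ≤ A * 4 * ab σ + ab σ := by gcongr; exact hn1.trans hnσ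
          _ = _ := by ring)
    calc _ ≤ 2 * ab σ ^ (1 / 2 : ℝ) * ab σ ^ (-(1 / 2 + γ)) := by gcongr
      _ = 2 * (ab σ ^ (-(γ / 2)) * ab σ ^ (-(γ / 2))) := by
          rw [mul_assoc, ← ENNReal.rpow_add _ _ hσ0 (ab_ne_top σ),
            ← ENNReal.rpow_add _ _ hσ0 (ab_ne_top σ)]
          congr 2; ring
      _ ≤ 2 * (((A * 4) ^ (γ / 2) * (n : ℝ≥0∞) ^ (-(γ / 2)))
            * ((A * 4 + 1) ^ (γ / 2) * jb σ ^ (-(γ / 2)))) := by gcongr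
      _ = _ := by ring
  all_goals
    refine le_trans ?_ le_add_self
    rw [← mul_assoc]
    refine mul_le_mul_left ((hmod _ h).trans (mul_le_mul_right ?_ _)) _
  · rw [add_assoc]; exact le_self_add
  · exact le_add_self.trans le_self_add
  · exact le_add_self

theorem exists_kmin_le {j : ℕ} (hj : 1 ≤ j) :
    ∃ A : ℝ≥0∞, A ≠ ⊤ ∧ ∀ p : ℤ × ℤ, (kmin p : ℝ≥0∞) * (kmax p : ℝ≥0∞) ^ (2 * j)
      ≤ A * ab (res j p) := by
  obtain ⟨C, hC, h⟩ := exists_le_resonance hj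
  refine ⟨ENNReal.ofReal C, by simp, fun p => ?_⟩
  have hx : ∀ k : ℤ, |(k : ℝ)| = (k.natAbs : ℝ) := fun k => by
    rw [← Int.cast_abs, Int.abs_eq_natAbs, Int.cast_natCast]
  have := h p.1 p.2 (thd p) (kmax p) (kmin p) (by simp [thd]) (by
      rw [hx, hx, hx]
      have : kmax p = p.1.natAbs ∨ kmax p = p.2.natAbs ∨ kmax p = (thd p).natAbs := by
        unfold kmax; omega
      exact_mod_cast this)
    (by rw [hx]; unfold kmax; exact_mod_cast (by omega))
    (by rw [hx]; unfold kmax; exact_mod_cast (by omega))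
    (by rw [hx]; unfold kmax; exact_mod_cast (by omega))
    (by rw [hx]; unfold kmin; exact_mod_cast (by omega))
    (by rw [hx]; unfold kmin; exact_mod_cast (by omega))
    (by rw [hx]; unfold kmin; exact_mod_cast (by omega)) (by positivity)
  have e : |(p.1 : ℝ) ^ (2 * j + 1) + (p.2 : ℝ) ^ (2 * j + 1) + (thd p : ℝ) ^ (2 * j + 1)|
      = |res j p| := by
    have : res j p = (-1) ^ j * ((p.1 : ℝ) ^ (2 * j + 1) + (p.2 : ℝ) ^ (2 * j + 1)
        + (thd p : ℝ) ^ (2 * j + 1)) := by simp only [res, phase_eq]; ring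
    rw [this, abs_mul, abs_pow, abs_neg, abs_one, one_pow, one_mul]
  rw [e] at this
  have := ENNReal.ofReal_le_ofReal this
  rw [ENNReal.ofReal_mul hC.le, ENNReal.ofReal_mul (by positivity),
    ENNReal.ofReal_pow (by positivity), ENNReal.ofReal_natCast, ENNReal.ofReal_natCast] at this
  exact this

/-- The trilinear estimate. -/
theorem exists_tsum_trilin_le {j : ℕ} (hj : 1 ≤ j) {γ : ℝ} (hγ : 0 < γ) (hγ1 : γ < 1 / 2) :
    ∃ C : ℝ≥0∞, C ≠ ⊤ ∧ ∀ f : ℤ → ℝ → ℝ≥0∞, (∀ k, Measurable (f k)) → (∀ x, f 0 x = 0) →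
      ∑' p : ℤ × ℤ, (kmax p : ℝ≥0∞) ^ j *
          trilin (fun y => ab y ^ (-(1 / 2 + γ))) (f p.1) (f p.2) (f (thd p)) (res j p)
        ≤ C * (∑' k, wsq (f k)) ^ (3 / 2 : ℝ) := by
  obtain ⟨A, hA, hres⟩ := exists_kmin_le hj
  obtain ⟨D, hD, hker⟩ := exists_kernel_le hA hγ
  obtain ⟨C₀, hC₀, h₀⟩ := exists_trilin_jb_le (γ := γ / 2) (by positivity) (by linarith)
  obtain ⟨C₁, hC₁, h₁⟩ := exists_tsum_high_le hj hγ hγ1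
  obtain ⟨C₂, hC₂, h₂⟩ := exists_tsum_kmin_le (r := 1 / 2 + γ / 2) (by linarith)
  refine ⟨A ^ (1 / 2 : ℝ) * (D * (C₀ ^ (1 / 2 : ℝ) * C₂) + 2 * (C₁ + C₁ + C₁)), ?_,
    fun f hf hf0 => ?_⟩
  · have e1 : A ^ (1 / 2 : ℝ) ≠ ⊤ := by simp [hA]
    have e2 : C₀ ^ (1 / 2 : ℝ) ≠ ⊤ := by simp [hC₀]
    have e3 : C₁ + C₁ + C₁ ≠ ⊤ := by simp [hC₁]
    exact ENNReal.mul_ne_top e1 (ENNReal.add_ne_top.2 ⟨ENNReal.mul_ne_top hD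
      (ENNReal.mul_ne_top e2 hC₂), ENNReal.mul_ne_top (by simp) e3⟩)
  set V := ∑' k, wsq (f k) with hV
  set κ : ℝ → ℝ≥0∞ := fun y => ab y ^ (-(1 / 2 + γ)) with hκ
  have hκm : Measurable κ := by fun_prop
  set q : ℤ → ℝ≥0∞ := fun k => wsq (f k) ^ (1 / 2 : ℝ) with hq
  have hq2 : ∀ k, q k ^ 2 = wsq (f k) := fun k => by
    rw [hq, ← ENNReal.rpow_two, ← ENNReal.rpow_mul]; norm_num
  have hq0 : q 0 = 0 := by simp [hq, wsq, hf0]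
  have hVq : V = ∑' k, q k ^ 2 := by simp_rw [hq2]; rfl
  set h : ℤ → ℝ → ℝ≥0∞ := fun k x => jb x ^ (1 / 2 : ℝ) * f k x with hh
  have hhm : ∀ k, Measurable (h k) := fun k => by
    have := hf k
    simp only [hh]; fun_prop
  set w : ℤ × ℤ → ℝ≥0∞ := fun p => (kmin p : ℝ≥0∞) ^ (-(1 / 2) : ℝ) with hw
  have hS1 : ∑' p : ℤ × ℤ, w p * trilin κ (h p.1) (f p.2) (f (thd p)) (res j p)
      ≤ C₁ * V ^ (3 / 2 : ℝ) := h₁ f hf hf0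
  have hS2 : ∑' p : ℤ × ℤ, w p * trilin κ (f p.1) (h p.2) (f (thd p)) (res j p)
      ≤ C₁ * V ^ (3 / 2 : ℝ) := by
    refine le_trans (le_of_eq ?_) hS1
    rw [← (Equiv.prodComm ℤ ℤ).tsum_eq]
    refine tsum_congr fun p => ?_
    simp only [Equiv.prodComm_apply, thd_swap, Prod.fst_swap, Prod.snd_swap, hw, kmin_swap,
      res_swap]
    rw [trilin_swap hκm (hf _) (hhm _) (hf _)]
  have hS3 : ∑' p : ℤ × ℤ, w p * trilin κ (f p.1) (f p.2) (h (thd p)) (res j p)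
      ≤ C₁ * V ^ (3 / 2 : ℝ) := by
    refine le_trans (le_of_eq ?_) hS1
    rw [← swapThd.tsum_eq]
    refine tsum_congr fun p => ?_
    simp only [hw, kmin_swapThd, res_swapThd, thd_swapThd]
    simp only [swapThd, Equiv.coe_fn_mk]
    congr 1
    rw [trilin, bilin_comm, ← trilin, trilin_swap hκm (hf _) (hhm _) (hf _), trilin, bilin_comm,
      ← trilin]
  have hS0 : ∑' p : ℤ × ℤ, (kmin p : ℝ≥0∞) ^ (-(1 / 2 + γ / 2)) *
      trilin (fun y => jb y ^ (-(γ / 2))) (f p.1) (f p.2) (f (thd p)) (res j p)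
      ≤ C₀ ^ (1 / 2 : ℝ) * C₂ * V ^ (3 / 2 : ℝ) := by
    calc _ ≤ ∑' p : ℤ × ℤ, C₀ ^ (1 / 2 : ℝ) * ((kmin p : ℝ≥0∞) ^ (-(1 / 2 + γ / 2)) *
          (q p.1 * (q p.2 * q (thd p)))) := by
          refine ENNReal.tsum_le_tsum fun p => ?_
          rw [mul_left_comm]
          refine mul_le_mul_right (le_of_sq_le_sq ?_) _
          refine (h₀ (f p.1) (f p.2) (f (thd p)) (hf _) (hf _) (hf _) (res j p)).trans
            (le_of_eq ?_)
          rw [mul_pow, mul_pow, mul_pow, hq2, hq2, hq2, ← ENNReal.rpow_two, ← ENNReal.rpow_mul]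
          norm_num
      _ ≤ _ := by
          rw [ENNReal.tsum_mul_left, mul_assoc, hVq]
          gcongr
          exact h₂ q hq0
  have key : ∀ p : ℤ × ℤ, (kmax p : ℝ≥0∞) ^ j * trilin κ (f p.1) (f p.2) (f (thd p)) (res j p) ≤
      A ^ (1 / 2 : ℝ) * (D * ((kmin p : ℝ≥0∞) ^ (-(1 / 2 + γ / 2)) *
        trilin (fun y => jb y ^ (-(γ / 2))) (f p.1) (f p.2) (f (thd p)) (res j p)) +
        2 * (w p * trilin κ (h p.1) (f p.2) (f (thd p)) (res j p) +
          w p * trilin κ (f p.1) (h p.2) (f (thd p)) (res j p) +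
          w p * trilin κ (f p.1) (f p.2) (h (thd p)) (res j p))) := by
    intro p
    have hm1 := hf p.1
    have hm2 := hf p.2
    have hm3 := hf (thd p)
    have hn1 := hhm p.1
    have hn2 := hhm p.2
    have hn3 := hhm (thd p)
    by_cases hp : kmin p = 0
    · have hz : trilin κ (f p.1) (f p.2) (f (thd p)) (res j p) = 0 := by
        have : p.1 = 0 ∨ p.2 = 0 ∨ thd p = 0 := by unfold kmin at hp; omega
        rcases this with h0 | h0 | h0 <;> simp [trilin, bilin, h0, hf0]
      simp [hz]
    have hk1 : (1 : ℝ≥0∞) ≤ kmin p := by exact_mod_cast Nat.one_le_iff_ne_zero.2 hp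
    have hk0 : (kmin p : ℝ≥0∞) ≠ 0 := by exact_mod_cast hp
    have hM1 : (1 : ℝ≥0∞) ≤ kmax p := by
      have : kmin p ≤ kmax p := by unfold kmin kmax; omega
      exact hk1.trans (by exact_mod_cast this)
    have hle : (kmin p : ℝ≥0∞) ≤ A * ab (res j p) := by
      refine le_trans ?_ (hres p)
      calc (kmin p : ℝ≥0∞) = kmin p * 1 := (mul_one _).symm
        _ ≤ _ := by gcongr; exact one_le_pow₀ hM1
    -- Square root of the resonance bound: the weight costs half a power of the resonance and gains
    -- half a power of `kmin`.
    have hMj : (kmax p : ℝ≥0∞) ^ j ≤ A ^ (1 / 2 : ℝ) * w p * ab (res j p) ^ (1 / 2 : ℝ) := by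
      apply le_of_sq_le_sq
      have e1 : ∀ y : ℝ≥0∞, (y ^ (1 / 2 : ℝ)) ^ 2 = y := fun y => by
        rw [← ENNReal.rpow_two, ← ENNReal.rpow_mul]; norm_num
      have e2 : (w p) ^ 2 = (kmin p : ℝ≥0∞)⁻¹ := by
        rw [hw, ← ENNReal.rpow_two, ← ENNReal.rpow_mul, ← ENNReal.rpow_neg_one]; norm_num
      rw [mul_pow, mul_pow, e1, e1, e2, ← pow_mul, mul_comm j 2]
      calc (kmax p : ℝ≥0∞) ^ (2 * j)
          = ((kmin p : ℝ≥0∞)⁻¹ * kmin p) * (kmax p : ℝ≥0∞) ^ (2 * j) := by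
            rw [ENNReal.inv_mul_cancel hk0 (by simp), one_mul]
        _ = (kmin p : ℝ≥0∞)⁻¹ * (kmin p * (kmax p : ℝ≥0∞) ^ (2 * j)) := by ring
        _ ≤ (kmin p : ℝ≥0∞)⁻¹ * (A * ab (res j p)) := mul_le_mul_right (hres p) _
        _ = _ := by ring
    have hint : ab (res j p) ^ (1 / 2 : ℝ) * trilin κ (f p.1) (f p.2) (f (thd p)) (res j p) ≤
        D * (kmin p : ℝ≥0∞) ^ (-(γ / 2)) *
          trilin (fun y => jb y ^ (-(γ / 2))) (f p.1) (f p.2) (f (thd p)) (res j p) +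
        2 * (trilin κ (h p.1) (f p.2) (f (thd p)) (res j p) +
          trilin κ (f p.1) (h p.2) (f (thd p)) (res j p) +
          trilin κ (f p.1) (f p.2) (h (thd p)) (res j p)) := by
      rw [trilin_eq_lintegral hκm hm1 hm2 hm3, trilin_eq_lintegral (by fun_prop) hm1 hm2 hm3,
        trilin_eq_lintegral hκm hn1 hm2 hm3, trilin_eq_lintegral hκm hm1 hn2 hm3,
        trilin_eq_lintegral hκm hm1 hm2 hn3, ← lintegral_const_mul _ (by fun_prop),
        ← lintegral_const_mul _ (by fun_prop), ← lintegral_add_left (by fun_prop),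
        ← lintegral_add_left (by fun_prop), ← lintegral_const_mul _ (by fun_prop),
        ← lintegral_add_left (by fun_prop)]
      refine lintegral_mono fun v => ?_
      have := hker (kmin p) (res j p) v.1 v.2.1 v.2.2 hp hle
      set σ := v.1 - res j p + v.2.1 + v.2.2
      calc _ = (ab (res j p) ^ (1 / 2 : ℝ) * ab σ ^ (-(1 / 2 + γ)))
            * (f p.1 v.1 * (f p.2 v.2.1 * f (thd p) v.2.2)) := by simp only [hκ]; ring
        _ ≤ _ := mul_le_mul_left this _
        _ = _ := by simp only [hκ, hh]; ring
    have hwk : w p * (kmin p : ℝ≥0∞) ^ (-(γ / 2)) = (kmin p : ℝ≥0∞) ^ (-(1 / 2 + γ / 2)) := by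
      rw [hw, ← ENNReal.rpow_add _ _ hk0 (by simp)]; congr 1; ring
    calc _ ≤ A ^ (1 / 2 : ℝ) * w p * ab (res j p) ^ (1 / 2 : ℝ)
          * trilin κ (f p.1) (f p.2) (f (thd p)) (res j p) := by gcongr
      _ = A ^ (1 / 2 : ℝ) * w p * (ab (res j p) ^ (1 / 2 : ℝ)
          * trilin κ (f p.1) (f p.2) (f (thd p)) (res j p)) := by ring
      _ ≤ _ := mul_le_mul_right hint _
      _ = _ := by rw [← hwk]; ring
  refine (ENNReal.tsum_le_tsum key).trans ?_
  rw [ENNReal.tsum_mul_left, ENNReal.tsum_add, ENNReal.tsum_mul_left, ENNReal.tsum_mul_left,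
    ENNReal.tsum_add, ENNReal.tsum_add]
  calc _ ≤ A ^ (1 / 2 : ℝ) * (D * (C₀ ^ (1 / 2 : ℝ) * C₂ * V ^ (3 / 2 : ℝ)) +
        2 * (C₁ * V ^ (3 / 2 : ℝ) + C₁ * V ^ (3 / 2 : ℝ) + C₁ * V ^ (3 / 2 : ℝ))) := by gcongr
    _ = _ := by ring

/-! ### Parseval's identity on a bounded interval -/

/-- The two definitions of the Fourier transform agree on `L¹ ∩ L²`. -/
theorem fourier_toLp_ae_eq {f : ℝ → ℂ} (hf : Integrable f) (hf2 : MemLp f 2) :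
    ((𝓕 (hf2.toLp f) : Lp ℂ 2 (volume : Measure ℝ)) : ℝ → ℂ) =ᵐ[volume] 𝓕 f := by
  have hcont : Continuous (𝓕 f) :=
    VectorFourier.fourierIntegral_continuous Real.continuous_fourierChar
      (L := innerₗ ℝ) continuous_inner hf
  refine ae_eq_of_integral_contDiff_smul_eq ((Lp.memLp _).locallyIntegrable (by norm_num))
    hcont.locallyIntegrable fun g g_smooth g_cpt => ?_
  have hg₁ : HasCompactSupport (Complex.ofRealCLM ∘ g) := g_cpt.comp_left rfl
  have hg₂ : ContDiff ℝ ∞ (Complex.ofRealCLM ∘ g) := by fun_prop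
  set G := hg₁.toSchwartzMap hg₂ with hG
  have hGc : ∀ x, G x = (g x : ℂ) := fun x => by simp [hG]
  have h1 := DFunLike.congr_fun (Lp.fourier_toTemperedDistribution_eq (hf2.toLp f)) G
  rw [TemperedDistribution.fourier_apply, Lp.toTemperedDistribution_apply,
    Lp.toTemperedDistribution_apply] at h1
  have h2 : ∫ x, (𝓕 G) x • (hf2.toLp f : ℝ → ℂ) x = ∫ x, (𝓕 G) x • f x := by
    refine integral_congr_ae ?_
    filter_upwards [hf2.coeFn_toLp] with x hx
    rw [hx]
  have h3 : ∫ x, (𝓕 G) x • f x = ∫ x, G x • 𝓕 f x := by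
    rw [SchwartzMap.fourier_coe]
    simpa using! (VectorFourier.integral_fourierIntegral_smul_eq_flip (L := innerₗ ℝ)
      Real.continuous_fourierChar continuous_inner G.integrable hf)
  rw [h2, h3] at h1
  simp only [hGc] at h1
  simpa using h1.symm

/-- Plancherel for `v` and the conjugate of `w`, whose `L²` transform is identified with its
integral transform. -/
theorem integral_mul_eq_integral_fourier (v : Lp ℂ 2 (volume : Measure ℝ)) {w : ℝ → ℂ}
    (hw : Integrable w) (hw2 : MemLp w 2) :
    ∫ t, v t * w t = ∫ ξ, (𝓕 v : Lp ℂ 2 (volume : Measure ℝ)) ξ * 𝓕⁻ w ξ := by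
  set g : ℝ → ℂ := fun t => starRingEnd ℂ (w t) with hg
  have hg1 : Integrable g := by
    have := (Complex.conjCLE.toContinuousLinearMap).integrable_comp hw
    exact this
  have hg2 : MemLp g 2 := hw2.star
  have h := Lp.inner_fourier_eq (hg2.toLp g) v
  rw [L2.inner_def, L2.inner_def] at h
  have e1 : ∫ t, inner ℂ ((hg2.toLp g : ℝ → ℂ) t) (v t) = ∫ t, v t * w t := by
    refine integral_congr_ae ?_
    filter_upwards [hg2.coeFn_toLp] with t ht
    rw [ht, hg]
    simp
  have e2 : ∫ ξ, inner ℂ ((𝓕 (hg2.toLp g) : Lp ℂ 2 (volume : Measure ℝ)) ξ)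
      ((𝓕 v : Lp ℂ 2 (volume : Measure ℝ)) ξ)
      = ∫ ξ, (𝓕 v : Lp ℂ 2 (volume : Measure ℝ)) ξ * 𝓕⁻ w ξ := by
    refine integral_congr_ae ?_
    filter_upwards [fourier_toLp_ae_eq hg1 hg2] with ξ hξ
    rw [hξ]
    have : 𝓕⁻ w ξ = starRingEnd ℂ (𝓕 g ξ) := by
      rw [Real.fourierInv_eq', Real.fourier_real_eq_integral_exp_smul, ← integral_conj]
      refine integral_congr_ae (ae_of_all _ fun t => ?_)
      simp only [hg, smul_eq_mul, map_mul, Complex.conj_conj, ← Complex.exp_conj, Complex.conj_I,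
        Complex.conj_ofReal, RCLike.inner_apply, conj_trivial]
      congr 2
      push_cast
      ring
    rw [this]
    simp
  rw [← e1, ← e2, h]

/-- The function `a` is dominated on `[α, β]`, on the Fourier side, by `G`. -/
def FourierDom (a : ℝ → ℂ) (G : ℝ → ℝ≥0∞) (α β : ℝ) : Prop :=
  ∀ w : ℝ → ℂ, Continuous w → ‖∫ t in α..β, a t * w t‖ₑ ≤
    ∫⁻ τ, G τ * ‖∫ t in α..β, w t * Complex.exp (Complex.I * τ * t)‖ₑ

theorem lintegral_div_two_pi (F : ℝ → ℝ≥0∞) :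
    ∫⁻ ξ, F (2 * Real.pi * ξ) = ENNReal.ofReal (2 * Real.pi)⁻¹ * ∫⁻ τ, F τ := by
  have h0 : 2 * Real.pi ≠ 0 := by positivity
  have h := (Homeomorph.mulLeft₀ _ h0).measurableEmbedding.lintegral_map (μ := volume) F
  have hm : Measure.map (Homeomorph.mulLeft₀ _ h0) volume
      = ENNReal.ofReal (2 * Real.pi)⁻¹ • (volume : Measure ℝ) := by
    have h1 := Real.map_volume_mul_left h0
    rwa [abs_of_pos (by positivity)] at h1
  rw [hm, lintegral_smul_measure, smul_eq_mul] at h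
  exact h.symm

/-- Parseval for `v` and `w` cut off to the interval. The factor `(2π)⁻¹` in `timeFourier` is
exactly the Jacobian of the passage from frequency to angular frequency. -/
theorem enorm_intervalIntegral_mul_le (v : Lp ℂ 2 (volume : Measure ℝ)) {α β : ℝ} (hαβ : α ≤ β)
    {w : ℝ → ℂ} (hw : Continuous w) :
    ‖∫ t in α..β, v t * w t‖ₑ ≤
      ∫⁻ τ, ‖timeFourier v τ‖ₑ * ‖∫ t in α..β, w t * Complex.exp (Complex.I * τ * t)‖ₑ := by
  set u : ℝ → ℂ := (Set.Ioc α β).indicator w with hu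
  obtain ⟨M, hM⟩ := (isCompact_Icc (a := α) (b := β)).exists_bound_of_continuousOn hw.continuousOn
  have hu1 : Integrable u :=
    (hw.integrableOn_Ioc).integrable_indicator measurableSet_Ioc
  have hu2 : MemLp u 2 := by
    rw [hu, memLp_indicator_iff_restrict measurableSet_Ioc]
    refine MemLp.of_bound hw.aestronglyMeasurable M ?_
    rw [ae_restrict_iff' measurableSet_Ioc]
    exact ae_of_all _ fun t ht => hM t ⟨ht.1.le, ht.2⟩
  have h1 : ∫ t in α..β, v t * w t = ∫ t, v t * u t := by
    rw [intervalIntegral.integral_of_le hαβ, ← integral_indicator measurableSet_Ioc]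
    congr 1
    ext t
    by_cases ht : t ∈ Set.Ioc α β <;> simp [hu, ht]
  have h2 : ∀ ξ : ℝ, 𝓕⁻ u ξ
      = ∫ t in α..β, w t * Complex.exp (Complex.I * ((2 * Real.pi * ξ : ℝ) : ℂ) * t) := by
    intro ξ
    rw [Real.fourierInv_eq', intervalIntegral.integral_of_le hαβ,
      ← integral_indicator measurableSet_Ioc]
    congr 1
    ext t
    by_cases ht : t ∈ Set.Ioc α β
    · simp only [hu, ht, Set.indicator_of_mem, smul_eq_mul, RCLike.inner_apply, conj_trivial]
      rw [mul_comm]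
      congr 2
      push_cast
      ring
    · simp [hu, ht]
  rw [h1, integral_mul_eq_integral_fourier v hu1 hu2]
  refine (enorm_integral_le_lintegral_enorm _).trans (le_of_eq ?_)
  have h0 : (2 * Real.pi) ≠ 0 := by positivity
  set F : ℝ → ℝ≥0∞ := fun τ => ‖(𝓕 v : Lp ℂ 2 (volume : Measure ℝ)) (τ / (2 * Real.pi))‖ₑ *
    ‖∫ t in α..β, w t * Complex.exp (Complex.I * τ * t)‖ₑ with hF
  calc _ = ∫⁻ ξ, F (2 * Real.pi * ξ) := by
        refine lintegral_congr fun ξ => ?_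
        rw [enorm_mul, h2 ξ, hF]
        simp only
        rw [mul_div_cancel_left₀ _ h0]
    _ = ENNReal.ofReal (2 * Real.pi)⁻¹ * ∫⁻ τ, F τ := lintegral_div_two_pi F
    _ = _ := by
        rw [← lintegral_const_mul' _ _ (by simp)]
        refine lintegral_congr fun τ => ?_
        rw [hF, timeFourier, enorm_mul, ← mul_assoc]
        congr 2
        rw [← ofReal_norm, Complex.norm_real, Real.norm_of_nonneg (by positivity)]

/-- A function which agrees on an interval with an element of `L²` is dominated, together with its
translates, by the Fourier transform of that element. -/
theorem fourierDom_of_ae_eq {v : Lp ℂ 2 (volume : Measure ℝ)} {a : ℝ → ℂ} {δ : ℝ}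
    (hva : ∀ᵐ t ∂(volume.restrict (Set.Icc 0 δ)), v t = a t) {α β h : ℝ} (hαβ : α ≤ β)
    (hα : 0 ≤ α + h) (hβ : β + h ≤ δ) :
    FourierDom (fun t => a (t + h)) (fun τ => ‖timeFourier v τ‖ₑ) α β := by
  intro w hw
  have e1 : ∫ t in α..β, a (t + h) * w t = ∫ t in (α + h)..(β + h), v t * w (t - h) := by
    have : ∫ t in α..β, a (t + h) * w t = ∫ t in (α + h)..(β + h), a t * w (t - h) := by
      rw [← intervalIntegral.integral_comp_add_right]
      simp
    rw [this, intervalIntegral.integral_of_le (by linarith),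
      intervalIntegral.integral_of_le (by linarith)]
    refine integral_congr_ae ?_
    have hsub : Set.Ioc (α + h) (β + h) ⊆ Set.Icc 0 δ := fun t ht =>
      ⟨hα.trans ht.1.le, ht.2.trans hβ⟩
    filter_upwards [ae_restrict_of_ae_restrict_of_subset hsub hva] with t ht
    rw [ht]
  rw [e1]
  refine (enorm_intervalIntegral_mul_le v (by linarith)
    (by fun_prop : Continuous fun t => w (t - h))).trans (le_of_eq ?_)
  refine lintegral_congr fun τ => ?_
  congr 1
  rw [← intervalIntegral.integral_comp_add_right]
  -- Translation only produces the unimodular factor `exp (iτh)`, so the dominating function does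
  -- not change.
  have e2 : ∫ t in α..β, w (t + h - h)
      * Complex.exp (Complex.I * τ * ((t + h : ℝ) : ℂ))
      = Complex.exp (Complex.I * τ * h) *
        ∫ t in α..β, w t * Complex.exp (Complex.I * τ * t) := by
    rw [← intervalIntegral.integral_const_mul]
    refine intervalIntegral.integral_congr fun t _ => ?_
    simp only [add_sub_cancel_right]
    rw [Complex.ofReal_add, mul_add, Complex.exp_add]
    ring
  rw [e2, enorm_mul, ← ofReal_norm (Complex.exp _),
    show Complex.I * τ * h = ((τ * h : ℝ) : ℂ) * Complex.I by push_cast; ring,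
    Complex.norm_exp_ofReal_mul_I]
  simp

/-- Geometric interpolation between the trivial bound `δ` and the oscillatory bound `2 / |σ|`. -/
theorem enorm_integral_exp_le {α β δ : ℝ} (hαβ : α ≤ β) (hδ : β - α ≤ δ) {θ : ℝ} (hθ : 0 ≤ θ)
    (hθ1 : θ ≤ 1) (σ : ℝ) :
    ‖∫ t in α..β, Complex.exp (Complex.I * σ * t)‖ₑ ≤
      2 * ENNReal.ofReal δ ^ θ * ab σ ^ (-(1 - θ)) := by
  set X := ‖∫ t in α..β, Complex.exp (Complex.I * σ * t)‖ₑ with hX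
  have hnorm : ∀ t : ℝ, ‖Complex.exp (Complex.I * σ * t)‖ = 1 := fun t => by
    rw [show Complex.I * σ * t = ((σ * t : ℝ) : ℂ) * Complex.I by push_cast; ring,
      Complex.norm_exp_ofReal_mul_I]
  have h1 : X ≤ ENNReal.ofReal δ := by
    rw [hX, ← ofReal_norm]
    apply ENNReal.ofReal_le_ofReal
    have := intervalIntegral.norm_integral_le_of_norm_le_const (a := α) (b := β) (C := 1)
      (f := fun t : ℝ => Complex.exp (Complex.I * σ * t)) fun t _ => (hnorm t).le
    rw [abs_of_nonneg (by linarith), one_mul] at this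
    exact this.trans hδ
  have h2 : X ≤ 2 * (ab σ)⁻¹ := by
    rcases eq_or_ne σ 0 with rfl | hσ
    · simp [ab]
    · have hc : Complex.I * (σ : ℂ) ≠ 0 := mul_ne_zero Complex.I_ne_zero (by exact_mod_cast hσ)
      rw [hX, integral_exp_mul_complex hc, ← ofReal_norm, norm_div, norm_mul,
        Complex.norm_I, one_mul, Complex.norm_real, Real.norm_eq_abs, ab,
        ← ENNReal.ofReal_inv_of_pos (abs_pos.2 hσ), show (2 : ℝ≥0∞) = ENNReal.ofReal 2 by simp,
        ← ENNReal.ofReal_mul two_pos.le, ← div_eq_mul_inv]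
      apply ENNReal.ofReal_le_ofReal
      gcongr
      refine (norm_sub_le _ _).trans ?_
      rw [hnorm, hnorm]
      norm_num
  calc X = X ^ θ * X ^ (1 - θ) := by
        rw [← ENNReal.rpow_add_of_nonneg _ _ hθ (by linarith)]; simp
    _ ≤ ENNReal.ofReal δ ^ θ * (2 * (ab σ)⁻¹) ^ (1 - θ) := by
        gcongr
    _ ≤ ENNReal.ofReal δ ^ θ * (2 * ab σ ^ (-(1 - θ))) := by
        rw [ENNReal.mul_rpow_of_nonneg _ _ (by linarith), ENNReal.rpow_neg, ENNReal.inv_rpow]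
        gcongr
        calc (2 : ℝ≥0∞) ^ (1 - θ) ≤ 2 ^ (1 : ℝ) :=
              ENNReal.rpow_le_rpow_of_exponent_le (by norm_num) (by linarith)
          _ = 2 := by simp
    _ = _ := by ring

/-- A trilinear integral over an interval is dominated on the Fourier side. -/
theorem FourierDom.enorm_integral_le {a₁ a₂ a₃ : ℝ → ℂ} {G₁ G₂ G₃ : ℝ → ℝ≥0∞} {α β δ : ℝ}
    (h₁ : FourierDom a₁ G₁ α β) (h₂ : FourierDom a₂ G₂ α β) (h₃ : FourierDom a₃ G₃ α β)
    (ha₂ : Continuous a₂) (ha₃ : Continuous a₃) (hG₂ : Measurable G₂) (hG₃ : Measurable G₃)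
    (hαβ : α ≤ β) (hδ : β - α ≤ δ) {θ : ℝ} (hθ : 0 ≤ θ) (hθ1 : θ ≤ 1) :
    ‖∫ t in α..β, a₁ t * a₂ t * a₃ t‖ₑ ≤ 2 * ENNReal.ofReal δ ^ θ *
      ∫⁻ x, ∫⁻ y, ∫⁻ z, ab (x + y + z) ^ (-(1 - θ)) * (G₁ x * G₂ y * G₃ z) := by
  have hexp : ∀ x : ℝ, Continuous fun t : ℝ => Complex.exp (Complex.I * x * t) := fun x => by
    fun_prop
  -- The domination is used for one factor at a time, the others serving as test function. After
  -- three uses only a product of exponentials remains, integrated by `enorm_integral_exp_le`.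
  have inner_le : ∀ x y : ℝ, ‖∫ t in α..β, a₃ t
      * (Complex.exp (Complex.I * x * t) * Complex.exp (Complex.I * y * t))‖ₑ ≤
      2 * ENNReal.ofReal δ ^ θ * ∫⁻ z, ab (x + y + z) ^ (-(1 - θ)) * G₃ z := by
    intro x y
    refine (h₃ (fun t => Complex.exp (Complex.I * x * t) * Complex.exp (Complex.I * y * t))
      (by fun_prop)).trans ?_
    rw [← lintegral_const_mul _ (by fun_prop)]
    refine lintegral_mono fun z => ?_
    have e : ∀ t : ℝ, Complex.exp (Complex.I * x * t) * Complex.exp (Complex.I * y * t)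
        * Complex.exp (Complex.I * z * t) = Complex.exp (Complex.I * ((x + y + z : ℝ) : ℂ) * t) := by
      intro t
      rw [← Complex.exp_add, ← Complex.exp_add]
      congr 1; push_cast; ring
    simp_rw [e]
    calc _ ≤ G₃ z * _ := mul_le_mul_right (enorm_integral_exp_le hαβ hδ hθ hθ1 (x + y + z)) _
      _ = _ := by ring
  have middle_le : ∀ x : ℝ, ‖∫ t in α..β, (a₂ t * a₃ t) * Complex.exp (Complex.I * x * t)‖ₑ ≤
      2 * ENNReal.ofReal δ ^ θ * ∫⁻ y, ∫⁻ z, ab (x + y + z) ^ (-(1 - θ)) * (G₂ y * G₃ z) := by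
    intro x
    have e : ∀ t : ℝ, (a₂ t * a₃ t) * Complex.exp (Complex.I * x * t)
        = a₂ t * (a₃ t * Complex.exp (Complex.I * x * t)) := fun t => by ring
    simp_rw [e]
    refine (h₂ (fun t => a₃ t * Complex.exp (Complex.I * x * t)) (by fun_prop)).trans ?_
    have hm : Measurable fun y : ℝ => ∫⁻ z, ab (x + y + z) ^ (-(1 - θ)) * (G₂ y * G₃ z) :=
      Measurable.lintegral_prod_right'
        (f := fun p : ℝ × ℝ => ab (x + p.1 + p.2) ^ (-(1 - θ)) * (G₂ p.1 * G₃ p.2)) (by fun_prop)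
    rw [← lintegral_const_mul _ hm]
    refine lintegral_mono fun y => ?_
    have e2 : ∀ z : ℝ, ab (x + y + z) ^ (-(1 - θ)) * (G₂ y * G₃ z)
        = G₂ y * (ab (x + y + z) ^ (-(1 - θ)) * G₃ z) := fun z => by ring
    simp_rw [e2]
    rw [lintegral_const_mul _ (by fun_prop), mul_left_comm]
    refine mul_le_mul_right (le_trans (le_of_eq ?_) (inner_le x y)) _
    congr 2
    ext t
    ring
  have e : ∀ t : ℝ, a₁ t * a₂ t * a₃ t = a₁ t * (a₂ t * a₃ t) := fun t => by ring
  simp_rw [e]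
  refine (h₁ (fun t => a₂ t * a₃ t) (by fun_prop)).trans ?_
  have hcst : 2 * ENNReal.ofReal δ ^ θ ≠ ⊤ :=
    ENNReal.mul_ne_top (by simp) (ENNReal.rpow_ne_top_of_nonneg hθ ENNReal.ofReal_ne_top)
  rw [← lintegral_const_mul' _ _ hcst]
  refine lintegral_mono fun x => ?_
  have hm : ∀ x : ℝ, Measurable fun y : ℝ => ∫⁻ z, ab (x + y + z) ^ (-(1 - θ)) * (G₂ y * G₃ z) :=
    fun x => Measurable.lintegral_prod_right'
      (f := fun p : ℝ × ℝ => ab (x + p.1 + p.2) ^ (-(1 - θ)) * (G₂ p.1 * G₃ p.2)) (by fun_prop)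
  have e3 : ∫⁻ y, ∫⁻ z, ab (x + y + z) ^ (-(1 - θ)) * (G₁ x * G₂ y * G₃ z)
      = G₁ x * ∫⁻ y, ∫⁻ z, ab (x + y + z) ^ (-(1 - θ)) * (G₂ y * G₃ z) := by
    rw [← lintegral_const_mul _ (hm x)]
    refine lintegral_congr fun y => ?_
    rw [← lintegral_const_mul _ (by fun_prop)]
    refine lintegral_congr fun z => ?_
    ring
  rw [e3, mul_left_comm]
  exact mul_le_mul_right (middle_le x) _

/-- Passing from time frequencies to modulations shifts each variable by its phase; the shifts add
up to the resonance. -/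
theorem lintegral_shift_eq_trilin {F G₁ G₂ G₃ : ℝ → ℝ≥0∞} (hF : Measurable F)
    (hG₂ : Measurable G₂) (hG₃ : Measurable G₃) (P₁ P₂ P₃ : ℝ) :
    ∫⁻ x, ∫⁻ y, ∫⁻ z, F (x + y + z) * (G₁ x * G₂ y * G₃ z) =
      trilin F (fun x => G₁ (x - P₁)) (fun x => G₂ (x - P₂)) (fun x => G₃ (x - P₃))
        (P₁ + P₂ + P₃) := by
  rw [trilin_eq hF (by fun_prop) (by fun_prop), ← lintegral_sub_right_eq_self _ P₁]
  refine lintegral_congr fun x => ?_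
  rw [← lintegral_sub_right_eq_self _ P₂]
  refine lintegral_congr fun y => ?_
  rw [← lintegral_sub_right_eq_self _ P₃]
  refine lintegral_congr fun z => ?_
  congr 2
  ring

/-! ### The energy identity for a weak equation -/

/-- The Steklov pairing of `b` with `a + a(· + h)`. -/
noncomputable def steklov (a b : ℝ → ℂ) (δ h : ℝ) : ℂ :=
  ∫ σ in (0 : ℝ)..1, ∫ t in (0 : ℝ)..(δ - h),
    (starRingEnd ℂ (a (t + h)) + starRingEnd ℂ (a t)) * b (t + h * σ)

theorem continuous_conj_comp {X : Type*} [TopologicalSpace X] {f : X → ℂ} (hf : Continuous f) :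
    Continuous fun x => starRingEnd ℂ (f x) := Complex.continuous_conj.comp hf

theorem continuous_steklov {a b : ℝ → ℂ} (ha : Continuous a) (hb : Continuous b) (δ : ℝ) :
    Continuous (steklov a b δ) := by
  have h1 : Continuous (fun q : (ℝ × ℝ) × ℝ =>
      (starRingEnd ℂ (a (q.2 + q.1.1)) + starRingEnd ℂ (a q.2)) * b (q.2 + q.1.1 * q.1.2)) := by
    have e1 := continuous_conj_comp (by fun_prop : Continuous fun q : (ℝ × ℝ) × ℝ => a (q.2 + q.1.1))
    have e2 := continuous_conj_comp (by fun_prop : Continuous fun q : (ℝ × ℝ) × ℝ => a q.2)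
    fun_prop
  have h2 : Continuous (fun q : ℝ × ℝ => ∫ t in (0 : ℝ)..(δ - q.1),
      (starRingEnd ℂ (a (t + q.1)) + starRingEnd ℂ (a t)) * b (t + q.1 * q.2)) :=
    intervalIntegral.continuous_parametric_intervalIntegral_of_continuous
      (f := fun (q : ℝ × ℝ) t =>
        (starRingEnd ℂ (a (t + q.1)) + starRingEnd ℂ (a t)) * b (t + q.1 * q.2)) h1 (by fun_prop)
  exact intervalIntegral.continuous_parametric_intervalIntegral_of_continuous'
    (f := fun h σ => ∫ t in (0 : ℝ)..(δ - h),
      (starRingEnd ℂ (a (t + h)) + starRingEnd ℂ (a t)) * b (t + h * σ)) h2 0 1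

theorem steklov_zero (a b : ℝ → ℂ) (δ : ℝ) :
    steklov a b δ 0 = 2 * ∫ t in (0 : ℝ)..δ, b t * starRingEnd ℂ (a t) := by
  simp only [steklov, add_zero, sub_zero, zero_mul, intervalIntegral.integral_const, one_smul]
  rw [← intervalIntegral.integral_const_mul]
  refine intervalIntegral.integral_congr fun t _ => ?_
  ring

/-- Moving `b` to time `r` leaves `a` shifted by `h - hσ` or by `-hσ`. This is why the hypothesis is
required for all translations that stay in `[0, δ]`. -/
theorem norm_steklov_le {a b : ℝ → ℂ} (ha : Continuous a) (hb : Continuous b) {δ h M : ℝ}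
    (hh : 0 ≤ h) (hhδ : h ≤ δ)
    (hM : ∀ α β η : ℝ, α ≤ β → 0 ≤ α → β ≤ δ → 0 ≤ α + η → β + η ≤ δ →
      ‖∫ t in α..β, b t * starRingEnd ℂ (a (t + η))‖ ≤ M) :
    ‖steklov a b δ h‖ ≤ 2 * M := by
  have key : ∀ σ ∈ Set.uIoc (0 : ℝ) 1, ‖∫ t in (0 : ℝ)..(δ - h),
      (starRingEnd ℂ (a (t + h)) + starRingEnd ℂ (a t)) * b (t + h * σ)‖ ≤ 2 * M := by
    intro σ hσ
    rw [Set.uIoc_of_le zero_le_one] at hσ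
    have hs0 : 0 ≤ h * σ := mul_nonneg hh hσ.1.le
    have hs1 : h * σ ≤ h := mul_le_of_le_one_right hh hσ.2
    have c1 : ∀ η : ℝ, Continuous fun t => b t * starRingEnd ℂ (a (t + η)) := fun η =>
      hb.mul (continuous_conj_comp (by fun_prop))
    have e : ∫ t in (0 : ℝ)..(δ - h),
        (starRingEnd ℂ (a (t + h)) + starRingEnd ℂ (a t)) * b (t + h * σ) =
        (∫ r in (h * σ)..(δ - h + h * σ), b r * starRingEnd ℂ (a (r + (h - h * σ))))
        + ∫ r in (h * σ)..(δ - h + h * σ), b r * starRingEnd ℂ (a (r + -(h * σ))) := by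
      rw [← intervalIntegral.integral_add ((c1 _).intervalIntegrable _ _)
        ((c1 _).intervalIntegrable _ _)]
      have := intervalIntegral.integral_comp_add_right (a := 0) (b := δ - h)
        (fun r => b r * starRingEnd ℂ (a (r + (h - h * σ)))
          + b r * starRingEnd ℂ (a (r + -(h * σ)))) (h * σ)
      rw [zero_add] at this
      rw [← this]
      refine intervalIntegral.integral_congr fun t _ => ?_
      simp only [show t + h * σ + (h - h * σ) = t + h by ring,
        show t + h * σ + -(h * σ) = t by ring]
      ring
    rw [e, two_mul]
    refine (norm_add_le _ _).trans (add_le_add ?_ ?_)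
    · exact hM _ _ _ (by linarith) hs0 (by linarith) (by linarith) (by linarith)
    · exact hM _ _ _ (by linarith) hs0 (by linarith) (by linarith) (by linarith)
  rw [steklov]
  simpa using intervalIntegral.norm_integral_le_of_norm_le_const key

theorem mul_steklov {a b : ℝ → ℂ} (ha : Continuous a) (hb : Continuous b) {δ h : ℝ} :
    (h : ℂ) * steklov a b δ h = ∫ t in (0 : ℝ)..(δ - h),
      (starRingEnd ℂ (a (t + h)) + starRingEnd ℂ (a t)) * ∫ r in t..(t + h), b r := by
  rw [steklov, intervalIntegral_intervalIntegral_swap, ← intervalIntegral.integral_const_mul]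
  · refine intervalIntegral.integral_congr fun t _ => ?_
    rw [intervalIntegral.integral_const_mul, mul_left_comm]
    congr 1
    have := intervalIntegral.smul_integral_comp_add_mul (a := 0) (b := 1) b h t
    rw [mul_zero, mul_one, add_zero, Complex.real_smul] at this
    exact this
  · have h1 : Continuous (fun q : ℝ × ℝ =>
        (starRingEnd ℂ (a (q.2 + h)) + starRingEnd ℂ (a q.2)) * b (q.2 + h * q.1)) := by
      have e1 := continuous_conj_comp (by fun_prop : Continuous fun q : ℝ × ℝ => a (q.2 + h))
      have e2 := continuous_conj_comp (by fun_prop : Continuous fun q : ℝ × ℝ => a q.2)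
      fun_prop
    have : IntegrableOn (fun q : ℝ × ℝ =>
        (starRingEnd ℂ (a (q.2 + h)) + starRingEnd ℂ (a q.2)) * b (q.2 + h * q.1))
        (Set.uIcc 0 1 ×ˢ Set.uIcc 0 (δ - h)) :=
      h1.continuousOn.integrableOn_compact (isCompact_uIcc.prod isCompact_uIcc)
    exact this.mono_set (Set.prod_mono Set.uIoc_subset_uIcc Set.uIoc_subset_uIcc)

/-- The real part of the integrand is `‖a (t + h)‖ ^ 2 - ‖a t‖ ^ 2`, whose integral telescopes to
averages over the two ends of the interval. -/
theorem re_integral_steklov {a : ℝ → ℂ} (ha : Continuous a) {δ h : ℝ} :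
    (∫ t in (0 : ℝ)..(δ - h),
      (starRingEnd ℂ (a (t + h)) + starRingEnd ℂ (a t)) * (a (t + h) - a t)).re
      = h * ∫ σ in (0 : ℝ)..1, (‖a (δ - h * σ)‖ ^ 2 - ‖a (h * σ)‖ ^ 2) := by
  have c : Continuous fun t => ‖a t‖ ^ 2 := by fun_prop
  have ci : ∀ x y, IntervalIntegrable (fun t => ‖a t‖ ^ 2) volume x y := fun x y =>
    c.intervalIntegrable x y
  have e0 : (∫ t in (0 : ℝ)..(δ - h),
      (starRingEnd ℂ (a (t + h)) + starRingEnd ℂ (a t)) * (a (t + h) - a t)).re =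
      ∫ t in (0 : ℝ)..(δ - h), (‖a (t + h)‖ ^ 2 - ‖a t‖ ^ 2) := by
    have e1 := continuous_conj_comp (by fun_prop : Continuous fun q : ℝ => a (q + h))
    have e2 := continuous_conj_comp (by fun_prop : Continuous fun q : ℝ => a q)
    have hc : Continuous fun t =>
        (starRingEnd ℂ (a (t + h)) + starRingEnd ℂ (a t)) * (a (t + h) - a t) := by fun_prop
    have := Complex.reCLM.intervalIntegral_comp_comm (hc.intervalIntegrable (μ := volume) 0 (δ - h))
    rw [Complex.reCLM_apply] at this
    rw [← this]
    refine intervalIntegral.integral_congr fun t _ => ?_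
    simp only [Complex.reCLM_apply, ← Complex.normSq_eq_norm_sq, Complex.normSq_apply,
      Complex.mul_re, Complex.add_re, Complex.sub_re, Complex.add_im, Complex.sub_im,
      Complex.conj_re, Complex.conj_im]
    ring
  have e3 := intervalIntegral.smul_integral_comp_sub_mul (a := 0) (b := 1) (fun t => ‖a t‖ ^ 2) h δ
  have e4 := intervalIntegral.smul_integral_comp_mul_left (a := 0) (b := 1) (fun t => ‖a t‖ ^ 2) h
  have e5 := intervalIntegral.integral_comp_add_right (a := 0) (b := δ - h) (fun t => ‖a t‖ ^ 2) h
  simp only [smul_eq_mul, mul_one, mul_zero, sub_zero, zero_add, sub_add_cancel] at e3 e4 e5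
  rw [e0, intervalIntegral.integral_sub ((by fun_prop : Continuous _).intervalIntegrable _ _)
    (ci _ _), intervalIntegral.integral_sub ((by fun_prop : Continuous _).intervalIntegrable _ _)
    ((by fun_prop : Continuous _).intervalIntegrable _ _), mul_sub, e3, e4, e5]
  linarith [intervalIntegral.integral_add_adjacent_intervals (ci 0 h) (ci h δ),
    intervalIntegral.integral_add_adjacent_intervals (ci 0 (δ - h)) (ci (δ - h) δ)]

/-- If `a' = ∑ b_l` in the time-integrated sense, then `(|a|²)' = 2 Re ∑ b_l ā` in the
time-integrated sense, provided that the integrals of `b_l ā(· + η)` are summable uniformly in the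
translations. -/
theorem hasSum_energy {ι : Type*} [Countable ι] {a : ℝ → ℂ} {b : ι → ℝ → ℂ} (ha : Continuous a)
    (hb : ∀ l, Continuous (b l)) {δ : ℝ} (hδ : 0 < δ) {M : ι → ℝ} (hM : Summable M)
    (hsum : ∀ t ∈ Set.Icc 0 δ, HasSum (fun l => ∫ r in (0 : ℝ)..t, b l r) (a t - a 0))
    (hM1 : ∀ l, ∀ t ∈ Set.Icc 0 δ, ‖∫ r in (0 : ℝ)..t, b l r‖ ≤ M l)
    (hM2 : ∀ l, ∀ α β η : ℝ, α ≤ β → 0 ≤ α → β ≤ δ → 0 ≤ α + η → β + η ≤ δ →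
      ‖∫ t in α..β, b l t * starRingEnd ℂ (a (t + η))‖ ≤ M l) :
    HasSum (fun l => 2 * (∫ t in (0 : ℝ)..δ, b l t * starRingEnd ℂ (a t)).re)
      (‖a δ‖ ^ 2 - ‖a 0‖ ^ 2) := by
  have hbd : ∀ h ∈ Set.Ioo 0 δ, ∀ l, ‖steklov a (b l) δ h‖ ≤ 2 * M l := fun h hh l =>
    norm_steklov_le ha (hb l) hh.1.le hh.2.le (hM2 l)
  have hbd0 : ∀ l, ‖steklov a (b l) δ 0‖ ≤ 2 * M l := fun l =>
    norm_steklov_le ha (hb l) le_rfl hδ.le (hM2 l)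
  have hIoo : ∀ᶠ h in 𝓝[>] (0 : ℝ), h ∈ Set.Ioo 0 δ := Ioo_mem_nhdsGT hδ
  -- The real part of this sum is known for `h > 0` from the telescoped identity. Dominated
  -- convergence carries it to `h = 0`, where the pairing is `2 ∫ b_l ā`.
  have hlim : Tendsto (fun h => ∑' l, steklov a (b l) δ h) (𝓝[>] 0)
      (𝓝 (∑' l, steklov a (b l) δ 0)) := by
    refine tendsto_tsum_of_dominated_convergence (hM.mul_left 2) (fun l => ?_) ?_
    · exact ((continuous_steklov ha (hb l) δ).tendsto 0).mono_left nhdsWithin_le_nhds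
    · filter_upwards [hIoo] with h hh l using hbd h hh l
  have hre : ∀ h ∈ Set.Ioo 0 δ, (∑' l, steklov a (b l) δ h).re
      = ∫ σ in (0 : ℝ)..1, (‖a (δ - h * σ)‖ ^ 2 - ‖a (h * σ)‖ ^ 2) := by
    intro h hh
    have hS : Summable fun l => steklov a (b l) δ h :=
      Summable.of_norm_bounded (hM.mul_left 2) (hbd h hh)
    have e1 := continuous_conj_comp (by fun_prop : Continuous fun q : ℝ => a (q + h))
    have e2 := continuous_conj_comp (by fun_prop : Continuous fun q : ℝ => a q)
    have e3 : Continuous fun t => starRingEnd ℂ (a (t + h)) + starRingEnd ℂ (a t) := by fun_prop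
    obtain ⟨A, hA⟩ := (isCompact_Icc (a := 0) (b := δ)).exists_bound_of_continuousOn e3.continuousOn
    have key : HasSum (fun l => (h : ℂ) * steklov a (b l) δ h)
        (∫ t in (0 : ℝ)..(δ - h),
          (starRingEnd ℂ (a (t + h)) + starRingEnd ℂ (a t)) * (a (t + h) - a t)) := by
      have : (fun l => (h : ℂ) * steklov a (b l) δ h) = fun l => ∫ t in (0 : ℝ)..(δ - h),
          (starRingEnd ℂ (a (t + h)) + starRingEnd ℂ (a t)) * ∫ r in t..(t + h), b l r :=
        funext fun l => mul_steklov ha (hb l)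
      rw [this]
      have hsub : ∀ t l, ∫ r in t..(t + h), b l r
          = (∫ r in (0 : ℝ)..(t + h), b l r) - ∫ r in (0 : ℝ)..t, b l r := fun t l =>
        (intervalIntegral.integral_interval_sub_left ((hb l).intervalIntegrable _ _)
          ((hb l).intervalIntegrable _ _)).symm
      have hmem : ∀ t ∈ Set.uIoc 0 (δ - h), t ∈ Set.Icc 0 δ ∧ t + h ∈ Set.Icc 0 δ := by
        intro t ht
        rw [Set.uIoc_of_le (by linarith [hh.2])] at ht
        exact ⟨⟨ht.1.le, by linarith [ht.2, hh.1]⟩, by linarith [ht.1, hh.1], by linarith [ht.2]⟩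
      refine intervalIntegral.hasSum_integral_of_dominated_convergence
        (fun l _ => A * (2 * M l)) (fun l => ?_) (fun l => ae_of_all _ fun t ht => ?_)
        (ae_of_all _ fun t _ => (hM.mul_left 2).mul_left A) (by simp)
        (ae_of_all _ fun t ht => ?_)
      · have : Continuous fun t => ∫ r in t..(t + h), b l r := by
          simp_rw [hsub]
          have := intervalIntegral.continuous_primitive
            (fun x y => (hb l).intervalIntegrable (μ := volume) x y) 0
          exact (this.comp (by fun_prop : Continuous fun t : ℝ => t + h)).sub this
        exact (e3.mul this).aestronglyMeasurable
      · rw [norm_mul]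
        refine mul_le_mul (hA t (hmem t ht).1) ?_ (norm_nonneg _) ((norm_nonneg _).trans
          (hA t (hmem t ht).1))
        rw [hsub, two_mul]
        exact (norm_sub_le _ _).trans (add_le_add (hM1 l _ (hmem t ht).2) (hM1 l _ (hmem t ht).1))
      · simp_rw [hsub]
        refine HasSum.mul_left _ ?_
        have := (hsum _ (hmem t ht).2).sub (hsum _ (hmem t ht).1)
        simpa using this
    have h1 := key.unique (hS.hasSum.mul_left (h : ℂ))
    have h2 := re_integral_steklov ha (δ := δ) (h := h)
    rw [h1, Complex.re_ofReal_mul] at h2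
    exact mul_left_cancel₀ hh.1.ne' h2
  have hcont : Continuous fun h : ℝ =>
      ∫ σ in (0 : ℝ)..1, (‖a (δ - h * σ)‖ ^ 2 - ‖a (h * σ)‖ ^ 2) :=
    intervalIntegral.continuous_parametric_intervalIntegral_of_continuous'
      (f := fun h σ => ‖a (δ - h * σ)‖ ^ 2 - ‖a (h * σ)‖ ^ 2) (by fun_prop) 0 1
  have hlim2 : Tendsto (fun h => (∑' l, steklov a (b l) δ h).re) (𝓝[>] 0)
      (𝓝 (‖a δ‖ ^ 2 - ‖a 0‖ ^ 2)) := by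
    have := (hcont.tendsto 0).mono_left (nhdsWithin_le_nhds (s := Set.Ioi 0))
    simp only [zero_mul, sub_zero, intervalIntegral.integral_const, one_smul] at this
    refine this.congr' ?_
    filter_upwards [hIoo] with h hh using (hre h hh).symm
  have h0 : (∑' l, steklov a (b l) δ 0).re = ‖a δ‖ ^ 2 - ‖a 0‖ ^ 2 :=
    tendsto_nhds_unique ((Complex.continuous_re.tendsto _).comp hlim) hlim2
  have hS0 : Summable fun l => steklov a (b l) δ 0 :=
    Summable.of_norm_bounded (hM.mul_left 2) hbd0
  have := Complex.hasSum_re hS0.hasSum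
  rw [h0] at this
  convert! this using 2 with l
  rw [steklov_zero]
  simp

/-! ### The equation in Fourier modes -/

/-- The coefficient functions of `u`, continued from `[0, δ]` as constants. -/
noncomputable def extend (δ : ℝ) (u : ℝ → ℤ → ℂ) (k : ℤ) (t : ℝ) : ℂ := u (max 0 (min t δ)) k

/-- The symbol `3 + (x² + y² + z²) / 2` of the symmetrised nonlinearity. -/
noncomputable def quad (p : ℤ × ℤ) : ℝ :=
  3 + ((p.1 : ℝ) ^ 2 + (p.2 : ℝ) ^ 2 + (thd p : ℝ) ^ 2) / 2

theorem quad_pos (p : ℤ × ℤ) : 0 < quad p := by unfold quad; positivity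

/-- The frequencies `l` with `|l| ≤ K` and `|k - l| ≤ K`. -/
noncomputable def freqs (K : ℕ) (k : ℤ) : Finset ℤ :=
  (Finset.Icc (-(K : ℤ)) (K : ℤ)).filter (fun l => |k - l| ≤ (K : ℤ))

theorem mem_freqs {K : ℕ} {k l : ℤ} : l ∈ freqs K k ↔ |l| ≤ K ∧ |k - l| ≤ K := by
  rw [freqs, Finset.mem_filter, Finset.mem_Icc, ← abs_le]

/-- The truncations exhaust all frequencies, so for summable terms their limit is the unconditional
sum. -/
theorem tendsto_freqs (k : ℤ) : Tendsto (fun K => freqs K k) atTop atTop := by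
  refine tendsto_atTop_finset_of_monotone (fun K L h l hl => ?_) fun l => ?_
  · rw [mem_freqs] at *
    have : (K : ℤ) ≤ L := by exact_mod_cast h
    exact ⟨hl.1.trans this, hl.2.trans this⟩
  · refine ⟨l.natAbs + (k - l).natAbs, mem_freqs.2 ⟨?_, ?_⟩⟩ <;> push_cast <;>
      linarith [abs_nonneg l, abs_nonneg (k - l)]

/-- The truncated index set is invariant under `l ↦ k - l`. Averaging over this reflection brings
out the factor `k` and leaves a symbol symmetric in the three frequencies. -/
theorem truncNonlin_eq (K : ℕ) (a : ℤ → ℂ) (k : ℤ) :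
    truncNonlin K a k =
      ∑ l ∈ freqs K k, Complex.I * k / 2 * quad (l, k - l) * (a l * a (k - l)) := by
  set g : ℤ → ℂ := fun l => a l * a (k - l) * (3 * (Complex.I * ((k - l : ℤ) : ℂ))
    - 2 * ((Complex.I * (l : ℂ)) * (Complex.I * ((k - l : ℤ) : ℂ)) ^ 2)
    - (Complex.I * ((k - l : ℤ) : ℂ)) ^ 3) with hg
  have h1 : truncNonlin K a k = ∑ l ∈ freqs K k, g l := by
    simp only [truncNonlin, truncProd, Finset.mul_sum, freqs, ← Finset.sum_sub_distrib]
    refine Finset.sum_congr rfl fun l _ => ?_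
    simp only [fourierDeriv, hg]
    ring
  have h2 : ∑ l ∈ freqs K k, g l = ∑ l ∈ freqs K k, g (k - l) := by
    refine Finset.sum_nbij' (fun l => k - l) (fun l => k - l) ?_ ?_ ?_ ?_ ?_
    · intro l hl; rw [mem_freqs] at *; exact ⟨hl.2, by simpa using hl.1⟩
    · intro l hl; rw [mem_freqs] at *; exact ⟨hl.2, by simpa using hl.1⟩
    · intro l _; ring
    · intro l _; ring
    · intro l _; simp
  have h3 : truncNonlin K a k = ∑ l ∈ freqs K k, (g l + g (k - l)) / 2 := by
    rw [← Finset.sum_div, Finset.sum_add_distrib, ← h2, h1]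
    ring
  rw [h3]
  refine Finset.sum_congr rfl fun l _ => ?_
  simp only [hg, quad, thd, sub_sub_cancel]
  push_cast
  -- The two sides agree modulo `I ^ 2 = -1`; the coefficient collects the terms of third order in
  -- the derivatives.
  linear_combination (norm := (ring_nf)) (a l * a (k - l) * Complex.I * (k : ℂ) *
    (-2 * l * (k - l) - (l ^ 2 - l * (k - l) + (k - l) ^ 2)) / 2) * Complex.I_sq

theorem fourierDeriv_linear (j : ℕ) (a : ℤ → ℂ) (k : ℤ) :
    fourierDeriv (2 * j + 1) a k - fourierDeriv (2 * j + 3) a k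
      = (1 + (k : ℂ) ^ 2) * (Complex.I * phase j k * a k) := by
  have h : (Complex.I * (k : ℂ)) ^ 2 = -(k : ℂ) ^ 2 := by rw [mul_pow, Complex.I_sq]; ring
  have h1 : (Complex.I * (k : ℂ)) ^ (2 * j + 1) = Complex.I * ((-1) ^ j * (k : ℂ) ^ (2 * j + 1)) := by
    rw [pow_succ, pow_mul, h, neg_pow, ← pow_mul]; ring
  have h3 : (Complex.I * (k : ℂ)) ^ (2 * j + 3) = -(k : ℂ) ^ 2 * (Complex.I * (k : ℂ)) ^ (2 * j + 1) := by
    rw [← h]; ring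
  simp only [fourierDeriv, h3, h1, phase]
  push_cast
  ring

theorem sub_fourierDeriv_two (a : ℤ → ℂ) (k : ℤ) :
    a k - fourierDeriv 2 a k = (1 + (k : ℂ) ^ 2) * a k := by
  rw [fourierDeriv, mul_pow, Complex.I_sq]; ring

theorem MemSobolev.sub {s : ℝ} {a b : ℤ → ℂ} (ha : MemSobolev s a) (hb : MemSobolev s b) :
    MemSobolev s (a - b) := by
  refine Summable.of_nonneg_of_le (fun k => ?_) (fun k => ?_) ((ha.add hb).mul_left 2)
  · have := bracket_pos k; positivity
  · have h0 : 0 ≤ bracket k ^ (2 * s) := by have := bracket_pos k; positivity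
    have h1 : ‖(a - b) k‖ ^ 2 ≤ 2 * (‖a k‖ ^ 2 + ‖b k‖ ^ 2) := by
      have := norm_sub_le (a k) (b k)
      rw [Pi.sub_apply]
      nlinarith [norm_nonneg (a k - b k), sq_nonneg (‖a k‖ - ‖b k‖)]
    calc _ ≤ bracket k ^ (2 * s) * (2 * (‖a k‖ ^ 2 + ‖b k‖ ^ 2)) := by gcongr
      _ = _ := by ring

theorem MemSobolev.norm_le {s : ℝ} {a : ℤ → ℂ} (ha : MemSobolev s a) (k : ℤ) :
    ‖a k‖ ≤ bracket k ^ (-s) * sobolevNorm s a := by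
  have hp := bracket_pos (k : ℝ)
  have h1 : bracket k ^ (2 * s) * ‖a k‖ ^ 2 ≤ ∑' k : ℤ, bracket k ^ (2 * s) * ‖a k‖ ^ 2 :=
    ha.le_tsum k fun l _ => by have := bracket_pos (l : ℝ); positivity
  have h2 : bracket k ^ s * ‖a k‖ ≤ sobolevNorm s a := by
    refine Real.le_sqrt_of_sq_le ?_
    rwa [mul_pow, ← Real.rpow_natCast (bracket k ^ s), ← Real.rpow_mul hp.le, mul_comm s,
      Nat.cast_ofNat]
  rw [Real.rpow_neg hp.le, inv_mul_eq_div, le_div_iff₀ (by positivity)]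
  linarith

namespace IsSolution

variable {j : ℕ} {s δ : ℝ} {u : ℝ → ℤ → ℂ}

theorem clamp_mem (hδ : 0 < δ) (t : ℝ) : max 0 (min t δ) ∈ Set.Icc 0 δ :=
  ⟨le_max_left _ _, max_le hδ.le (min_le_right _ _)⟩

theorem extend_eq {t : ℝ} (ht : t ∈ Set.Icc 0 δ) (k : ℤ) : extend δ u k t = u t k := by
  rw [extend, min_eq_left ht.2, max_eq_right ht.1]

theorem continuous_extend (hu : IsSolution j s δ u) (hδ : 0 < δ) (k : ℤ) :
    Continuous (extend δ u k) := by
  have h : ContinuousOn (fun t => u t k) (Set.Icc 0 δ) := by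
    intro t₀ ht₀
    rw [ContinuousWithinAt, tendsto_iff_norm_sub_tendsto_zero]
    have h0 := (hu.cont t₀ ht₀).const_mul (bracket k ^ (-s))
    rw [mul_zero] at h0
    refine squeeze_zero' (Eventually.of_forall fun t => norm_nonneg _) ?_ h0
    filter_upwards [self_mem_nhdsWithin] with t ht
    exact ((hu.mem t ht).sub (hu.mem t₀ ht₀)).norm_le k
  exact h.comp_continuous (by fun_prop) (clamp_mem hδ)

theorem extend_neg (hu : IsSolution j s δ u) (hδ : 0 < δ) (k : ℤ) (t : ℝ) :
    extend δ u (-k) t = starRingEnd ℂ (extend δ u k t) :=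
  hu.real _ (clamp_mem hδ t) k

/-- The mean is conserved because the linear and the symmetrised nonlinear term both carry a factor
`k`. -/
theorem extend_zero (hu : IsSolution j s δ u) (hδ : 0 < δ) (t : ℝ) : extend δ u 0 t = 0 := by
  have h := hu.equation _ (clamp_mem hδ t) 0
  simp only [sub_fourierDeriv_two, fourierDeriv_linear, truncNonlin_eq] at h
  rw [extend]
  simpa [phase, hu.mean_zero] using h

/-- The coefficient of `u_l u_{k-l}` in the equation for `u_k`. -/
noncomputable def coeff (k l : ℤ) : ℂ := Complex.I * k / (2 * (1 + (k : ℂ) ^ 2)) * quad (l, k - l)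

theorem one_add_sq_ne_zero (k : ℤ) : (1 + (k : ℂ) ^ 2) ≠ 0 := by
  have : (0 : ℝ) < 1 + (k : ℝ) ^ 2 := by positivity
  exact_mod_cast this.ne'

theorem tendsto_sum (hu : IsSolution j s δ u) (hδ : 0 < δ) (k : ℤ) {t : ℝ}
    (ht : t ∈ Set.Icc 0 δ) :
    Tendsto (fun K => ∑ l ∈ freqs K k,
        ∫ r in (0 : ℝ)..t, -(coeff k l * (extend δ u l r * extend δ u (k - l) r))) atTop
      (𝓝 (extend δ u k t - extend δ u k 0
        - ∫ r in (0 : ℝ)..t, -(Complex.I * phase j k * extend δ u k r))) := by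
  have hc := fun k => hu.continuous_extend hδ k
  have h := (hu.equation t ht k).const_mul ((1 + (k : ℂ) ^ 2)⁻¹)
  rw [mul_zero] at h
  have h' := h.const_sub (extend δ u k t - extend δ u k 0
        - ∫ r in (0 : ℝ)..t, -(Complex.I * phase j k * extend δ u k r))
  rw [sub_zero] at h'
  refine h'.congr fun K => ?_
  have hne := one_add_sq_ne_zero k
  have e1 : ∫ r in (0 : ℝ)..t, (fourierDeriv (2 * j + 1) (u r) k - fourierDeriv (2 * j + 3) (u r) k
      + truncNonlin K (u r) k) = ∫ r in (0 : ℝ)..t, (1 + (k : ℂ) ^ 2) *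
        (Complex.I * phase j k * extend δ u k r
          + ∑ l ∈ freqs K k, coeff k l * (extend δ u l r * extend δ u (k - l) r)) := by
    refine intervalIntegral.integral_congr fun r hr => ?_
    rw [Set.uIcc_of_le ht.1] at hr
    have hr' : r ∈ Set.Icc 0 δ := ⟨hr.1, hr.2.trans ht.2⟩
    simp only [fourierDeriv_linear, truncNonlin_eq, extend_eq hr', mul_add, Finset.mul_sum]
    congr 1
    refine Finset.sum_congr rfl fun l _ => ?_
    rw [coeff]
    field_simp
  rw [e1, intervalIntegral.integral_const_mul, intervalIntegral.integral_add
    ((by fun_prop : Continuous _).intervalIntegrable _ _)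
    ((by fun_prop : Continuous _).intervalIntegrable _ _), intervalIntegral.integral_finsetSum
    (fun l _ => (by fun_prop : Continuous _).intervalIntegrable _ _), sub_fourierDeriv_two,
    sub_fourierDeriv_two, ← extend_eq (u := u) ht k, ← extend_eq (u := u) ⟨le_rfl, hδ.le⟩ k]
  simp only [intervalIntegral.integral_neg, Finset.sum_neg_distrib]
  field_simp
  ring

end IsSolution

namespace IsSolution

variable {j : ℕ} {s δ : ℝ} {u : ℝ → ℤ → ℂ}

/-- The energy identity in one Fourier mode. -/
theorem hasSum_mode (hu : IsSolution j s δ u) (hδ : 0 < δ) (k : ℤ) {M : ℤ → ℝ} (hM : Summable M)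
    (h1 : ∀ l, ∀ t ∈ Set.Icc 0 δ,
      ‖∫ r in (0 : ℝ)..t, coeff k l * (extend δ u l r * extend δ u (k - l) r)‖ ≤ M l)
    (h2 : ∀ l, ∀ α β η : ℝ, α ≤ β → 0 ≤ α → β ≤ δ → 0 ≤ α + η → β + η ≤ δ →
      ‖∫ t in α..β, coeff k l * (extend δ u l t * extend δ u (k - l) t)
        * extend δ u (-k) (t + η)‖ ≤ M l) :
    HasSum (fun l => k / (1 + (k : ℝ) ^ 2) * quad (l, k - l) *
        (∫ t in (0 : ℝ)..δ, extend δ u l t * extend δ u (k - l) t * extend δ u (-k) t).im)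
      (‖u δ k‖ ^ 2 - ‖u 0 k‖ ^ 2) := by
  have hc := fun k => hu.continuous_extend hδ k
  -- The extra index holds the linear term, so that `hasSum_energy` treats the whole right-hand side
  -- as one family.
  set b : Unit ⊕ ℤ → ℝ → ℂ := Sum.elim (fun _ r => -(Complex.I * phase j k * extend δ u k r))
    (fun l r => -(coeff k l * (extend δ u l r * extend δ u (k - l) r))) with hb
  have hbc : ∀ i, Continuous (b i) := by
    rintro (_ | l)
    · simp only [hb, Sum.elim_inl]; fun_prop
    · simp only [hb, Sum.elim_inr]; fun_prop
  obtain ⟨A, hA⟩ := (isCompact_Icc (a := 0) (b := δ)).exists_bound_of_continuousOn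
    (hc k).continuousOn
  have hA0 : 0 ≤ A := (norm_nonneg _).trans (hA 0 ⟨le_rfl, hδ.le⟩)
  have hlin : ∀ r ∈ Set.Icc 0 δ, ‖-(Complex.I * phase j k * extend δ u k r)‖ ≤ |phase j k| * A := by
    intro r hr
    rw [norm_neg, norm_mul, norm_mul, Complex.norm_I, one_mul, Complex.norm_real, Real.norm_eq_abs]
    exact mul_le_mul_of_nonneg_left (hA r hr) (abs_nonneg _)
  have hint : ∀ {f : ℝ → ℂ} {D α β : ℝ}, α ≤ β → 0 ≤ α → β ≤ δ → 0 ≤ D →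
      (∀ r ∈ Set.Icc α β, ‖f r‖ ≤ D) → ‖∫ r in α..β, f r‖ ≤ D * δ := by
    intro f D α β hαβ hα hβ hD h
    refine (intervalIntegral.norm_integral_le_of_norm_le_const (C := D) fun r hr => ?_).trans ?_
    · rw [Set.uIoc_of_le hαβ] at hr
      exact h r ⟨hr.1.le, hr.2⟩
    · rw [abs_of_nonneg (by linarith)]
      exact mul_le_mul_of_nonneg_left (by linarith) hD
  set M' : Unit ⊕ ℤ → ℝ := Sum.elim (fun _ => |phase j k| * A * δ + |phase j k| * A * A * δ) M with hM'
  have hpos : 0 ≤ |phase j k| * A := by positivity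
  have hM's : Summable M' := by
    refine (HasSum.sum (f := M') (a := M' (Sum.inl ())) (b := ∑' l, M l) ?_ hM.hasSum).summable
    exact hasSum_unique _
  have h1' : ∀ i, ∀ t ∈ Set.Icc 0 δ, ‖∫ r in (0 : ℝ)..t, b i r‖ ≤ M' i := by
    rintro (_ | l) t ht
    · simp only [hb, hM', Sum.elim_inl]
      refine (hint ht.1 le_rfl ht.2 hpos fun r hr => hlin r ⟨hr.1, hr.2.trans ht.2⟩).trans ?_
      have : 0 ≤ |phase j k| * A * A * δ := by positivity
      linarith
    · simp only [hb, hM', Sum.elim_inr, intervalIntegral.integral_neg, norm_neg]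
      exact h1 l t ht
  have h2' : ∀ i, ∀ α β η : ℝ, α ≤ β → 0 ≤ α → β ≤ δ → 0 ≤ α + η → β + η ≤ δ →
      ‖∫ t in α..β, b i t * starRingEnd ℂ (extend δ u k (t + η))‖ ≤ M' i := by
    rintro (_ | l) α β η hαβ hα hβ hαη hβη
    · simp only [hb, hM', Sum.elim_inl]
      refine (hint (D := |phase j k| * A * A) hαβ hα hβ (by positivity) fun r hr => ?_).trans ?_
      · rw [norm_mul, RCLike.norm_conj]
        exact mul_le_mul (hlin r ⟨hα.trans hr.1, hr.2.trans hβ⟩)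
          (hA _ ⟨by linarith [hr.1], by linarith [hr.2]⟩) (norm_nonneg _) hpos
      · have : 0 ≤ |phase j k| * A * δ := by positivity
        linarith
    · simp only [hb, hM', Sum.elim_inr, neg_mul, intervalIntegral.integral_neg, norm_neg]
      simp_rw [← hu.extend_neg hδ]
      exact h2 l α β η hαβ hα hβ hαη hβη
  have hsum : ∀ t ∈ Set.Icc 0 δ, HasSum (fun i => ∫ r in (0 : ℝ)..t, b i r)
      (extend δ u k t - extend δ u k 0) := by
    intro t ht
    -- The bounds `M` give absolute summability, which turns the limit along truncations into an
    -- unconditional sum.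
    have hS : Summable fun l => ∫ r in (0 : ℝ)..t, b (Sum.inr l) r :=
      Summable.of_norm_bounded hM fun l => h1' (Sum.inr l) t ht
    have e := tendsto_nhds_unique (hS.hasSum.comp (tendsto_freqs k)) (hu.tendsto_sum hδ k ht)
    have := HasSum.sum (f := fun i => ∫ r in (0 : ℝ)..t, b i r) (hasSum_unique _) hS.hasSum
    convert! this using 1
    rw [e]
    simp [hb]
  have hmain := hasSum_energy (hc k) hbc hδ hM's hsum h1' h2'
  -- The linear term pairs to an imaginary multiple of `‖u_k‖ ^ 2`, so it drops out of the energy.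
  have h0 : ∀ i ∉ Set.range (Sum.inr : ℤ → Unit ⊕ ℤ),
      2 * (∫ t in (0 : ℝ)..δ, b i t * starRingEnd ℂ (extend δ u k t)).re = 0 := by
    rintro (_ | l) hi
    · have : ∀ t, b (Sum.inl ()) t * starRingEnd ℂ (extend δ u k t)
          = -(Complex.I * phase j k) * ((‖extend δ u k t‖ ^ 2 : ℝ) : ℂ) := by
        intro t
        rw [← Complex.normSq_eq_norm_sq, ← Complex.mul_conj]
        simp only [hb, Sum.elim_inl]
        ring
      simp_rw [this]
      rw [intervalIntegral.integral_const_mul, intervalIntegral.integral_ofReal]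
      simp
    · exact absurd ⟨l, rfl⟩ hi
  rw [← Function.Injective.hasSum_iff Sum.inr_injective h0] at hmain
  rw [extend_eq ⟨hδ.le, le_rfl⟩, extend_eq ⟨le_rfl, hδ.le⟩] at hmain
  convert! hmain using 2 with l
  simp only [Function.comp, hb, Sum.elim_inr, ← hu.extend_neg hδ]
  have : ∀ t, -(coeff k l * (extend δ u l t * extend δ u (k - l) t)) * extend δ u (-k) t
      = ((-(k / (2 * (1 + (k : ℝ) ^ 2)) * quad (l, k - l)) : ℝ) : ℂ) * (Complex.I *
        (extend δ u l t * extend δ u (k - l) t * extend δ u (-k) t)) := by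
    intro t
    rw [coeff]
    push_cast
    ring
  simp_rw [this]
  rw [intervalIntegral.integral_const_mul, intervalIntegral.integral_const_mul,
    Complex.re_ofReal_mul, Complex.I_mul_re]
  have : (1 + (k : ℝ) ^ 2) ≠ 0 := by positivity
  field_simp

end IsSolution

/-! ### Cut-off functions -/

theorem measurable_timeFourier (v : Lp ℂ 2 (volume : Measure ℝ)) : Measurable (timeFourier v) := by
  unfold timeFourier
  have := (Lp.stronglyMeasurable (𝓕 v : Lp ℂ 2 (volume : Measure ℝ))).measurable
  fun_prop

/-- The Fourier transform of a Schwartz function has finite weighted norm. -/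
theorem lintegral_timeFourier_toLp_ne_top (S : SchwartzMap ℝ ℂ) (P : ℝ) :
    ∫⁻ τ, jb (τ + P) * ‖timeFourier (S.toLp 2) τ‖ₑ ^ 2 ≠ ⊤ := by
  set c : ℝ := (2 * Real.pi)⁻¹ with hc
  set g : SchwartzMap ℝ ℂ := 𝓕 S with hg
  have h0 : 2 * Real.pi ≠ 0 := by positivity
  set F : ℝ → ℝ≥0∞ := fun τ => jb (τ + P) * ‖timeFourier (S.toLp 2) τ‖ₑ ^ 2 with hF
  have h1 := lintegral_div_two_pi F
  have hc0 : ENNReal.ofReal (2 * Real.pi)⁻¹ ≠ 0 := by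
    rw [Ne, ENNReal.ofReal_eq_zero, not_le]; positivity
  suffices h : ∫⁻ ξ, F (2 * Real.pi * ξ) ≠ ⊤ by
    intro htop
    rw [h1, htop, ENNReal.mul_top hc0] at h
    exact h rfl
  obtain ⟨D, hD0, hD⟩ := g.decay 0 0
  simp only [pow_zero, one_mul, norm_iteratedFDeriv_zero] at hD
  have hint : Integrable fun ξ => (1 + 2 * Real.pi + |P|) * (c ^ 2 * (D * ((1 + |ξ|) * ‖g ξ‖))) := by
    have e0 := g.integrable_pow_mul volume 0
    have e1 := g.integrable_pow_mul volume 1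
    have := ((e0.add e1).const_mul D).const_mul (c ^ 2) |>.const_mul (1 + 2 * Real.pi + |P|)
    refine this.congr (ae_of_all _ fun ξ => ?_)
    simp only [Pi.add_apply, pow_zero, pow_one, Real.norm_eq_abs]
    ring
  refine ne_top_of_le_ne_top hint.lintegral_lt_top.ne (lintegral_mono_ae ?_)
  filter_upwards [g.coeFn_toLp 2] with ξ hξ
  have e : ‖timeFourier (S.toLp 2) (2 * Real.pi * ξ)‖ₑ = ENNReal.ofReal (c * ‖g ξ‖) := by
    rw [timeFourier, SchwartzMap.toLp_fourier_eq, ← hg, mul_div_cancel_left₀ _ h0, hξ,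
      ← ofReal_norm, norm_mul, Complex.norm_real, Real.norm_of_nonneg (by positivity)]
  rw [hF]
  simp only
  rw [e, jb, ← ENNReal.ofReal_pow (by positivity), ← ENNReal.ofReal_mul (by unfold bracket; positivity)]
  apply ENNReal.ofReal_le_ofReal
  have hb : bracket (2 * Real.pi * ξ + P) ≤ (1 + 2 * Real.pi + |P|) * (1 + |ξ|) := by
    have h2 : bracket (2 * Real.pi * ξ + P) ≤ 1 + |2 * Real.pi * ξ + P| := by
      refine Real.sqrt_le_iff.2 ⟨by positivity, ?_⟩
      nlinarith [abs_nonneg (2 * Real.pi * ξ + P), sq_abs (2 * Real.pi * ξ + P)]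
    have h3 := abs_add_le (2 * Real.pi * ξ) P
    rw [abs_mul, abs_of_pos (by positivity : 0 < 2 * Real.pi)] at h3
    nlinarith [abs_nonneg ξ, mul_nonneg (abs_nonneg P) (abs_nonneg ξ), Real.pi_pos]
  calc bracket (2 * Real.pi * ξ + P) * (c * ‖g ξ‖) ^ 2
      = bracket (2 * Real.pi * ξ + P) * (c ^ 2 * (‖g ξ‖ * ‖g ξ‖)) := by ring
    _ ≤ ((1 + 2 * Real.pi + |P|) * (1 + |ξ|)) * (c ^ 2 * (D * ‖g ξ‖)) := by
        gcongr
        exact hD ξ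
    _ = _ := by ring

theorem exists_schwartz_eq_one {δ : ℝ} (hδ : 0 < δ) :
    ∃ S : SchwartzMap ℝ ℂ, ∀ t ∈ Set.Icc 0 δ, S t = 1 := by
  obtain ⟨χ, hχ⟩ : ∃ χ : ContDiffBump (0 : ℝ), χ.rIn = δ := ⟨⟨δ, 2 * δ, hδ, by linarith⟩, rfl⟩
  have h1 : HasCompactSupport (Complex.ofRealCLM ∘ χ) := χ.hasCompactSupport.comp_left (by simp)
  have h2 : ContDiff ℝ ∞ (Complex.ofRealCLM ∘ χ) := Complex.ofRealCLM.contDiff.comp χ.contDiff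
  refine ⟨h1.toSchwartzMap h2, fun t ht => ?_⟩
  have : χ t = 1 := χ.one_of_mem_closedBall (by
      rw [mem_closedBall_zero_iff, Real.norm_eq_abs, abs_of_nonneg ht.1, hχ]; exact ht.2)
  simp [this]

/-- There is a square integrable function which is `1` on `[0, δ]` and whose Fourier transform has
finite weighted norm. -/
theorem exists_cutoff {δ : ℝ} (hδ : 0 < δ) (P : ℝ) : ∃ B : Lp ℂ 2 (volume : Measure ℝ),
    (∀ᵐ t ∂(volume.restrict (Set.Icc 0 δ)), B t = 1) ∧
      ∫⁻ τ, jb (τ + P) * ‖timeFourier B τ‖ₑ ^ 2 ≠ ⊤ := by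
  obtain ⟨S, hS⟩ := exists_schwartz_eq_one hδ
  have h : ∀ᵐ t ∂(volume.restrict (Set.Icc 0 δ)), (S.toLp 2 : Lp ℂ 2 (volume : Measure ℝ)) t = 1 := by
    rw [ae_restrict_iff' measurableSet_Icc]
    filter_upwards [S.coeFn_toLp 2] with t ht htm
    rw [ht, hS t htm]
  have h' := lintegral_timeFourier_toLp_ne_top S P
  generalize (S.toLp 2 : Lp ℂ 2 (volume : Measure ℝ)) = B at h h'
  exact ⟨B, h, h'⟩

/-! ### Dominated trilinear sums -/

theorem trilin_const_mul {F f₁ f₂ f₃ : ℝ → ℝ≥0∞} (hF : Measurable F) (h₂ : Measurable f₂)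
    (h₃ : Measurable f₃) {c₁ c₂ c₃ : ℝ≥0∞} (hc₁ : c₁ ≠ ⊤) (hc₂ : c₂ ≠ ⊤) (hc₃ : c₃ ≠ ⊤) (Ω : ℝ) :
    trilin F (fun x => c₁ * f₁ x) (fun x => c₂ * f₂ x) (fun x => c₃ * f₃ x) Ω
      = c₁ * c₂ * c₃ * trilin F f₁ f₂ f₃ Ω := by
  have hc : c₁ * c₂ * c₃ ≠ ⊤ := ENNReal.mul_ne_top (ENNReal.mul_ne_top hc₁ hc₂) hc₃
  rw [trilin_eq hF (by fun_prop) (by fun_prop), trilin_eq hF h₂ h₃, ← lintegral_const_mul' _ _ hc]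
  refine lintegral_congr fun x => ?_
  rw [← lintegral_const_mul' _ _ hc]
  refine lintegral_congr fun y => ?_
  rw [← lintegral_const_mul' _ _ hc]
  refine lintegral_congr fun z => ?_
  ring

/-- The trilinear form dominating `∫ u_{p₁} u_{p₂} u_{p₃}` over an interval of length `1`, when
`u_k` is dominated by `G k`. -/
noncomputable def tri (j : ℕ) (θ : ℝ) (G : ℤ → ℝ → ℝ≥0∞) (p : ℤ × ℤ) : ℝ≥0∞ :=
  trilin (fun y => ab y ^ (-(1 - θ))) (fun x => G p.1 (x - phase j p.1))
    (fun x => G p.2 (x - phase j p.2)) (fun x => G (thd p) (x - phase j (thd p))) (res j p)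

/-- The form `tri` with the weight `kmax^j ⟨p₁⟩⟨p₂⟩⟨p₃⟩`. -/
noncomputable def wtri (j : ℕ) (θ : ℝ) (G : ℤ → ℝ → ℝ≥0∞) (p : ℤ × ℤ) : ℝ≥0∞ :=
  (kmax p : ℝ≥0∞) ^ j * (jb p.1 * jb p.2 * jb (thd p)) * tri j θ G p

/-- The square of the norm of `X_{1,1/2}` in terms of the moduli of the Fourier transforms. -/
noncomputable def energy (j : ℕ) (G : ℤ → ℝ → ℝ≥0∞) : ℝ≥0∞ :=
  ∑' k : ℤ, jb k ^ 2 * ∫⁻ τ, jb (τ + phase j k) * G k τ ^ 2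

/-- The trilinear estimate for `⟨k⟩ G_k` expressed in the modulation variable, with `γ = 1 / 2 - θ`.
-/
theorem exists_tsum_wtri_le {j : ℕ} (hj : 1 ≤ j) {θ : ℝ} (hθ : 0 < θ) (hθ1 : θ < 1 / 2) :
    ∃ C : ℝ≥0∞, C ≠ ⊤ ∧ ∀ G : ℤ → ℝ → ℝ≥0∞, (∀ k, Measurable (G k)) → (∀ x, G 0 x = 0) →
      ∑' p : ℤ × ℤ, wtri j θ G p ≤ C * energy j G ^ (3 / 2 : ℝ) := by
  obtain ⟨C, hC, h⟩ := exists_tsum_trilin_le hj (γ := 1 / 2 - θ) (by linarith) (by linarith)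
  refine ⟨C, hC, fun G hG hG0 => ?_⟩
  convert! h (fun k x => jb k * G k (x - phase j k)) (fun k => by have := hG k; fun_prop)
    (fun x => by rw [hG0, mul_zero]) using 1
  · refine tsum_congr fun p => ?_
    have h1 := hG p.2
    have h2 := hG (thd p)
    rw [trilin_const_mul (by fun_prop) (by fun_prop) (by fun_prop) (jb_ne_top _) (jb_ne_top _)
      (jb_ne_top _), wtri, tri, mul_assoc, show 1 / 2 + (1 / 2 - θ) = 1 - θ by ring]
  · congr 2
    refine tsum_congr fun k => ?_
    rw [wsq, ← lintegral_const_mul' _ _ (ENNReal.pow_ne_top (jb_ne_top _)),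
      ← lintegral_sub_right_eq_self _ (phase j k)]
    refine lintegral_congr fun τ => ?_
    rw [sub_add_cancel]
    ring

theorem norm_integral_le_of_fourierDom {a₁ a₂ a₃ : ℝ → ℂ} {G : ℤ → ℝ → ℝ≥0∞} {j : ℕ} {p : ℤ × ℤ}
    {α β δ : ℝ} (hG : ∀ k, Measurable (G k)) (h₁ : FourierDom a₁ (G p.1) α β)
    (h₂ : FourierDom a₂ (G p.2) α β) (h₃ : FourierDom a₃ (G (thd p)) α β)
    (ha₂ : Continuous a₂) (ha₃ : Continuous a₃) (hαβ : α ≤ β) (hδ : β - α ≤ δ) {θ : ℝ}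
    (hθ : 0 ≤ θ) (hθ1 : θ ≤ 1) (hfin : wtri j θ G p ≠ ⊤) :
    (kmax p : ℝ) ^ j * (bracket p.1 * bracket p.2 * bracket (thd p))
      * ‖∫ t in α..β, a₁ t * a₂ t * a₃ t‖ ≤ 2 * δ ^ θ * (wtri j θ G p).toReal := by
  have h := FourierDom.enorm_integral_le h₁ h₂ h₃ ha₂ ha₃ (hG _) (hG _) hαβ hδ hθ hθ1
  rw [lintegral_shift_eq_trilin (F := fun y => ab y ^ (-(1 - θ))) (by fun_prop) (hG _) (hG _)
    (phase j p.1) (phase j p.2) (phase j (thd p))] at h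
  have h' : (kmax p : ℝ≥0∞) ^ j * (jb p.1 * jb p.2 * jb (thd p))
      * ‖∫ t in α..β, a₁ t * a₂ t * a₃ t‖ₑ ≤ 2 * ENNReal.ofReal δ ^ θ * wtri j θ G p := by
    refine (mul_le_mul_right h _).trans (le_of_eq ?_)
    rw [wtri, tri, res]
    ring
  have hr : 2 * ENNReal.ofReal δ ^ θ * wtri j θ G p ≠ ⊤ := ENNReal.mul_ne_top
    (ENNReal.mul_ne_top (by simp) (ENNReal.rpow_ne_top_of_nonneg hθ ENNReal.ofReal_ne_top)) hfin
  have := ENNReal.toReal_mono hr h'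
  have hb : ∀ x : ℝ, (jb x).toReal = bracket x := fun x => ENNReal.toReal_ofReal (bracket_pos x).le
  simpa [ENNReal.toReal_mul, ENNReal.toReal_pow, hb, ← ENNReal.toReal_rpow,
    ENNReal.toReal_ofReal ((sub_nonneg.2 hαβ).trans hδ)] using this

/-! ### The multiplier on frequency triples, and domination of `Iu` -/

/-- The multiplier of the operator `I`. -/
noncomputable def mult (φ : ℝ → ℝ) (N : ℝ) (k : ℤ) : ℝ := φ (|(k : ℝ)| / N)

theorem mult_neg (φ : ℝ → ℝ) (N : ℝ) (k : ℤ) : mult φ N (-k) = mult φ N k := by simp [mult]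

theorem one_le_abs_cast {k : ℤ} (hk : k ≠ 0) : 1 ≤ |(k : ℝ)| := by
  exact_mod_cast Int.one_le_abs hk

theorem abs_cast_le_kmax (p : ℤ × ℤ) :
    |(p.1 : ℝ)| ≤ kmax p ∧ |(p.2 : ℝ)| ≤ kmax p ∧ |(thd p : ℝ)| ≤ kmax p := by
  have h : ∀ k : ℤ, |(k : ℝ)| = (k.natAbs : ℝ) := fun k => by
    rw [Nat.cast_natAbs, Int.cast_abs]
  simp only [h, Nat.cast_le, kmax]
  omega

theorem IsProfile.exists_mult_le {s : ℝ} {φ : ℝ → ℝ} (h : IsProfile s φ) {j : ℕ} (hj : 1 ≤ j)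
    (hs : (2 - (j : ℝ)) / 2 ≤ s) (hs1 : s < 1) :
    ∃ C : ℝ, 0 < C ∧ ∀ N : ℝ, 1 ≤ N → ∀ p : ℤ × ℤ, p.1 ≠ 0 → p.2 ≠ 0 → thd p ≠ 0 →
      |mult φ N p.1 ^ 2 * p.1 + mult φ N p.2 ^ 2 * p.2 + mult φ N (thd p) ^ 2 * thd p| * quad p
        ≤ C * (kmax p / N) ^ j * (mult φ N p.1 * mult φ N p.2 * mult φ N (thd p)
          * (bracket p.1 * bracket p.2 * bracket (thd p))) ∧
      mult φ N (thd p) ^ 2 * |(thd p : ℝ)| * quad p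
        ≤ C * kmax p ^ j * (mult φ N p.1 * mult φ N p.2 * mult φ N (thd p)
          * (bracket p.1 * bracket p.2 * bracket (thd p))) := by
  obtain ⟨C, hC, H⟩ := h.exists_symbol_le hj hs hs1
  refine ⟨C, hC, fun N hN p h1 h2 h3 => ?_⟩
  obtain ⟨e1, e2, e3⟩ := abs_cast_le_kmax p
  have := H N hN p.1 p.2 (thd p) (kmax p) (by simp [thd]) (one_le_abs_cast h1)
    (one_le_abs_cast h2) (one_le_abs_cast h3) e1 e2 e3
  exact ⟨this.1, this.2 _ (by simp)⟩

theorem FourierDom.mono {a : ℝ → ℂ} {G G' : ℝ → ℝ≥0∞} {α β : ℝ} (h : FourierDom a G α β)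
    (hG : ∀ τ, G τ ≤ G' τ) : FourierDom a G' α β := fun w hw =>
  (h w hw).trans (lintegral_mono fun τ => mul_le_mul_left (hG τ) _)

/-- `G` dominates the coefficients of `I u` on `[0, δ]`. -/
def Dominates (φ : ℝ → ℝ) (N δ : ℝ) (u : ℝ → ℤ → ℂ) (G : ℤ → ℝ → ℝ≥0∞) : Prop :=
  ∀ (k : ℤ) (α β h : ℝ), α ≤ β → 0 ≤ α + h → β + h ≤ δ →
    FourierDom (fun t => (mult φ N k : ℂ) * extend δ u k (t + h)) (G k) α β

theorem Dominates.mono {φ : ℝ → ℝ} {N δ : ℝ} {u : ℝ → ℤ → ℂ} {G G' : ℤ → ℝ → ℝ≥0∞}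
    (h : Dominates φ N δ u G) (hG : ∀ k τ, G k τ ≤ G' k τ) : Dominates φ N δ u G' :=
  fun k α β η h1 h2 h3 => (h k α β η h1 h2 h3).mono (hG k)

namespace IsSolution

variable {j : ℕ} {s δ : ℝ} {u : ℝ → ℤ → ℂ} {φ : ℝ → ℝ} {N : ℝ} {G : ℤ → ℝ → ℝ≥0∞} {θ : ℝ}

theorem norm_coeff_le (k l : ℤ) : ‖coeff k l‖ ≤ |(k : ℝ)| * quad (l, k - l) := by
  have hq := quad_pos (l, k - l)
  have h1 : (1 + (k : ℂ) ^ 2) = ((1 + (k : ℝ) ^ 2 : ℝ) : ℂ) := by push_cast; ring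
  rw [coeff, h1, norm_mul, norm_div, norm_mul, norm_mul, Complex.norm_I, one_mul, Complex.norm_real,
    Complex.norm_real, Complex.norm_intCast, Real.norm_of_nonneg hq.le,
    Real.norm_of_nonneg (by positivity), Complex.norm_ofNat]
  refine mul_le_mul_of_nonneg_right (div_le_self (abs_nonneg _) ?_) hq.le
  nlinarith [sq_nonneg (k : ℝ)]

/-- The third factor `a` is left general because two choices are needed: a translate of `m_k u_{-k}`
for the energy pairing, and the constant `1` for the convergence of the equation itself. Of the
multipliers in the symbol bound, those of `l` and `k - l` go into `Iu`, and division by `m_k ^ 2`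
leaves `m_k⁻¹`. -/
theorem norm_integral_coeff_le (hu : IsSolution j s δ u) (hδ : 0 < δ) (hφ : IsProfile s φ)
    {C : ℝ} (hC : 0 < C)
    (hm : ∀ p : ℤ × ℤ, p.1 ≠ 0 → p.2 ≠ 0 → thd p ≠ 0 →
      mult φ N (thd p) ^ 2 * |(thd p : ℝ)| * quad p
        ≤ C * kmax p ^ j * (mult φ N p.1 * mult φ N p.2 * mult φ N (thd p)
          * (bracket p.1 * bracket p.2 * bracket (thd p))))
    (hG : ∀ k, Measurable (G k)) (hdom : Dominates φ N δ u G) (hθ : 0 ≤ θ) (hθ1 : θ ≤ 1)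
    {k : ℤ} (hk : k ≠ 0) (l : ℤ) (hfin : wtri j θ G (l, k - l) ≠ ⊤) {α β : ℝ} (hαβ : α ≤ β)
    (hα : 0 ≤ α) (hβ : β ≤ δ) {a : ℝ → ℂ} (ha : Continuous a) (had : FourierDom a (G (-k)) α β) :
    ‖∫ t in α..β, coeff k l * (extend δ u l t * extend δ u (k - l) t) * a t‖
      ≤ C * (mult φ N k)⁻¹ * (2 * δ ^ θ * (wtri j θ G (l, k - l)).toReal) := by
  have hmk : ∀ k, 0 < mult φ N k := fun k => hφ.pos _
  have hc := fun k => hu.continuous_extend hδ k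
  have hrhs : 0 ≤ C * (mult φ N k)⁻¹ * (2 * δ ^ θ * (wtri j θ G (l, k - l)).toReal) := by
    have := hmk k; positivity
  rcases eq_or_ne l 0 with hl | hl
  · simpa [hl, hu.extend_zero hδ] using hrhs
  rcases eq_or_ne (k - l) 0 with hkl | hkl
  · simpa [hkl, hu.extend_zero hδ] using hrhs
  have hthd : thd (l, k - l) = -k := by simp only [thd]; ring
  have key := norm_integral_le_of_fourierDom (a₃ := a) (p := (l, k - l)) (j := j) hG
    (by simpa using hdom l α β 0 hαβ (by linarith) (by linarith))
    (by simpa using hdom (k - l) α β 0 hαβ (by linarith) (by linarith)) (by rwa [hthd])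
    (by have := hc (k - l); fun_prop) ha hαβ (by linarith : β - α ≤ δ) hθ hθ1 hfin
  have hs := hm (l, k - l) hl hkl (by rw [hthd]; exact neg_ne_zero.2 hk)
  rw [hthd] at hs key
  simp only [mult_neg, Int.cast_neg, abs_neg] at hs
  set J := ‖∫ t in α..β, (mult φ N l : ℂ) * extend δ u l t
    * ((mult φ N (k - l) : ℂ) * extend δ u (k - l) t) * a t‖ with hJ
  set X := ‖∫ t in α..β, extend δ u l t * extend δ u (k - l) t * a t‖ with hX
  set B := bracket l * bracket ((k - l : ℤ) : ℝ) * bracket ((-k : ℤ) : ℝ) with hB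
  have hJX : J = mult φ N l * mult φ N (k - l) * X := by
    have : ∀ t, (mult φ N l : ℂ) * extend δ u l t
        * ((mult φ N (k - l) : ℂ) * extend δ u (k - l) t) * a t
        = ((mult φ N l * mult φ N (k - l) : ℝ) : ℂ)
          * (extend δ u l t * extend δ u (k - l) t * a t) := fun t => by push_cast; ring
    rw [hJ, hX]
    simp_rw [this]
    rw [intervalIntegral.integral_const_mul, norm_mul, Complex.norm_real,
      Real.norm_of_nonneg (mul_pos (hmk _) (hmk _)).le]
  have hlhs : ‖∫ t in α..β, coeff k l * (extend δ u l t * extend δ u (k - l) t) * a t‖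
      = ‖coeff k l‖ * X := by
    rw [hX, ← norm_mul, ← intervalIntegral.integral_const_mul]
    simp_rw [mul_assoc]
  rw [hlhs]
  have h1 := hmk k
  have h2 := hmk l
  have h3 := hmk (k - l)
  have hX0 : 0 ≤ X := norm_nonneg _
  have h4 : |(k : ℝ)| * quad (l, k - l) ≤ C * (mult φ N k)⁻¹
      * (kmax (l, k - l) ^ j * (mult φ N l * mult φ N (k - l) * B)) := by
    have : |(k : ℝ)| * quad (l, k - l)
        = (mult φ N k ^ 2)⁻¹ * (mult φ N k ^ 2 * |(k : ℝ)| * quad (l, k - l)) := by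
      field_simp
    rw [this]
    refine (mul_le_mul_of_nonneg_left hs (by positivity)).trans (le_of_eq ?_)
    rw [hB]
    simp only [Int.cast_neg]
    field_simp
  calc ‖coeff k l‖ * X ≤ (C * (mult φ N k)⁻¹
        * (kmax (l, k - l) ^ j * (mult φ N l * mult φ N (k - l) * B))) * X :=
        mul_le_mul_of_nonneg_right ((norm_coeff_le k l).trans h4) hX0
    _ = C * (mult φ N k)⁻¹ * (kmax (l, k - l) ^ j * B * J) := by rw [hJX]; ring
    _ ≤ _ := by gcongr

end IsSolution

/-- Only one mode is changed, by a function of finite weighted norm. -/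
theorem energy_add_cutoff_ne_top {j : ℕ} {G : ℤ → ℝ → ℝ≥0∞} (hE : energy j G ≠ ⊤) {n : ℤ}
    {B : ℝ → ℝ≥0∞} (hG : ∀ k, Measurable (G k))
    (hB : ∫⁻ τ, jb (τ + phase j n) * B τ ^ 2 ≠ ⊤) :
    energy j (fun k τ => G k τ + if k = n then B τ else 0) ≠ ⊤ := by
  set D := jb n ^ 2 * ∫⁻ τ, jb (τ + phase j n) * B τ ^ 2 with hD
  have hDt : D ≠ ⊤ := ENNReal.mul_ne_top (ENNReal.pow_ne_top (jb_ne_top _)) hB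
  refine ne_top_of_le_ne_top (b := 4 * (energy j G + ∑' k : ℤ, if k = n then D else 0)) ?_ ?_
  · rw [tsum_ite_eq]
    exact ENNReal.mul_ne_top (by simp) (ENNReal.add_ne_top.2 ⟨hE, hDt⟩)
  · rw [energy, energy, ← ENNReal.tsum_add, ← ENNReal.tsum_mul_left]
    refine ENNReal.tsum_le_tsum fun k => ?_
    have hm := hG k
    calc jb k ^ 2 * ∫⁻ τ, jb (τ + phase j k) * (G k τ + if k = n then B τ else 0) ^ 2
        ≤ jb k ^ 2 * ∫⁻ τ, 4 * (jb (τ + phase j k) * G k τ ^ 2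
            + jb (τ + phase j k) * (if k = n then B τ else 0) ^ 2) := by
          refine mul_le_mul_right (lintegral_mono fun τ => ?_) _
          refine (mul_le_mul_right (sq_add_le _ _) _).trans (le_of_eq ?_)
          ring
      _ = 4 * (jb k ^ 2 * (∫⁻ τ, jb (τ + phase j k) * G k τ ^ 2)
            + jb k ^ 2 * ∫⁻ τ, jb (τ + phase j k) * (if k = n then B τ else 0) ^ 2) := by
          rw [lintegral_const_mul' _ _ (by simp), lintegral_add_left (by fun_prop)]
          ring
      _ ≤ _ := by
          gcongr
          split_ifs with h
          · rw [h]
          · simp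

namespace IsSolution

variable {j : ℕ} {s δ : ℝ} {u : ℝ → ℤ → ℂ} {φ : ℝ → ℝ} {N : ℝ} {G : ℤ → ℝ → ℝ≥0∞} {θ : ℝ}

/-- The integral of `u_{p₁} u_{p₂} u_{p₃}` over `[0, δ]`. -/
noncomputable def cubic (δ : ℝ) (u : ℝ → ℤ → ℂ) (p : ℤ × ℤ) : ℂ :=
  ∫ t in (0 : ℝ)..δ, extend δ u p.1 t * extend δ u p.2 t * extend δ u (thd p) t

/-- The energy identity in one Fourier mode, for a solution dominated in `X_{1,1/2}`. -/
theorem hasSum_mode_of_dominates (hu : IsSolution j s δ u) (hj : 1 ≤ j) (hδ : 0 < δ)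
    (hφ : IsProfile s φ) (hs : (2 - (j : ℝ)) / 2 ≤ s) (hs1 : s < 1) (hN : 1 ≤ N)
    (hG : ∀ k, Measurable (G k)) (hG0 : ∀ τ, G 0 τ = 0) (hdom : Dominates φ N δ u G)
    (hE : energy j G ≠ ⊤) (k : ℤ) :
    HasSum (fun l => k / (1 + (k : ℝ) ^ 2) * quad (l, k - l) * (cubic δ u (l, k - l)).im)
      (‖u δ k‖ ^ 2 - ‖u 0 k‖ ^ 2) := by
  rcases eq_or_ne k 0 with rfl | hk
  · have e1 := hu.extend_zero hδ δ
    have e2 := hu.extend_zero hδ 0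
    rw [extend_eq ⟨hδ.le, le_rfl⟩] at e1
    rw [extend_eq ⟨le_rfl, hδ.le⟩] at e2
    simp [e1, e2]
  obtain ⟨C, hC, hm⟩ := hφ.exists_mult_le hj hs hs1
  -- The integrals of the nonlinear terms alone have no third factor. The constant `1` is used in
  -- its place in mode `-k`, dominated by the transform of a cut-off function.
  obtain ⟨B, hB1, hB2⟩ := exists_cutoff hδ (phase j (-k))
  -- Only finiteness matters here, so any exponent strictly between `0` and `1 / 2` serves.
  obtain ⟨D, hD, hwtri⟩ := exists_tsum_wtri_le hj (θ := 1 / 4) (by norm_num) (by norm_num)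
  set G' : ℤ → ℝ → ℝ≥0∞ := fun n τ => G n τ + if n = -k then ‖timeFourier B τ‖ₑ else 0 with hG'
  have hBm := measurable_timeFourier B
  have hG'm : ∀ n, Measurable (G' n) := fun n => by
    have := hG n
    by_cases h : n = -k <;> simp only [hG', h, if_true, if_false] <;> fun_prop
  have hG'0 : ∀ τ, G' 0 τ = 0 := fun τ => by
    have : (0 : ℤ) ≠ -k := fun h => hk (by omega)
    simp [hG', hG0, this]
  have hE' : energy j G' ≠ ⊤ := energy_add_cutoff_ne_top hE hG hB2
  have hdom' : Dominates φ N δ u G' := hdom.mono fun n τ => le_self_add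
  have hsum : ∑' p, wtri j (1 / 4) G' p ≠ ⊤ := ne_top_of_le_ne_top
    (ENNReal.mul_ne_top hD (ENNReal.rpow_ne_top_of_nonneg (by norm_num) hE')) (hwtri G' hG'm hG'0)
  have hfin : ∀ p, wtri j (1 / 4) G' p ≠ ⊤ := fun p => ENNReal.ne_top_of_tsum_ne_top hsum p
  have hmk : 0 < mult φ N k := hφ.pos _
  have hmk1 : mult φ N k ≤ 1 := hφ.le_one _
  have hi1 : 1 ≤ (mult φ N k)⁻¹ := (one_le_inv₀ hmk).2 hmk1
  set X : ℤ → ℝ := fun l =>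
    C * (mult φ N k)⁻¹ * (2 * δ ^ (1 / 4 : ℝ) * (wtri j (1 / 4) G' (l, k - l)).toReal) with hX
  have hX0 : ∀ l, 0 ≤ X l := fun l => by positivity
  have hXs : Summable fun l => (mult φ N k)⁻¹ * X l := by
    have h1 : Summable fun l : ℤ => (wtri j (1 / 4) G' (l, k - l)).toReal :=
      (ENNReal.summable_toReal hsum).comp_injective
        (i := fun l : ℤ => (l, k - l)) fun a b h => (Prod.ext_iff.1 h).1
    exact ((h1.mul_left _).mul_left _).mul_left _
  have key := fun (l : ℤ) (α β : ℝ) (hαβ : α ≤ β) (hα : 0 ≤ α) (hβ : β ≤ δ) (a : ℝ → ℂ)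
      (ha : Continuous a) (had : FourierDom a (G' (-k)) α β) =>
    hu.norm_integral_coeff_le hδ hφ hC (fun p h1 h2 h3 => (hm N hN p h1 h2 h3).2) hG'm hdom'
      (θ := 1 / 4) (by norm_num) (by norm_num) hk l (hfin _) hαβ hα hβ ha had
  have main := hu.hasSum_mode hδ k hXs (fun l t ht => ?_) (fun l α β η hαβ hα hβ hαη hβη => ?_)
  · have hthd : ∀ l, thd (l, k - l) = -k := fun l => by simp only [thd]; ring
    simpa only [cubic, hthd] using main
  · have had : FourierDom (fun _ => (1 : ℂ)) (G' (-k)) 0 t :=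
      (fourierDom_of_ae_eq (v := B) (a := fun _ => 1) (h := 0) hB1 ht.1 (by simp)
        (by simpa using ht.2)).mono fun τ => by simp [hG']
    have := key l 0 t ht.1 le_rfl ht.2 _ continuous_const had
    simp only [mul_one] at this
    exact this.trans (le_mul_of_one_le_left (hX0 l) hi1)
  · have hc := hu.continuous_extend hδ (-k)
    have := key l α β hαβ hα hβ _ (by fun_prop) (hdom' (-k) α β η hαβ hαη hβη)
    rw [mult_neg] at this
    have e : ∀ t, coeff k l * (extend δ u l t * extend δ u (k - l) t)
        * ((mult φ N k : ℂ) * extend δ u (-k) (t + η)) = (mult φ N k : ℂ) *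
          (coeff k l * (extend δ u l t * extend δ u (k - l) t) * extend δ u (-k) (t + η)) :=
      fun t => by ring
    simp_rw [e] at this
    rw [intervalIntegral.integral_const_mul, norm_mul, Complex.norm_real,
      Real.norm_of_nonneg hmk.le] at this
    rw [inv_mul_eq_div, le_div_iff₀ hmk, mul_comm]
    exact this

end IsSolution

/-! ### The almost conserved energy -/

theorem quad_swap (p : ℤ × ℤ) : quad p.swap = quad p := by
  simp only [quad, thd_swap, Prod.fst_swap, Prod.snd_swap]; ring

theorem quad_swapThd (p : ℤ × ℤ) : quad (swapThd p) = quad p := by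
  simp only [quad, thd_swapThd]; simp only [swapThd, Equiv.coe_fn_mk]; ring

/-- The multiplier gains `1 - s` derivatives at frequencies beyond `2N`, and below them `⟨k⟩ ≤ 1 +
2N`. The constant depends on `N`, but it is used only for summability. -/
theorem IsProfile.memSobolev_opI {s : ℝ} {φ : ℝ → ℝ} (h : IsProfile s φ) (hs1 : s < 1) {N : ℝ}
    (hN : 1 ≤ N) {a : ℤ → ℂ} (ha : MemSobolev s a) : MemSobolev 1 (opI φ N a) := by
  refine Summable.of_nonneg_of_le (fun k => ?_) (fun k => ?_) (ha.mul_left ((1 + 2 * N) ^ (2 * (1 - s))))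
  · have := bracket_pos k; positivity
  have hb := bracket_pos (k : ℝ)
  have hm := h.pos (|(k : ℝ)| / N)
  have key : bracket k ^ (1 - s) * φ (|(k : ℝ)| / N) ≤ (1 + 2 * N) ^ (1 - s) := by
    rcases le_or_gt (2 * N) |(k : ℝ)| with hk | hk
    · have h0 : 0 < |(k : ℝ)| := by linarith
      rw [h.eq_rpow _ ((le_div_iff₀ (by linarith)).2 hk), show s - 1 = -(1 - s) by ring,
        Real.rpow_neg (by positivity), ← div_eq_mul_inv, ← Real.div_rpow hb.le (by positivity)]
      refine Real.rpow_le_rpow (by positivity) ?_ (by linarith)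
      rw [div_div_eq_mul_div, div_le_iff₀ h0]
      nlinarith [bracket_le_two_mul_abs (by linarith : 1 ≤ |(k : ℝ)|)]
    · refine (mul_le_of_le_one_right (by positivity) (h.le_one _)).trans ?_
      refine Real.rpow_le_rpow hb.le ?_ (by linarith)
      refine Real.sqrt_le_iff.2 ⟨by linarith, ?_⟩
      nlinarith [abs_nonneg (k : ℝ), sq_abs (k : ℝ)]
  have e1 : bracket k ^ (2 * (1 : ℝ)) = bracket k ^ (2 * s) * (bracket k ^ (1 - s)) ^ 2 := by
    rw [← Real.rpow_natCast, ← Real.rpow_mul hb.le, ← Real.rpow_add hb]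
    congr 1; push_cast; ring
  have e2 : (1 + 2 * N) ^ (2 * (1 - s)) = ((1 + 2 * N) ^ (1 - s)) ^ 2 := by
    rw [← Real.rpow_natCast, ← Real.rpow_mul (by linarith)]
    congr 1; push_cast; ring
  rw [opI, norm_mul, Complex.norm_real, Real.norm_of_nonneg hm.le, e1, e2]
  calc _ = (bracket k ^ (1 - s) * φ (|(k : ℝ)| / N)) ^ 2 * (bracket k ^ (2 * s) * ‖a k‖ ^ 2) := by
        ring
    _ ≤ _ := by
        gcongr

theorem sq_sobolevNorm (s : ℝ) (a : ℤ → ℂ) :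
    sobolevNorm s a ^ 2 = ∑' k : ℤ, bracket k ^ (2 * s) * ‖a k‖ ^ 2 :=
  Real.sq_sqrt (tsum_nonneg fun k => by have := bracket_pos (k : ℝ); positivity)

namespace IsSolution

variable {j : ℕ} {s δ : ℝ} {u : ℝ → ℤ → ℂ} {φ : ℝ → ℝ} {N : ℝ} {G : ℤ → ℝ → ℝ≥0∞} {θ : ℝ}

theorem cubic_swap (p : ℤ × ℤ) : cubic δ u p.swap = cubic δ u p := by
  simp only [cubic, thd_swap, Prod.fst_swap, Prod.snd_swap, mul_comm (extend δ u p.2 _)]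

theorem cubic_swapThd (p : ℤ × ℤ) : cubic δ u (swapThd p) = cubic δ u p := by
  simp only [cubic, thd_swapThd]
  simp only [swapThd, Equiv.coe_fn_mk]
  refine intervalIntegral.integral_congr fun t _ => ?_
  ring

theorem cubic_eq_zero (hu : IsSolution j s δ u) (hδ : 0 < δ) {p : ℤ × ℤ}
    (hp : p.1 = 0 ∨ p.2 = 0 ∨ thd p = 0) : cubic δ u p = 0 := by
  rcases hp with h | h | h <;> simp [cubic, h, hu.extend_zero hδ]

theorem norm_cubic_le (hu : IsSolution j s δ u) (hδ : 0 < δ) (hφ : IsProfile s φ)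
    (hG : ∀ k, Measurable (G k)) (hdom : Dominates φ N δ u G) (hθ : 0 ≤ θ) (hθ1 : θ ≤ 1)
    {p : ℤ × ℤ} (hfin : wtri j θ G p ≠ ⊤) :
    (kmax p : ℝ) ^ j * (mult φ N p.1 * mult φ N p.2 * mult φ N (thd p)
      * (bracket p.1 * bracket p.2 * bracket (thd p))) * ‖cubic δ u p‖
      ≤ 2 * δ ^ θ * (wtri j θ G p).toReal := by
  have hc := fun k => hu.continuous_extend hδ k
  have hd : ∀ k, FourierDom (fun t => (mult φ N k : ℂ) * extend δ u k t) (G k) 0 δ := fun k => by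
    simpa using hdom k 0 δ 0 hδ.le (by simp) (by simp)
  have key := norm_integral_le_of_fourierDom (p := p) (j := j) hG (hd _) (hd _) (hd _)
    (by have := hc p.2; fun_prop) (by have := hc (thd p); fun_prop) hδ.le (sub_zero δ).le hθ hθ1 hfin
  have e : ∀ t, (mult φ N p.1 : ℂ) * extend δ u p.1 t * ((mult φ N p.2 : ℂ) * extend δ u p.2 t)
      * ((mult φ N (thd p) : ℂ) * extend δ u (thd p) t)
      = ((mult φ N p.1 * mult φ N p.2 * mult φ N (thd p) : ℝ) : ℂ)
        * (extend δ u p.1 t * extend δ u p.2 t * extend δ u (thd p) t) := fun t => by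
    push_cast; ring
  simp_rw [e] at key
  have hmk : ∀ k, 0 < mult φ N k := fun k => hφ.pos _
  rw [intervalIntegral.integral_const_mul, norm_mul, Complex.norm_real, Real.norm_of_nonneg
    (mul_pos (mul_pos (hmk _) (hmk _)) (hmk _)).le] at key
  refine le_trans (le_of_eq ?_) key
  rw [cubic]
  ring

/-- The contribution of the interaction of `p.1` and `p.2` to the energy of the mode `-thd p`. -/
noncomputable def flux (φ : ℝ → ℝ) (N δ : ℝ) (u : ℝ → ℤ → ℂ) (p : ℤ × ℤ) : ℝ :=
  -(mult φ N (thd p) ^ 2 * thd p * quad p * (cubic δ u p).im)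

/-- There is no decay in `N` here: the bound serves to make the flux absolutely summable, so that
the sum may be symmetrised. -/
theorem abs_flux_le (hu : IsSolution j s δ u) (hδ : 0 < δ) (hφ : IsProfile s φ) {C : ℝ} (hC : 0 < C)
    (hm : ∀ p : ℤ × ℤ, p.1 ≠ 0 → p.2 ≠ 0 → thd p ≠ 0 →
      mult φ N (thd p) ^ 2 * |(thd p : ℝ)| * quad p
        ≤ C * kmax p ^ j * (mult φ N p.1 * mult φ N p.2 * mult φ N (thd p)
          * (bracket p.1 * bracket p.2 * bracket (thd p))))
    (hG : ∀ k, Measurable (G k)) (hdom : Dominates φ N δ u G) (hθ : 0 ≤ θ) (hθ1 : θ ≤ 1)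
    {p : ℤ × ℤ} (hfin : wtri j θ G p ≠ ⊤) :
    |flux φ N δ u p| ≤ C * (2 * δ ^ θ * (wtri j θ G p).toReal) := by
  by_cases hp : p.1 = 0 ∨ p.2 = 0 ∨ thd p = 0
  · rw [flux, hu.cubic_eq_zero hδ hp]
    simp only [Complex.zero_im, mul_zero, neg_zero, abs_zero]
    positivity
  push Not at hp
  rw [flux, abs_neg, abs_mul, abs_mul, abs_mul, abs_of_nonneg (sq_nonneg (mult φ N (thd p))),
    abs_of_pos (quad_pos p)]
  calc _ ≤ (C * kmax p ^ j * (mult φ N p.1 * mult φ N p.2 * mult φ N (thd p)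
          * (bracket p.1 * bracket p.2 * bracket (thd p)))) * ‖cubic δ u p‖ := by
        have h := hm p hp.1 hp.2.1 hp.2.2
        exact mul_le_mul h (Complex.abs_im_le_norm _) (abs_nonneg _)
          ((mul_nonneg (mul_nonneg (sq_nonneg _) (abs_nonneg _)) (quad_pos p).le).trans h)
    _ = C * (kmax p ^ j * (mult φ N p.1 * mult φ N p.2 * mult φ N (thd p)
          * (bracket p.1 * bracket p.2 * bracket (thd p))) * ‖cubic δ u p‖) := by ring
    _ ≤ _ := mul_le_mul_of_nonneg_left (hu.norm_cubic_le hδ hφ hG hdom hθ hθ1 hfin) hC.le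

/-- Both `quad` and `cubic` are invariant under permuting the frequencies, so only the factor `m² k`
changes when another frequency takes the place of the output. -/
theorem flux_add_flux_add_flux (p : ℤ × ℤ) :
    flux φ N δ u (swapThd p) + flux φ N δ u (swapThd p.swap) + flux φ N δ u p =
      -((mult φ N p.1 ^ 2 * p.1 + mult φ N p.2 ^ 2 * p.2 + mult φ N (thd p) ^ 2 * thd p)
        * quad p * (cubic δ u p).im) := by
  simp only [flux, thd_swapThd, quad_swapThd, quad_swap, cubic_swapThd, cubic_swap, Prod.fst_swap]
  ring

theorem abs_flux_add_le (hu : IsSolution j s δ u) (hδ : 0 < δ) (hφ : IsProfile s φ) {C : ℝ}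
    (hC : 0 < C) (hN : 1 ≤ N)
    (hm : ∀ p : ℤ × ℤ, p.1 ≠ 0 → p.2 ≠ 0 → thd p ≠ 0 →
      |mult φ N p.1 ^ 2 * p.1 + mult φ N p.2 ^ 2 * p.2 + mult φ N (thd p) ^ 2 * thd p| * quad p
        ≤ C * (kmax p / N) ^ j * (mult φ N p.1 * mult φ N p.2 * mult φ N (thd p)
          * (bracket p.1 * bracket p.2 * bracket (thd p))))
    (hG : ∀ k, Measurable (G k)) (hdom : Dominates φ N δ u G) (hθ : 0 ≤ θ) (hθ1 : θ ≤ 1)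
    {p : ℤ × ℤ} (hfin : wtri j θ G p ≠ ⊤) :
    |flux φ N δ u (swapThd p) + flux φ N δ u (swapThd p.swap) + flux φ N δ u p|
      ≤ C * (N ^ j)⁻¹ * (2 * δ ^ θ * (wtri j θ G p).toReal) := by
  have hN0 : 0 < N := by linarith
  rw [flux_add_flux_add_flux]
  by_cases hp : p.1 = 0 ∨ p.2 = 0 ∨ thd p = 0
  · rw [hu.cubic_eq_zero hδ hp]
    simp only [Complex.zero_im, mul_zero, neg_zero, abs_zero]
    positivity
  push Not at hp
  rw [abs_neg, abs_mul, abs_mul, abs_of_pos (quad_pos p)]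
  calc _ ≤ (C * (kmax p / N) ^ j * (mult φ N p.1 * mult φ N p.2 * mult φ N (thd p)
          * (bracket p.1 * bracket p.2 * bracket (thd p)))) * ‖cubic δ u p‖ := by
        have h := hm p hp.1 hp.2.1 hp.2.2
        exact mul_le_mul h (Complex.abs_im_le_norm _) (abs_nonneg _)
          ((mul_nonneg (abs_nonneg _) (quad_pos p).le).trans h)
    _ = C * (N ^ j)⁻¹ * (kmax p ^ j * (mult φ N p.1 * mult φ N p.2 * mult φ N (thd p)
          * (bracket p.1 * bracket p.2 * bracket (thd p))) * ‖cubic δ u p‖) := by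
        rw [div_pow]; ring
    _ ≤ _ := mul_le_mul_of_nonneg_left (hu.norm_cubic_le hδ hφ hG hdom hθ hθ1 hfin) (by positivity)

theorem hasSum_energy_sub (hu : IsSolution j s δ u) (hj : 1 ≤ j) (hδ : 0 < δ)
    (hφ : IsProfile s φ) (hs : (2 - (j : ℝ)) / 2 ≤ s) (hs1 : s < 1) (hN : 1 ≤ N)
    (hG : ∀ k, Measurable (G k)) (hG0 : ∀ τ, G 0 τ = 0) (hdom : Dominates φ N δ u G)
    (hE : energy j G ≠ ⊤) (hflux : Summable (flux φ N δ u)) :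
    sobolevNorm 1 (opI φ N (u δ)) ^ 2 - sobolevNorm 1 (opI φ N (u 0)) ^ 2
      = ∑' p, flux φ N δ u p := by
  have hS : ∀ t ∈ Set.Icc 0 δ, MemSobolev 1 (opI φ N (u t)) := fun t ht =>
    hφ.memSobolev_opI hs1 hN (hu.mem t ht)
  rw [sq_sobolevNorm, sq_sobolevNorm,
    ← (hS δ ⟨hδ.le, le_rfl⟩).tsum_sub (hS 0 ⟨le_rfl, hδ.le⟩)]
  have h1 : ∀ k : ℤ, HasSum (fun l => flux φ N δ u (l, k - l))
      (bracket k ^ (2 * (1 : ℝ)) * ‖opI φ N (u δ) k‖ ^ 2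
        - bracket k ^ (2 * (1 : ℝ)) * ‖opI φ N (u 0) k‖ ^ 2) := by
    intro k
    have h := (hu.hasSum_mode_of_dominates hj hδ hφ hs hs1 hN hG hG0 hdom hE k).mul_left
      ((1 + (k : ℝ) ^ 2) * mult φ N k ^ 2)
    have hm : 0 < mult φ N k := hφ.pos _
    have hop : ∀ t, ‖opI φ N (u t) k‖ = mult φ N k * ‖u t k‖ := fun t => by
      rw [opI, norm_mul, Complex.norm_real]
      exact congrArg (· * ‖u t k‖) (Real.norm_of_nonneg hm.le)
    have hb : bracket k ^ (2 * (1 : ℝ)) = 1 + (k : ℝ) ^ 2 := by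
      rw [mul_one, ← sq_bracket, ← Real.rpow_natCast, Nat.cast_ofNat]
    rw [show ∀ x y : ℝ, bracket k ^ (2 * (1 : ℝ)) * x - bracket k ^ (2 * (1 : ℝ)) * y
      = bracket k ^ (2 * (1 : ℝ)) * (x - y) from fun x y => by ring, hop, hop, hb,
      show ∀ x y m : ℝ, (m * x) ^ 2 - (m * y) ^ 2 = m ^ 2 * (x ^ 2 - y ^ 2) from
        fun x y m => by ring, ← mul_assoc]
    convert! h using 2 with l
    have hthd : thd (l, k - l) = -k := by simp only [thd]; ring
    have : (1 + (k : ℝ) ^ 2) ≠ 0 := by positivity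
    rw [flux, hthd, mult_neg]
    push_cast
    field_simp
  -- A pair of output `k` and input `l` becomes the triple `l`, `k - l`, `-k`; summing first over
  -- `l` gives the modes.
  let e : ℤ × ℤ ≃ ℤ × ℤ :=
    { toFun := fun q => (q.2, q.1 - q.2)
      invFun := fun q => (q.1 + q.2, q.1)
      left_inv := fun q => by simp
      right_inv := fun q => by simp }
  have h2 : HasSum (fun q => flux φ N δ u (e q)) (∑' p, flux φ N δ u p) :=
    e.hasSum_iff.2 hflux.hasSum
  exact (h2.prod_fiberwise h1).tsum_eq

/-- The increment of the energy of `I u`, bounded by the dominated trilinear sum. -/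
theorem abs_energy_sub_le (hu : IsSolution j s δ u) (hj : 1 ≤ j) (hδ : 0 < δ)
    (hφ : IsProfile s φ) (hs : (2 - (j : ℝ)) / 2 ≤ s) (hs1 : s < 1) (hN : 1 ≤ N)
    (hG : ∀ k, Measurable (G k)) (hG0 : ∀ τ, G 0 τ = 0) (hdom : Dominates φ N δ u G)
    (hE : energy j G ≠ ⊤) (hθ : 0 ≤ θ) (hθ1 : θ ≤ 1) {C : ℝ} (hC : 0 < C)
    (hm : ∀ p : ℤ × ℤ, p.1 ≠ 0 → p.2 ≠ 0 → thd p ≠ 0 →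
      |mult φ N p.1 ^ 2 * p.1 + mult φ N p.2 ^ 2 * p.2 + mult φ N (thd p) ^ 2 * thd p| * quad p
        ≤ C * (kmax p / N) ^ j * (mult φ N p.1 * mult φ N p.2 * mult φ N (thd p)
          * (bracket p.1 * bracket p.2 * bracket (thd p))) ∧
      mult φ N (thd p) ^ 2 * |(thd p : ℝ)| * quad p
        ≤ C * kmax p ^ j * (mult φ N p.1 * mult φ N p.2 * mult φ N (thd p)
          * (bracket p.1 * bracket p.2 * bracket (thd p))))
    (hsum : ∑' p, wtri j θ G p ≠ ⊤) :
    |sobolevNorm 1 (opI φ N (u δ)) ^ 2 - sobolevNorm 1 (opI φ N (u 0)) ^ 2|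
      ≤ C * (N ^ j)⁻¹ * δ ^ θ * (∑' p, wtri j θ G p).toReal := by
  have hfin : ∀ p, wtri j θ G p ≠ ⊤ := fun p => ENNReal.ne_top_of_tsum_ne_top hsum p
  have hw := ENNReal.summable_toReal hsum
  have hflux : Summable (flux φ N δ u) :=
    Summable.of_norm_bounded ((hw.mul_left (2 * δ ^ θ)).mul_left C) fun p =>
      hu.abs_flux_le hδ hφ hC (fun p h1 h2 h3 => (hm p h1 h2 h3).2) hG hdom hθ hθ1 (hfin p)
  rw [hu.hasSum_energy_sub hj hδ hφ hs hs1 hN hG hG0 hdom hE hflux]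
  -- By absolute summability the total flux is unchanged by relabelling, so three times it is the
  -- sum of the symmetrised flux.
  have s1 : HasSum (fun p => flux φ N δ u (swapThd p)) (∑' p, flux φ N δ u p) :=
    swapThd.hasSum_iff.2 hflux.hasSum
  have s2 : HasSum (fun p : ℤ × ℤ => flux φ N δ u (swapThd p.swap)) (∑' p, flux φ N δ u p) :=
    (Equiv.prodComm ℤ ℤ).hasSum_iff.2 s1
  have s3 := (s1.add s2).add hflux.hasSum
  have h3 : ‖∑' p, flux φ N δ u p + ∑' p, flux φ N δ u p + ∑' p, flux φ N δ u p‖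
      ≤ ∑' p, C * (N ^ j)⁻¹ * (2 * δ ^ θ * (wtri j θ G p).toReal) := by
    rw [← s3.tsum_eq]
    exact tsum_of_norm_bounded ((hw.mul_left (2 * δ ^ θ)).mul_left (C * (N ^ j)⁻¹)).hasSum fun p =>
      hu.abs_flux_add_le hδ hφ hC hN (fun p h1 h2 h3 => (hm p h1 h2 h3).1) hG hdom hθ hθ1 (hfin p)
  rw [tsum_mul_left, tsum_mul_left, ← ENNReal.tsum_toReal_eq hfin, Real.norm_eq_abs] at h3
  set F := ∑' p, flux φ N δ u p
  -- The factor `2 / 3`, from the exponential integral and the threefold count, is bounded by `1`.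
  have e : |F + F + F| = 3 * |F| := by
    rw [show F + F + F = 3 * F by ring, abs_mul, abs_of_pos (by norm_num : (0 : ℝ) < 3)]
  have h0 : 0 ≤ C * (N ^ j)⁻¹ * δ ^ θ * (∑' p, wtri j θ G p).toReal := by
    have : 0 < N := by linarith
    positivity
  rw [e] at h3
  linarith

end IsSolution

/-! ### From extensions of `Iu` to dominating families -/

/-- The moduli of the Fourier transforms of the nonconstant modes of `v`. -/
noncomputable def modulus (v : ℤ → Lp ℂ 2 (volume : Measure ℝ)) (k : ℤ) (τ : ℝ) : ℝ≥0∞ :=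
  if k = 0 then 0 else ‖timeFourier (v k) τ‖ₑ

theorem measurable_modulus (v : ℤ → Lp ℂ 2 (volume : Measure ℝ)) (k : ℤ) :
    Measurable (modulus v k) := by
  have := measurable_timeFourier (v k)
  unfold modulus
  split_ifs <;> fun_prop

theorem energy_modulus_le (j : ℕ) (v : ℤ → Lp ℂ 2 (volume : Measure ℝ)) :
    energy j (modulus v) ^ (3 / 2 : ℝ) ≤ xNorm j 1 (1 / 2) v ^ 3 := by
  rw [xNorm, ← ENNReal.rpow_natCast, ← ENNReal.rpow_mul,
    show (1 / 2 : ℝ) * ((3 : ℕ) : ℝ) = 3 / 2 by norm_num]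
  refine ENNReal.rpow_le_rpow (ENNReal.tsum_le_tsum fun k => ?_) (by norm_num)
  rw [← lintegral_const_mul' _ _ (ENNReal.pow_ne_top (jb_ne_top _))]
  refine lintegral_mono fun τ => ?_
  have h1 := (bracket_pos k).le
  have h2 := (bracket_pos (τ + phase j k)).le
  have e : ENNReal.ofReal (bracket k ^ (2 * (1 : ℝ)) * bracket (τ + phase j k) ^ (2 * (1 / 2 : ℝ))
      * ‖timeFourier (v k) τ‖ ^ 2) = jb k ^ 2 * (jb (τ + phase j k) * ‖timeFourier (v k) τ‖ₑ ^ 2) := by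
    rw [show (2 * (1 / 2 : ℝ)) = 1 by norm_num, Real.rpow_one, mul_one,
      show bracket k ^ (2 : ℝ) = bracket k ^ 2 by rw [← Real.rpow_natCast, Nat.cast_ofNat],
      ENNReal.ofReal_mul (by positivity), ENNReal.ofReal_mul (by positivity),
      ENNReal.ofReal_pow h1, ENNReal.ofReal_pow (norm_nonneg _), ofReal_norm, mul_assoc, jb, jb]
  rw [e]
  gcongr
  unfold modulus
  split_ifs <;> simp

/-- The zero mode of an extension may be discarded because that of the solution vanishes on `[0,
δ]`. This supplies the condition `G 0 = 0` of the trilinear estimate. -/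
theorem IsSolution.dominates_modulus {j : ℕ} {s δ : ℝ} {u : ℝ → ℤ → ℂ} {φ : ℝ → ℝ} {N : ℝ}
    (hu : IsSolution j s δ u) (hδ : 0 < δ) {v : ℤ → Lp ℂ 2 (volume : Measure ℝ)}
    (hv : ∀ k : ℤ, ∀ᵐ t ∂(volume.restrict (Set.Icc 0 δ)), v k t = opI φ N (u t) k) :
    Dominates φ N δ u (modulus v) := by
  intro k α β h hαβ hα hβ
  rcases eq_or_ne k 0 with rfl | hk
  · intro w _
    simp [hu.extend_zero hδ]
  · have : modulus v k = fun τ => ‖timeFourier (v k) τ‖ₑ := by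
      ext τ; simp [modulus, hk]
    rw [this]
    refine fourierDom_of_ae_eq (a := fun t => (mult φ N k : ℂ) * extend δ u k t) ?_ hαβ hα hβ
    filter_upwards [hv k, ae_restrict_mem measurableSet_Icc] with t ht htm
    rw [ht, extend_eq htm]
    rfl

/-- Taking cube roots moves the bound inside the infimum; this needs the constant to be neither `0`
nor `⊤`. -/
theorem le_mul_iInf_pow_three {ι : Sort*} {L c : ℝ≥0∞} (hc : c ≠ 0) (hc' : c ≠ ⊤) {x : ι → ℝ≥0∞}
    (h : ∀ i, L ≤ c * x i ^ 3) : L ≤ c * (⨅ i, x i) ^ 3 := by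
  have e : ∀ y : ℝ≥0∞, (y ^ 3) ^ (1 / 3 : ℝ) = y := fun y => by
    rw [← ENNReal.rpow_natCast, ← ENNReal.rpow_mul]; norm_num
  have e' : ∀ y : ℝ≥0∞, (y ^ (1 / 3 : ℝ)) ^ 3 = y := fun y => by
    rw [← ENNReal.rpow_natCast, ← ENNReal.rpow_mul]; norm_num
  have h1 : (L / c) ^ (1 / 3 : ℝ) ≤ ⨅ i, x i := le_iInf fun i => by
    rw [← e (x i)]
    refine ENNReal.rpow_le_rpow ?_ (by norm_num)
    rw [ENNReal.div_le_iff' hc hc']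
    exact h i
  have h2 := pow_le_pow_left' h1 3
  rwa [e', ENNReal.div_le_iff' hc hc'] at h2

end ShallowWater

/-! ### The almost conservation law -/

theorem lemma5p4 (j : ℕ) (hj : 1 ≤ j) (s : ℝ) (hs : (2 - (j : ℝ)) / 2 ≤ s) (hs1 : s < 1)
    (ε : ℝ) (hε : 0 < ε) (hε1 : ε < 1 / (10000 * (2 * (j : ℝ) + 1)))
    (φ : ℝ → ℝ) (hφ : ShallowWater.IsProfile s φ) :
    ∃ C : ℝ, 0 < C ∧ ∀ N : ℝ, 1 ≤ N → ∀ δ : ℝ, 0 < δ → ∀ u : ℝ → ℤ → ℂ,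
      ShallowWater.IsSolution j s δ u →
        ENNReal.ofReal
            |ShallowWater.sobolevNorm 1 (ShallowWater.opI φ N (u δ)) ^ 2
              - ShallowWater.sobolevNorm 1 (ShallowWater.opI φ N (u 0)) ^ 2|
          ≤ ENNReal.ofReal (C * δ ^ ((j : ℝ) / (2 * (j : ℝ) + 1) - 2 * ε) * N ^ (-(j : ℝ)))
            * ShallowWater.xNormOn j 1 (1 / 2) δ (fun t => ShallowWater.opI φ N (u t)) ^ 3 := by
  have hj' : (1 : ℝ) ≤ j := by exact_mod_cast hj
  obtain ⟨θ, hθ⟩ : ∃ θ : ℝ, θ = (j : ℝ) / (2 * (j : ℝ) + 1) - 2 * ε := ⟨_, rfl⟩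
  -- The smallness of `ε` makes `2ε` less than `1 / (2j + 1) ≤ j / (2j + 1)`.
  have hθ0 : 0 < θ := by
    have h1 : 1 / (2 * (j : ℝ) + 1) ≤ (j : ℝ) / (2 * (j : ℝ) + 1) := by gcongr
    have h2 : 1 / (10000 * (2 * (j : ℝ) + 1)) = 1 / (2 * (j : ℝ) + 1) / 10000 := by
      field_simp
    have h3 : 0 < 1 / (2 * (j : ℝ) + 1) := by positivity
    linarith
  have hθ1 : θ < 1 / 2 := by
    have : (j : ℝ) / (2 * (j : ℝ) + 1) < 1 / 2 := by
      rw [div_lt_div_iff₀ (by positivity) two_pos]; linarith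
    linarith
  rw [← hθ]
  obtain ⟨C, hC, hm⟩ := hφ.exists_mult_le hj hs hs1
  obtain ⟨D, hD, hw⟩ := ShallowWater.exists_tsum_wtri_le hj hθ0 hθ1
  -- The summand `1` keeps the constant positive even if `D = 0`; otherwise the bound could read `0
  -- * ⊤ = 0` for extensions of infinite norm.
  refine ⟨C * (D.toReal + 1), by positivity, fun N hN δ hδ u hu => ?_⟩
  have hN0 : 0 < N := by linarith
  have hc : 0 < C * (D.toReal + 1) * δ ^ θ * N ^ (-(j : ℝ)) := by positivity
  have hc0 := (ENNReal.ofReal_pos.2 hc).ne'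
  unfold ShallowWater.xNormOn
  simp_rw [iInf_subtype']
  refine ShallowWater.le_mul_iInf_pow_three hc0 ENNReal.ofReal_ne_top fun v => ?_
  obtain ⟨v, hv⟩ := v
  simp only
  by_cases htop : ShallowWater.xNorm j 1 (1 / 2) v = ⊤
  · rw [htop, ENNReal.top_pow (by norm_num), ENNReal.mul_top hc0]
    exact le_top
  have hle := ShallowWater.energy_modulus_le j v
  have hE : ShallowWater.energy j (ShallowWater.modulus v) ^ (3 / 2 : ℝ) ≠ ⊤ :=
    ne_top_of_le_ne_top (ENNReal.pow_ne_top htop) hle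
  have hE' : ShallowWater.energy j (ShallowWater.modulus v) ≠ ⊤ := fun h => by
    rw [h, ENNReal.top_rpow_of_pos (by norm_num)] at hE
    exact hE rfl
  have hG0 : ∀ τ, ShallowWater.modulus v 0 τ = 0 := fun τ => by simp [ShallowWater.modulus]
  have hsum := hw _ (ShallowWater.measurable_modulus v) hG0
  have hfin := ne_top_of_le_ne_top (ENNReal.mul_ne_top hD hE) hsum
  have key := hu.abs_energy_sub_le hj hδ hφ hs hs1 hN (ShallowWater.measurable_modulus v) hG0
    (hu.dominates_modulus hδ hv) hE' hθ0.le (by linarith) hC (hm N hN) hfin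
  refine (ENNReal.ofReal_le_ofReal key).trans ?_
  have hc1 : 0 ≤ C * (N ^ j)⁻¹ * δ ^ θ := by positivity
  rw [ENNReal.ofReal_mul hc1, ENNReal.ofReal_toReal hfin, Real.rpow_neg hN0.le, Real.rpow_natCast,
    show C * (D.toReal + 1) * δ ^ θ * (N ^ j)⁻¹ = C * (N ^ j)⁻¹ * δ ^ θ * (D.toReal + 1) by ring,
    ENNReal.ofReal_mul hc1, mul_assoc (ENNReal.ofReal _)]
  refine mul_le_mul_right (hsum.trans (mul_le_mul' ?_ hle)) _
  rw [← ENNReal.ofReal_toReal hD]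
  exact ENNReal.ofReal_le_ofReal (by rw [ENNReal.toReal_ofReal ENNReal.toReal_nonneg]; linarith)
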